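/- Let $\{A_j^{(i)} : j\in\mathbb{N},\, i\in\mathbb{Z}\}$ be i.i.d. nonnegative integer-valued random variables, independent of another i.i.d. sequence $\{B_i : i\in\mathbb{Z}\}$ of nonnegative integer-valued random variables, and let $A$ and $B$ denote generic copies of $A_j^{(i)}$ and $B_i$. Put $\mu_A := \mathbb{E}[A]$, $\sigma_A^2 := \mathrm{Var}(A)$, $\mu_B := \mathbb{E}[B]$, and suppose that (i) $\mu_A\in(0,1)$; (ii) $\sigma_A^2\in(0,\infty)$; (iii) $B$ is regularly varying with tail index $\alpha\in(1,2)$, i.e. $\lim_{x\to\infty} \mathbb{P}(B>qx)/\mathbb{P}(B>x) = q^{-\alpha}$ for all $q\in(0,\infty)$. Let $(X_i)_{i\in\mathbb{Z}}$ be a strongly stationary process of nonnegative integer-valued random variables satisfying, almost surely, $$X_i = \sum_{j=1}^{X_{i-1}} A_j^{(i)} + B_i, \qquad i\in\mathbb{Z},$$ and let $M_i := X_i - \mu_A X_{i-1} - \mu_B$, $i\in\mathbb{Z}$. Let $Y_0$ be a random variable with $\mathbb{P}(Y_0\ge y) = y^{-\alpha}$ for all $y\ge 1$, let $K$ be a random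 variable independent of $Y_0$ with $\mathbb{P}(K=k) = \mu_A^{\alpha k}(1-\mu_A^\alpha)$ for $k=0,1,2,\dots$, and let $(Z_i)_{i\ge 0}$ be an i.i.d. sequence of $\mathcal{N}(0,\sigma_A^2)$-distributed random variables independent of $(Y_0,K)$. Set $Y_i := \mu_A^i Y_0$ for $i\geq 0$ and $Y_i := \mu_A^{i}\,\mathbf{1}_{\{K\ge |i|\}}\,Y_0$ for $i<0$. Then for every integer $m\ge 0$, as $x\to\infty$ (through the real numbers), the conditional law of $$\left(\frac{X_{-m}}{x},\dots,\frac{X_m}{x},\ \frac{M_1}{\sqrt{X_0\vee 1}},\dots,\frac{M_{m+1}}{\sqrt{X_m\vee 1}}\right)$$ given $X_0>x$ converges weakly to the law of $(Y_{-m},\dots,Y_m,Z_0,\dots,Z_m)$. -/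

import Mathlib

open MeasureTheory ProbabilityTheory Filter Topology

noncomputable section

namespace GWI

variable {Ω E : Type*} [MeasurableSpace Ω] [MeasurableSpace E]

/-- A two-sided strongly stationary Galton-Watson process with immigration `X`, with offspring
numbers `A i j` and immigration numbers `B i`. The offspring of the individuals of generation
`i - 1` are numbered `j = 0, 1, 2, …`, so that the sum over `j < X (i - 1)` has `X (i - 1)` terms.
All the variables `A i j` and `B i` are jointly independent, that is, each of the two families is
independent and the families are independent of each other. -/
structure IsStationaryGWI (P : Measure Ω) (X : ℤ → Ω → ℕ) (A : ℤ → ℕ → Ω → ℕ)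
    (B : ℤ → Ω → ℕ) : Prop where
  measurable_X : ∀ i, Measurable (X i)
  measurable_A : ∀ i j, Measurable (A i j)
  measurable_B : ∀ i, Measurable (B i)
  identDistrib_A : ∀ i j, IdentDistrib (A i j) (A 0 0) P P
  identDistrib_B : ∀ i, IdentDistrib (B i) (B 0) P P
  indep : iIndepFun (Sum.elim (fun p : ℤ × ℕ => A p.1 p.2) B) P
  stationary : ∀ h : ℤ,
    IdentDistrib (fun (ω : Ω) (i : ℤ) => X (i + h) ω) (fun (ω : Ω) (i : ℤ) => X i ω) P P
  recursion : ∀ i : ℤ, ∀ᵐ ω ∂P, X i ω = (∑ j ∈ Finset.range (X (i - 1) ω), A i j ω) + B i ω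

/-- The random variable `U` is regularly varying (at infinity) with tail index `α`. -/
def IsRegularlyVarying (P : Measure Ω) (U : Ω → ℝ) (α : ℝ) : Prop :=
  ∀ q : ℝ, 0 < q →
    Tendsto (fun x : ℝ => P.real {ω | q * x < U ω} / P.real {ω | x < U ω}) atTop (𝓝 (q ^ (-α)))

/-- The martingale differences `M_i = X_i - μ_A X_{i-1} - μ_B`. -/
def M (μA μB : ℝ) (X : ℤ → Ω → ℕ) (i : ℤ) (ω : Ω) : ℝ :=
  (X i ω : ℝ) - μA * (X (i - 1) ω : ℝ) - μB

/-- The tail process `Y_i`, which is `μ_A ^ i * Y₀` for `i ≥ 0` and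
`μ_A ^ i * 1{K ≥ |i|} * Y₀` for `i < 0`. -/
def tailProcess (μA : ℝ) (Y₀ : Ω → ℝ) (K : Ω → ℕ) (i : ℤ) (ω : Ω) : ℝ :=
  if 0 ≤ i then μA ^ i * Y₀ ω
  else if |i| ≤ (K ω : ℤ) then μA ^ i * Y₀ ω
  else 0

/-- The space `ℝ^(2m+1) × ℝ^(m+1)`, with the first coordinates indexed by `-m, …, m` and the last
ones by `0, …, m`. -/
abbrev VecSpace (m : ℕ) : Type :=
  (Finset.Icc (-(m : ℤ)) (m : ℤ) → ℝ) × (Fin (m + 1) → ℝ)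

/-- The vector `(X_{-m}/x, …, X_m/x, M_1/√(X_0 ∨ 1), …, M_{m+1}/√(X_m ∨ 1))`. -/
def scaledVec (μA μB : ℝ) (X : ℤ → Ω → ℕ) (m : ℕ) (x : ℝ) (ω : Ω) : VecSpace m :=
  (fun i => (X i ω : ℝ) / x,
   fun k => M μA μB X ((k : ℤ) + 1) ω / √(max (X (k : ℤ) ω : ℝ) 1))

/-- The vector `(Y_{-m}, …, Y_m, Z_0, …, Z_m)`. -/
def limitVec (μA : ℝ) (Y₀ : Ω → ℝ) (K : Ω → ℕ) (Z : ℕ → Ω → ℝ) (m : ℕ) (ω : Ω) : VecSpace m :=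
  (fun i => tailProcess μA Y₀ K i ω, fun k => Z k ω)

/-- The law of `V`. Finite measures carry the topology of weak convergence. -/
def law (P : Measure Ω) [IsFiniteMeasure P] (V : Ω → E) : FiniteMeasure E :=
  ⟨P.map V, inferInstance⟩

/-- The law of `V` conditionally on the event `s`; it is a probability measure for measurable `V`
when `s` has positive probability, and the zero measure when `s` has probability zero. -/
def condLaw (P : Measure Ω) [IsFiniteMeasure P] (V : Ω → E) (s : Set Ω) : FiniteMeasure E :=
  ⟨(cond P s).map V, inferInstance⟩

end GWI

end

/-! The proof rests on the principle of a single big jump. Since `α > 1`, immigration and hence the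
stationary law have finite mean. Chebyshev's inequality then shows that the offspring of generation
`k` differ from `μ * X k` by more than `y` with probability `O(y⁻²)`. Since `α < 2`, this is
negligible against a tail of index `-α`. On the scale of tail events the process therefore obeys `X
(k + 1) ≈ μ * X k + B (k + 1)`, with independent summands that are almost never both large. So the
stationary tail `p` satisfies `p x ≈ p (x / μ) + b x`, where `b` is the tail of `B`, and iteration
gives `p ∼ b / (1 - μ ^ α)` (`IsRVTail.tendsto_div_of_recursion`, `isRVTail_tail`). In particular `X
0 / x` given `X 0 > x` is asymptotically Pareto.

Given `X 0 > x`, the path after time `0` decays geometrically (`tendsto_deviation`). Before time `0`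
it follows the same geometric curve backwards to the generation of the big jump, and is negligible
earlier (`exists_spine`). By stationarity, the event that the ancestors `k` generations back were
already large has relative probability tending to `μ ^ (α * k)`, which is the tail of the geometric
variable `K`. It leaves the limit law of `X 0 / x` unchanged (`tendsto_tailMean_ancestor`). A
telescoping sum over the age of the big jump, `spineExp`, turns this into the limit of the
characteristic function of the whole path.

For the normalized increments, the offspring and immigration numbers of generation `k + 1` are
independent of the past of `X`. This needs an argument, since stationarity alone does not say that
`X` is a function of past innovations: causality is derived from a coupling in which the influence
of a remote initial population dies out (`indepFun_history_innovation`). Given `X 0 > x`, the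
generations from `0` on are large, so the central limit theorem applies to one increment after
another. Peeling off the last one each time produces Gaussian factors, asymptotically independent of
the past (`tendsto_tailMean_mul_prod`). Lévy's continuity theorem concludes. -/

set_option linter.unusedSectionVars false

noncomputable section

/-! ### Regularly varying tails. -/

namespace GWI

/-- A nonincreasing function that is regularly varying at infinity with index `-α`. -/
structure IsRVTail (b : ℝ → ℝ) (α : ℝ) : Prop where
  antitone : Antitone b
  nonneg : ∀ x, 0 ≤ b x
  tendsto_div : ∀ q : ℝ, 0 < q → Tendsto (fun x => b (q * x) / b x) atTop (𝓝 (q ^ (-α)))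

namespace IsRVTail

variable {b : ℝ → ℝ} {α : ℝ}

/-- With the convention `0 / 0 = 0`, the limit `b y / b y → 1` forces `b y ≠ 0` for some `y ≥ x`.
Monotonicity carries positivity back to `x`. -/
lemma pos (hb : IsRVTail b α) (x : ℝ) : 0 < b x := by
  have h := hb.tendsto_div 1 one_pos
  simp only [one_mul, Real.one_rpow] at h
  have h2 : ∀ᶠ y in atTop, 0 < b y / b y := h.eventually (lt_mem_nhds one_pos)
  obtain ⟨y, hy, hxy⟩ := (h2.and (eventually_ge_atTop x)).exists
  have : b y ≠ 0 := by
    intro h0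
    simp [h0] at hy
  exact lt_of_lt_of_le (lt_of_le_of_ne (hb.nonneg y) this.symm) (hb.antitone hxy)

lemma eventually_le_mul (hb : IsRVTail b α) {q θ : ℝ} (hq : 0 < q) (h : q ^ (-α) < θ) :
    ∀ᶠ x in atTop, b (q * x) ≤ θ * b x := by
  filter_upwards [(hb.tendsto_div q hq).eventually (gt_mem_nhds h)] with x hx
  exact ((div_lt_iff₀ (hb.pos x)).1 hx).le

lemma eventually_mul_le (hb : IsRVTail b α) {q θ : ℝ} (hq : 0 < q) (h : θ < q ^ (-α)) :
    ∀ᶠ x in atTop, θ * b x ≤ b (q * x) := by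
  filter_upwards [(hb.tendsto_div q hq).eventually (lt_mem_nhds h)] with x hx
  exact ((lt_div_iff₀ (hb.pos x)).1 hx).le

lemma le_pow_mul {κ θ x₀ x : ℝ} (hκ : 1 ≤ κ) (hx₀ : 0 ≤ x₀) (hθ : 0 ≤ θ)
    (h : ∀ x ≥ x₀, b (κ * x) ≤ θ * b x) (hx : x₀ ≤ x) (n : ℕ) :
    b (κ ^ n * x) ≤ θ ^ n * b x := by
  induction n with
  | zero => simp
  | succ n ih =>
    have h1 : x₀ ≤ κ ^ n * x := hx.trans (le_mul_of_one_le_left (hx₀.trans hx) (one_le_pow₀ hκ))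
    have := h _ h1
    calc b (κ ^ (n + 1) * x) = b (κ * (κ ^ n * x)) := by ring_nf
      _ ≤ θ * b (κ ^ n * x) := this
      _ ≤ θ * (θ ^ n * b x) := by gcongr
      _ = _ := by ring

lemma pow_mul_le {κ θ x₀ x : ℝ} (hκ : 1 ≤ κ) (hx₀ : 0 ≤ x₀) (hθ : 0 ≤ θ)
    (h : ∀ x ≥ x₀, θ * b x ≤ b (κ * x)) (hx : x₀ ≤ x) (n : ℕ) :
    θ ^ n * b x ≤ b (κ ^ n * x) := by
  induction n with
  | zero => simp
  | succ n ih =>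
    have h1 : x₀ ≤ κ ^ n * x := hx.trans (le_mul_of_one_le_left (hx₀.trans hx) (one_le_pow₀ hκ))
    have := h _ h1
    calc θ ^ (n + 1) * b x = θ * (θ ^ n * b x) := by ring
      _ ≤ θ * b (κ ^ n * x) := by gcongr
      _ ≤ b (κ * (κ ^ n * x)) := this
      _ = b (κ ^ (n + 1) * x) := by ring_nf

/-- Consecutive terms have ratio tending to `2 * 2 ^ (-α) < 1`. This is the dyadic form of a finite
first moment. -/
lemma summable_two_pow (hb : IsRVTail b α) (hα : 1 < α) :
    Summable (fun n : ℕ => (2 : ℝ) ^ n * b (2 ^ n)) := by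
  have h2 : (2 : ℝ) ^ (-α) < 2⁻¹ := by
    rw [← Real.rpow_neg_one]
    exact Real.rpow_lt_rpow_of_exponent_lt (by norm_num) (by linarith)
  refine summable_of_ratio_test_tendsto_lt_one (α := ℝ) (l := 2 * 2 ^ (-α)) (by linarith)
    (Eventually.of_forall fun n => (mul_pos (by positivity) (hb.pos _)).ne') ?_
  have h3 := ((hb.tendsto_div 2 (by norm_num)).comp
    (tendsto_pow_atTop_atTop_of_one_lt (by norm_num : (1 : ℝ) < 2))).const_mul 2
  refine h3.congr fun n => ?_
  have := hb.pos (2 ^ n)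
  simp only [Function.comp_apply, norm_mul, norm_pow, Real.norm_ofNat, Real.norm_eq_abs,
    abs_of_pos (hb.pos _)]
  rw [← pow_succ']
  field_simp
  ring

/-- Doubling a large `x` multiplies `x ^ 2` by `4` and `b x` by at least some `θ > 1 / 4`, so the
product grows geometrically. This makes Chebyshev errors of order `x⁻²` negligible. -/
lemma tendsto_sq_mul (hb : IsRVTail b α) (hα : α < 2) :
    Tendsto (fun x => x ^ 2 * b x) atTop atTop := by
  have h2 : (4 : ℝ)⁻¹ < 2 ^ (-α) := by
    have : (4 : ℝ)⁻¹ = 2 ^ (-2 : ℝ) := by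
      rw [Real.rpow_neg (by norm_num)]; norm_num
    rw [this]
    exact Real.rpow_lt_rpow_of_exponent_lt (by norm_num) (by linarith)
  obtain ⟨θ, hθ1, hθ2⟩ := exists_between h2
  have hθ0 : 0 < θ := lt_trans (by norm_num) hθ1
  obtain ⟨x₀, hx₀'⟩ := eventually_atTop.1 (hb.eventually_mul_le (by norm_num : (0 : ℝ) < 2) hθ2)
  set y₀ := max x₀ 1 with hy₀
  have hy1 : 1 ≤ y₀ := le_max_right _ _
  have hx₀ : ∀ x ≥ y₀, θ * b x ≤ b (2 * x) := fun x hx => hx₀' x ((le_max_left _ _).trans hx)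
  -- On a dyadic block, `x ^ 2` is estimated at the left end and `b` at the right end, which costs
  -- one extra factor `θ`.
  have key : ∀ n : ℕ, ∀ x, 2 ^ n * y₀ ≤ x → x < 2 ^ (n + 1) * y₀ →
      (4 * θ) ^ n * (θ * b y₀) ≤ x ^ 2 * b x := by
    intro n x h1 h3
    have h4 := pow_mul_le (by norm_num) (by linarith) hθ0.le hx₀ le_rfl (n + 1)
    have h5 : b (2 ^ (n + 1) * y₀) ≤ b x := hb.antitone h3.le
    have h6 : (2 ^ n) ^ 2 ≤ x ^ 2 := by
      have : (2 : ℝ) ^ n ≤ 2 ^ n * y₀ := le_mul_of_one_le_right (by positivity) hy1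
      exact pow_le_pow_left₀ (by positivity) (this.trans h1) 2
    calc (4 * θ) ^ n * (θ * b y₀) = (2 ^ n) ^ 2 * (θ ^ (n + 1) * b y₀) := by
          rw [mul_pow, show (4 : ℝ) ^ n = (2 ^ n) ^ 2 by rw [← pow_mul, mul_comm, pow_mul]; norm_num]
          ring
      _ ≤ x ^ 2 * b x := mul_le_mul h6 (h4.trans h5)
          (mul_nonneg (by positivity) (hb.nonneg _)) (by positivity)
  rw [tendsto_atTop]
  intro C
  have h4 : Tendsto (fun n : ℕ => (4 * θ) ^ n * (θ * b y₀)) atTop atTop :=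
    (tendsto_pow_atTop_atTop_of_one_lt (by linarith)).atTop_mul_const
      (mul_pos hθ0 (hb.pos _))
  obtain ⟨N, hN⟩ := eventually_atTop.1 (h4.eventually_ge_atTop C)
  filter_upwards [eventually_ge_atTop (2 ^ N * y₀)] with x hx
  obtain ⟨n, hn1, hn2⟩ := exists_nat_pow_near (x := x / y₀) (y := 2)
    (by rw [le_div_iff₀ (by linarith)]
        have : (1 : ℝ) ≤ 2 ^ N := one_le_pow₀ (by norm_num)
        nlinarith) (by norm_num)
  rw [le_div_iff₀ (by linarith)] at hn1
  rw [div_lt_iff₀ (by linarith)] at hn2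
  have hNn : N ≤ n := by
    by_contra hlt
    have : (2 : ℝ) ^ (n + 1) ≤ 2 ^ N := pow_le_pow_right₀ (by norm_num) (by omega)
    have : (2 : ℝ) ^ (n + 1) * y₀ ≤ 2 ^ N * y₀ := by gcongr
    linarith
  exact (hN n hNn).trans (key n x hn1 hn2)

lemma tendsto_inv_sq_div (hb : IsRVTail b α) (hα : α < 2) (C : ℝ) :
    Tendsto (fun x => C / x ^ 2 / b x) atTop (𝓝 0) := by
  have := (hb.tendsto_sq_mul hα).inv_tendsto_atTop.const_mul C
  simp only [mul_zero] at this
  refine this.congr fun x => ?_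
  simp only [Pi.inv_apply, mul_inv, div_eq_mul_inv, mul_assoc]

end IsRVTail

/-! ### The asymptotic fixed point equation for tails. -/

section Recursion

variable {p b : ℝ → ℝ}

/-- Iterating the inequality along `κ ^ n * x` sums a geometric series in `θ`; the remainder `p (κ ^
n * x)` vanishes in the limit. -/
lemma eventually_le_of_le_add {κ θ c : ℝ} (hκ : 1 < κ) (hθ0 : 0 ≤ θ) (hθ : θ < 1)
    (hc : 0 ≤ c) (hp : Tendsto p atTop (𝓝 0))
    (h1 : ∀ᶠ x in atTop, b (κ * x) ≤ θ * b x) (h2 : ∀ᶠ x in atTop, p x ≤ p (κ * x) + c * b x) :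
    ∀ᶠ x in atTop, p x ≤ c / (1 - θ) * b x := by
  obtain ⟨x₀', hx₀⟩ := eventually_atTop.1 (h1.and h2)
  set x₀ := max x₀' 1
  have hx1 : 1 ≤ x₀ := le_max_right _ _
  have ha : ∀ x ≥ x₀, b (κ * x) ≤ θ * b x := fun x hx => (hx₀ x ((le_max_left _ _).trans hx)).1
  have hb2 : ∀ x ≥ x₀, p x ≤ p (κ * x) + c * b x :=
    fun x hx => (hx₀ x ((le_max_left _ _).trans hx)).2
  filter_upwards [eventually_ge_atTop x₀] with x hx
  have hx0 : 0 < x := by linarith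
  have key : ∀ n : ℕ, p x ≤ p (κ ^ n * x) + c / (1 - θ) * b x * (1 - θ ^ n) := by
    intro n
    induction n with
    | zero => simp
    | succ n ih =>
      have h3 : x₀ ≤ κ ^ n * x := hx.trans (le_mul_of_one_le_left hx0.le (one_le_pow₀ hκ.le))
      have h4 := hb2 _ h3
      have h5 := IsRVTail.le_pow_mul hκ.le (by linarith) hθ0 ha hx n
      have h6 : c * b (κ ^ n * x) ≤ c * (θ ^ n * b x) := by gcongr
      have h7 : κ ^ (n + 1) * x = κ * (κ ^ n * x) := by ring
      rw [h7]
      have h8 : c / (1 - θ) * b x * (1 - θ ^ (n + 1)) =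
          c / (1 - θ) * b x * (1 - θ ^ n) + c * (θ ^ n * b x) := by
        have : 1 - θ ≠ 0 := by linarith
        field_simp
        ring
      linarith
  have hl : Tendsto (fun n : ℕ => p (κ ^ n * x) + c / (1 - θ) * b x * (1 - θ ^ n)) atTop
      (𝓝 (0 + c / (1 - θ) * b x * (1 - 0))) := by
    refine Tendsto.add (hp.comp ((tendsto_pow_atTop_atTop_of_one_lt hκ).atTop_mul_const hx0)) ?_
    exact ((tendsto_pow_atTop_nhds_zero_of_lt_one hθ0 hθ).const_sub 1).const_mul _
  have := ge_of_tendsto' hl key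
  simpa using this

/-- The same iteration from below, where the remainder is simply dropped because it is nonnegative.
-/
lemma eventually_ge_of_add_le {κ θ c : ℝ} (hκ : 1 < κ) (hθ0 : 0 ≤ θ) (hθ : θ < 1)
    (hc : 0 ≤ c) (hp : ∀ x, 0 ≤ p x)
    (h1 : ∀ᶠ x in atTop, θ * b x ≤ b (κ * x)) (h2 : ∀ᶠ x in atTop, p (κ * x) + c * b x ≤ p x) :
    ∀ᶠ x in atTop, c / (1 - θ) * b x ≤ p x := by
  obtain ⟨x₀', hx₀⟩ := eventually_atTop.1 (h1.and h2)
  set x₀ := max x₀' 1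
  have hx1 : 1 ≤ x₀ := le_max_right _ _
  have ha : ∀ x ≥ x₀, θ * b x ≤ b (κ * x) := fun x hx => (hx₀ x ((le_max_left _ _).trans hx)).1
  have hb2 : ∀ x ≥ x₀, p (κ * x) + c * b x ≤ p x :=
    fun x hx => (hx₀ x ((le_max_left _ _).trans hx)).2
  filter_upwards [eventually_ge_atTop x₀] with x hx
  have hx0 : 0 < x := by linarith
  have key : ∀ n : ℕ, p (κ ^ n * x) + c / (1 - θ) * b x * (1 - θ ^ n) ≤ p x := by
    intro n
    induction n with
    | zero => simp
    | succ n ih =>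
      have h3 : x₀ ≤ κ ^ n * x := hx.trans (le_mul_of_one_le_left hx0.le (one_le_pow₀ hκ.le))
      have h4 := hb2 _ h3
      have h5 := IsRVTail.pow_mul_le hκ.le (by linarith) hθ0 ha hx n
      have h6 : c * (θ ^ n * b x) ≤ c * b (κ ^ n * x) := by gcongr
      have h7 : κ ^ (n + 1) * x = κ * (κ ^ n * x) := by ring
      rw [h7]
      have h8 : c / (1 - θ) * b x * (1 - θ ^ (n + 1)) =
          c / (1 - θ) * b x * (1 - θ ^ n) + c * (θ ^ n * b x) := by
        have : 1 - θ ≠ 0 := by linarith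
        field_simp
        ring
      linarith
  have hl : Tendsto (fun n : ℕ => c / (1 - θ) * b x * (1 - θ ^ n)) atTop
      (𝓝 (c / (1 - θ) * b x * (1 - 0))) :=
    ((tendsto_pow_atTop_nhds_zero_of_lt_one hθ0 hθ).const_sub 1).const_mul _
  have := le_of_tendsto' hl fun n => (by linarith [key n, hp (κ ^ n * x)] :
    c / (1 - θ) * b x * (1 - θ ^ n) ≤ p x)
  simpa using this

/-- A tail that satisfies, up to smaller terms, the fixed point equation
`p x = p (x / μ) + b x` with regularly varying `b` is asymptotically proportional to `b`. -/
lemma IsRVTail.tendsto_div_of_recursion {α μ : ℝ} (hb : IsRVTail b α) (hα : 0 < α)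
    (hμ : μ ∈ Set.Ioo (0 : ℝ) 1) (hp0 : ∀ x, 0 ≤ p x) (hp : Tendsto p atTop (𝓝 0))
    (hup : ∀ δ ∈ Set.Ioo (0 : ℝ) 1, ∃ e : ℝ → ℝ, Tendsto (fun x => e x / b x) atTop (𝓝 0) ∧
      ∀ᶠ x in atTop, p x ≤ p ((1 - δ) / μ * x) + b ((1 - δ) * x) + e x)
    (hlo : ∀ δ ∈ Set.Ioo (0 : ℝ) 1, ∃ e : ℝ → ℝ, Tendsto (fun x => e x / b x) atTop (𝓝 0) ∧
      ∀ᶠ x in atTop, p ((1 + δ) / μ * x) + b ((1 + δ) * x) - e x ≤ p x) :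
    Tendsto (fun x => p x / b x) atTop (𝓝 (1 / (1 - μ ^ α))) := by
  obtain ⟨hμ0, hμ1⟩ := hμ
  have hμα : μ ^ α < 1 := Real.rpow_lt_one hμ0.le hμ1 hα
  have hμα0 : 0 < μ ^ α := Real.rpow_pos_of_pos hμ0 _
  have hinv : (1 / μ) ^ (-α) = μ ^ α := by
    rw [one_div, Real.inv_rpow hμ0.le, Real.rpow_neg hμ0.le, inv_inv]
  -- the bounds as functions of a perturbation `u` of `0`
  have hθlim : Tendsto (fun u : ℝ => ((1 + u) / μ) ^ (-α)) (𝓝 0) (𝓝 (μ ^ α)) := by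
    have h1 : Tendsto (fun u : ℝ => (1 + u) / μ) (𝓝 0) (𝓝 (1 / μ)) := by
      have : ContinuousAt (fun u : ℝ => (1 + u) / μ) 0 := by fun_prop
      simpa [ContinuousAt] using this
    have := h1.rpow_const (p := -α) (Or.inl (by positivity))
    rwa [hinv] at this
  have hclim : Tendsto (fun u : ℝ => (1 + u) ^ (-α)) (𝓝 0) (𝓝 1) := by
    have h1 : Tendsto (fun u : ℝ => (1 + u)) (𝓝 0) (𝓝 1) := by
      have : ContinuousAt (fun u : ℝ => (1 + u)) 0 := by fun_prop
      simpa [ContinuousAt] using this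
    have := h1.rpow_const (p := -α) (Or.inl (by positivity))
    simpa using this
  have hnn : Tendsto (fun δ : ℝ => -δ) (𝓝[>] 0) (𝓝 0) := by
    have : Tendsto (fun δ : ℝ => -δ) (𝓝 0) (𝓝 (-0)) := continuous_neg.tendsto 0
    rw [neg_zero] at this
    exact this.mono_left nhdsWithin_le_nhds
  have hid : Tendsto (fun δ : ℝ => δ) (𝓝[>] 0) (𝓝 0) := tendsto_id.mono_left nhdsWithin_le_nhds
  rw [tendsto_order]
  constructor
  · intro a ha
    -- One parameter serves every loss: the dilation `1 + δ`, the slack in the two regular variation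
    -- estimates, and the bound `δ * b x` on the error `e x`. The resulting constant is continuous
    -- at `δ = 0`.
    have hl : Tendsto (fun δ : ℝ => ((1 + δ) ^ (-α) - δ - δ) / (1 - (((1 + δ) / μ) ^ (-α) - δ)))
        (𝓝[>] 0) (𝓝 ((1 - 0 - 0) / (1 - (μ ^ α - 0)))) :=
      (((hclim.comp hid).sub hid).sub hid).div
        (((hθlim.comp hid).sub hid).const_sub 1) (by linarith)
    have hc' := ((hclim.comp hid).sub hid).sub hid
    have hθ' := (hθlim.comp hid).sub hid
    simp only [sub_zero] at hl hc' hθ'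
    have e1 := hl.eventually (lt_mem_nhds ha)
    have e2 := hc'.eventually (lt_mem_nhds zero_lt_one)
    have e3 := hθ'.eventually (lt_mem_nhds hμα0)
    have e4 := hθ'.eventually (gt_mem_nhds hμα)
    have e5 : ∀ᶠ δ : ℝ in 𝓝[>] 0, δ ∈ Set.Ioo (0 : ℝ) 1 := Ioo_mem_nhdsGT one_pos
    obtain ⟨δ, h1, h2, h3, h4, h5⟩ := (e1.and (e2.and (e3.and (e4.and e5)))).exists
    simp only [Function.comp_apply] at h1 h2 h3 h4
    obtain ⟨e, he, hle⟩ := hlo δ h5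
    have hδ0 := h5.1
    have hκ : 1 < (1 + δ) / μ := by rw [lt_div_iff₀ hμ0]; linarith
    have f1 := hb.eventually_mul_le (by positivity : 0 < (1 + δ) / μ)
      (by linarith : ((1 + δ) / μ) ^ (-α) - δ < ((1 + δ) / μ) ^ (-α))
    have f2 := hb.eventually_mul_le (by positivity : 0 < (1 + δ))
      (by linarith : (1 + δ) ^ (-α) - δ < (1 + δ) ^ (-α))
    have f3 := he.eventually (gt_mem_nhds hδ0)
    have g : ∀ᶠ x in atTop, p ((1 + δ) / μ * x) + ((1 + δ) ^ (-α) - δ - δ) * b x ≤ p x := by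
      filter_upwards [f2, f3, hle] with x k1 k2 k3
      have k2' := (div_lt_iff₀ (hb.pos x)).1 k2
      linarith
    filter_upwards [eventually_ge_of_add_le hκ h3.le h4 h2.le hp0 f1 g] with x hx
    rw [lt_div_iff₀ (hb.pos x)]
    exact lt_of_lt_of_le (mul_lt_mul_of_pos_right h1 (hb.pos x)) hx
  · intro a ha
    have hl : Tendsto (fun δ : ℝ => ((1 + -δ) ^ (-α) + δ + δ) / (1 - (((1 + -δ) / μ) ^ (-α) + δ)))
        (𝓝[>] 0) (𝓝 ((1 + 0 + 0) / (1 - (μ ^ α + 0)))) :=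
      (((hclim.comp hnn).add hid).add hid).div
        (((hθlim.comp hnn).add hid).const_sub 1) (by linarith)
    have hθ' := (hθlim.comp hnn).add hid
    simp only [add_zero] at hl hθ'
    have e1 := hl.eventually (gt_mem_nhds ha)
    have e4 := hθ'.eventually (gt_mem_nhds hμα)
    -- The restriction `δ < 1 - μ` keeps the dilation `(1 - δ) / μ` above `1`, as the iteration
    -- requires.
    have e5 : ∀ᶠ δ : ℝ in 𝓝[>] 0, δ ∈ Set.Ioo (0 : ℝ) (1 - μ) := Ioo_mem_nhdsGT (by linarith)
    obtain ⟨δ, h1, h4, h5⟩ := (e1.and (e4.and e5)).exists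
    simp only [Function.comp_apply, ← sub_eq_add_neg] at h1 h4
    have hδ0 := h5.1
    have hδ1 : δ < 1 - μ := h5.2
    obtain ⟨e, he, hle⟩ := hup δ ⟨hδ0, by linarith⟩
    have hδ2 : 0 < 1 - δ := by linarith
    have hκ : 1 < (1 - δ) / μ := by rw [lt_div_iff₀ hμ0]; linarith
    have f1 := hb.eventually_le_mul (by positivity : 0 < (1 - δ) / μ)
      (by linarith : ((1 - δ) / μ) ^ (-α) < ((1 - δ) / μ) ^ (-α) + δ)
    have f2 := hb.eventually_le_mul (by positivity : 0 < (1 - δ))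
      (by linarith : (1 - δ) ^ (-α) < (1 - δ) ^ (-α) + δ)
    have f3 := he.eventually (gt_mem_nhds hδ0)
    have g : ∀ᶠ x in atTop, p x ≤ p ((1 - δ) / μ * x) + ((1 - δ) ^ (-α) + δ + δ) * b x := by
      filter_upwards [f2, f3, hle] with x k1 k2 k3
      have k2' := (div_lt_iff₀ (hb.pos x)).1 k2
      linarith
    filter_upwards [eventually_le_of_le_add hκ (by positivity) h4 (by positivity) hp
      f1 g] with x hx
    rw [div_lt_iff₀ (hb.pos x)]
    exact lt_of_le_of_lt hx (mul_lt_mul_of_pos_right h1 (hb.pos x))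

lemma IsRVTail.of_tendsto_div {α c : ℝ} (hb : IsRVTail b α) (hc : 0 < c) (hp : Antitone p)
    (hp0 : ∀ x, 0 ≤ p x) (h : Tendsto (fun x => p x / b x) atTop (𝓝 c)) : IsRVTail p α := by
  refine ⟨hp, hp0, fun q hq => ?_⟩
  have h1 : Tendsto (fun x => p (q * x) / b (q * x)) atTop (𝓝 c) :=
    h.comp (tendsto_id.const_mul_atTop hq)
  have h2 := (h1.mul (hb.tendsto_div q hq)).div h hc.ne'
  rw [mul_div_cancel_left₀ _ hc.ne'] at h2
  refine h2.congr fun x => ?_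
  have := hb.pos x
  have := hb.pos (q * x)
  simp only [Pi.div_apply]
  field_simp

end Recursion

end GWI

namespace GWI

/-! ### Measurability of random sums, Fubini under independence, a moment criterion. -/

section General

variable {Ω β γ : Type*}

lemma measurable_sum_range {m : MeasurableSpace Ω} {N : Ω → ℕ} {A : ℕ → Ω → ℕ}
    (hN : Measurable N) (hA : ∀ j, Measurable (A j)) :
    Measurable (fun ω => ∑ j ∈ Finset.range (N ω), A j ω) := by
  have h : Measurable (fun q : ℕ × Ω => ∑ j ∈ Finset.range q.1, A j q.2) :=
    measurable_from_prod_countable_right fun n =>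
      Finset.measurable_sum (Finset.range n) fun j _ => hA j
  exact h.comp (hN.prodMk measurable_id)

lemma measurable_sum_range_add {m : MeasurableSpace Ω} {N B : Ω → ℕ} {A : ℕ → Ω → ℕ}
    (hN : Measurable N) (hA : ∀ j, Measurable (A j)) (hB : Measurable B) :
    Measurable (fun ω => (∑ j ∈ Finset.range (N ω), A j ω) + B ω) :=
  (measurable_sum_range hN hA).add hB

lemma measurable_pi_prodMk {m : MeasurableSpace Ω} {B : Ω → ℕ} {A : ℕ → Ω → ℕ}
    (hA : ∀ j, Measurable (A j)) (hB : Measurable B) :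
    Measurable (fun ω => (fun j => A j ω, B ω)) :=
  (measurable_pi_lambda _ hA).prodMk hB

variable [MeasurableSpace Ω] {P : Measure Ω} [IsProbabilityMeasure P]
  [MeasurableSpace β] [MeasurableSpace γ] {f : Ω → β} {g : Ω → γ}

/-- The joint law is a product, so Fubini's theorem allows `f` to be frozen while `g` is integrated
out. This takes the place of conditional expectations. -/
lemma lintegral_of_indepFun (h : IndepFun f g P) (hf : Measurable f) (hg : Measurable g)
    {F : β × γ → ENNReal} (hF : Measurable F) :
    ∫⁻ ω, F (f ω, g ω) ∂P = ∫⁻ ω, ∫⁻ ω', F (f ω, g ω') ∂P ∂P := by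
  have h1 := (indepFun_iff_map_prod_eq_prod_map_map hf.aemeasurable hg.aemeasurable).1 h
  have : IsProbabilityMeasure (P.map g) := Measure.isProbabilityMeasure_map hg.aemeasurable
  have : IsProbabilityMeasure (P.map f) := Measure.isProbabilityMeasure_map hf.aemeasurable
  calc ∫⁻ ω, F (f ω, g ω) ∂P = ∫⁻ z, F z ∂(P.map fun ω => (f ω, g ω)) :=
        (lintegral_map hF (hf.prodMk hg)).symm
    _ = ∫⁻ x, ∫⁻ y, F (x, y) ∂(P.map g) ∂(P.map f) := by rw [h1, lintegral_prod _ hF.aemeasurable]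
    _ = ∫⁻ ω, ∫⁻ y, F (f ω, y) ∂(P.map g) ∂P :=
        lintegral_map hF.lintegral_prod_right' hf
    _ = _ := by
        refine lintegral_congr fun ω => ?_
        exact lintegral_map (hF.comp measurable_prodMk_left) hg

lemma integral_of_indepFun (h : IndepFun f g P) (hf : Measurable f) (hg : Measurable g)
    {F : β × γ → ℂ} (hF : Measurable F) {C : ℝ} (hC : ∀ z, ‖F z‖ ≤ C) :
    ∫ ω, F (f ω, g ω) ∂P = ∫ ω, ∫ ω', F (f ω, g ω') ∂P ∂P := by
  have h1 := (indepFun_iff_map_prod_eq_prod_map_map hf.aemeasurable hg.aemeasurable).1 h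
  have : IsProbabilityMeasure (P.map g) := Measure.isProbabilityMeasure_map hg.aemeasurable
  have : IsProbabilityMeasure (P.map f) := Measure.isProbabilityMeasure_map hf.aemeasurable
  calc ∫ ω, F (f ω, g ω) ∂P = ∫ z, F z ∂(P.map fun ω => (f ω, g ω)) :=
        (integral_map (hf.prodMk hg).aemeasurable hF.aestronglyMeasurable).symm
    _ = ∫ x, ∫ y, F (x, y) ∂(P.map g) ∂(P.map f) := by
        rw [h1, integral_prod _ (Integrable.of_bound hF.aestronglyMeasurable C
          (Eventually.of_forall hC))]
    _ = ∫ ω, ∫ y, F (f ω, y) ∂(P.map g) ∂P :=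
        integral_map hf.aemeasurable
          hF.stronglyMeasurable.integral_prod_right'.aestronglyMeasurable
    _ = _ := by
        congr 1 with ω
        exact integral_map hg.aemeasurable (hF.comp measurable_prodMk_left).aestronglyMeasurable

/-- Dyadic condensation: if `N` is the least exponent with `B ≤ 2 ^ N`, then `2 ^ N` is `1` plus the
sum of the levels `2 ^ n` with `n < N`, all of which lie strictly below `B`. -/
lemma lintegral_natCast_lt_top_of_summable {B : Ω → ℕ} (hB : Measurable B)
    (h : Summable fun n : ℕ => (2 : ℝ) ^ n * P.real {ω | (2 : ℝ) ^ n < (B ω : ℝ)}) :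
    ∫⁻ ω, (B ω : ENNReal) ∂P < ⊤ := by
  have hms : ∀ n : ℕ, MeasurableSet {ω | 2 ^ n < B ω} := fun n =>
    measurableSet_lt measurable_const hB
  have key : ∀ ω, (B ω : ENNReal) ≤
      1 + ∑' n : ℕ, Set.indicator {ω | 2 ^ n < B ω} (fun _ => (2 : ENNReal) ^ n) ω := by
    intro ω
    have hex : ∃ n, B ω ≤ 2 ^ n := ⟨B ω, Nat.lt_two_pow_self.le⟩
    classical
    set N := Nat.find hex
    have h1 : B ω ≤ 2 ^ N := Nat.find_spec hex
    have h2 : ∀ n < N, 2 ^ n < B ω := fun n hn => not_le.1 (Nat.find_min hex hn)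
    calc (B ω : ENNReal) ≤ ((2 ^ N : ℕ) : ENNReal) := by exact_mod_cast h1
      _ = 1 + ∑ n ∈ Finset.range N, (2 : ENNReal) ^ n := by
          have : 2 ^ N = 1 + ∑ n ∈ Finset.range N, 2 ^ n := by
            have := Nat.geomSum_eq (le_refl 2) N
            have h3 : 0 < 2 ^ N := by positivity
            simp only [Nat.add_one_sub_one, Nat.div_one] at this
            omega
          rw [this]; push_cast; rfl
      _ = 1 + ∑ n ∈ Finset.range N,
            Set.indicator {ω | 2 ^ n < B ω} (fun _ => (2 : ENNReal) ^ n) ω := by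
          congr 1
          refine Finset.sum_congr rfl fun n hn => ?_
          rw [Set.indicator_of_mem]
          exact h2 n (Finset.mem_range.1 hn)
      _ ≤ _ := by gcongr; exact ENNReal.sum_le_tsum _
  refine lt_of_le_of_lt (lintegral_mono key) ?_
  rw [lintegral_add_left measurable_const, lintegral_tsum
    (fun n => (measurable_const.indicator (hms n)).aemeasurable)]
  simp only [lintegral_const, measure_univ, mul_one]
  refine ENNReal.add_lt_top.2 ⟨ENNReal.one_lt_top, ?_⟩
  have e : ∀ n : ℕ, ∫⁻ ω, Set.indicator {ω | 2 ^ n < B ω} (fun _ => (2 : ENNReal) ^ n) ω ∂P =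
      ENNReal.ofReal ((2 : ℝ) ^ n * P.real {ω | (2 : ℝ) ^ n < (B ω : ℝ)}) := by
    intro n
    rw [lintegral_indicator_const (hms n), ENNReal.ofReal_mul (by positivity),
      ENNReal.ofReal_pow (by norm_num), ofReal_measureReal]
    congr 2
    · simp
    · ext ω; simp only [Set.mem_ofPred_eq]; norm_cast
  simp_rw [e]
  exact h.tsum_ofReal_lt_top

end General

/-! ### Causality, finite mean, and independence of past and innovations. -/

variable {Ω : Type*} [mΩ : MeasurableSpace Ω] {P : Measure Ω} [IsProbabilityMeasure P]
  {X : ℤ → Ω → ℕ} {A : ℤ → ℕ → Ω → ℕ} {B : ℤ → Ω → ℕ}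

/-- The population at time `k` if it had `c` individuals `n` generations earlier. -/
def populationFrom (A : ℤ → ℕ → Ω → ℕ) (B : ℤ → Ω → ℕ) (c : ℕ) : ℕ → ℤ → Ω → ℕ
  | 0, _, _ => c
  | n + 1, k, ω => (∑ j ∈ Finset.range (populationFrom A B c n (k - 1) ω), A k j ω) + B k ω

/-- The offspring and immigration numbers that produce generation `k`. -/
def innovation (A : ℤ → ℕ → Ω → ℕ) (B : ℤ → Ω → ℕ) (k : ℤ) (ω : Ω) : (ℕ → ℕ) × ℕ :=
  (fun j => A k j ω, B k ω)

/-- The history of the process up to time `k`, read backwards. -/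
def history (X : ℤ → Ω → ℕ) (k : ℤ) (ω : Ω) (j : ℕ) : ℕ := X (k - j) ω

/-- The generation that an offspring or immigration variable contributes to. -/
def generation : (ℤ × ℕ) ⊕ ℤ → ℤ := Sum.elim Prod.fst id

/-- The information in the innovations of the generations in `S`. -/
@[reducible] def innovationSigma (A : ℤ → ℕ → Ω → ℕ) (B : ℤ → Ω → ℕ) (S : Set ℤ) : MeasurableSpace Ω :=
  ⨆ q ∈ generation ⁻¹' S,
    MeasurableSpace.comap (Sum.elim (fun p : ℤ × ℕ => A p.1 p.2) B q) inferInstance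

lemma measurable_A_innovationSigma {S : Set ℤ} {k : ℤ} (hk : k ∈ S) (j : ℕ) :
    Measurable[innovationSigma A B S] (A k j) := by
  rw [measurable_iff_comap_le]
  exact le_iSup₂_of_le (f := fun q (_ : q ∈ generation ⁻¹' S) =>
    MeasurableSpace.comap (Sum.elim (fun p : ℤ × ℕ => A p.1 p.2) B q) inferInstance)
    (Sum.inl (k, j)) hk le_rfl

lemma measurable_B_innovationSigma {S : Set ℤ} {k : ℤ} (hk : k ∈ S) :
    Measurable[innovationSigma A B S] (B k) := by
  rw [measurable_iff_comap_le]
  exact le_iSup₂_of_le (f := fun q (_ : q ∈ generation ⁻¹' S) =>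
    MeasurableSpace.comap (Sum.elim (fun p : ℤ × ℕ => A p.1 p.2) B q) inferInstance)
    (Sum.inr k) hk le_rfl

lemma measurable_populationFrom_innovationSigma (c n : ℕ) (k : ℤ) :
    Measurable[innovationSigma A B (Set.Iic k)] (populationFrom A B c n k) := by
  -- The induction lowers `k` while the σ-algebra has to stay fixed, hence the separate upper index
  -- `l`.
  suffices h : ∀ l, k ≤ l →
      Measurable[innovationSigma A B (Set.Iic l)] (populationFrom A B c n k) from h k le_rfl
  induction n generalizing k with
  | zero => intro l _; exact @measurable_const _ _ _ (innovationSigma A B (Set.Iic l)) _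
  | succ n ih =>
    intro l hl
    exact measurable_sum_range_add (ih (k - 1) l (by omega))
      (fun j => measurable_A_innovationSigma (S := Set.Iic l) hl j)
      (measurable_B_innovationSigma (S := Set.Iic l) hl)

lemma populationFrom_le_succ (n : ℕ) (k : ℤ) (ω : Ω) :
    populationFrom A B 0 n k ω ≤ populationFrom A B 0 (n + 1) k ω := by
  induction n generalizing k with
  | zero => exact Nat.zero_le _
  | succ n ih =>
    exact Nat.add_le_add_right (Finset.sum_le_sum_of_subset
      (Finset.range_subset_range.2 (ih (k - 1)))) _

namespace IsStationaryGWI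

variable (h : IsStationaryGWI P X A B)
include h

lemma innovationSigma_le (S : Set ℤ) : innovationSigma A B S ≤ mΩ := by
  refine iSup₂_le fun q _ => ?_
  rw [← measurable_iff_comap_le]
  rcases q with ⟨i, j⟩ | i
  · exact h.measurable_A i j
  · exact h.measurable_B i

lemma measurable_innovation (k : ℤ) : Measurable (innovation A B k) :=
  (measurable_pi_lambda _ fun j => h.measurable_A k j).prodMk (h.measurable_B k)

lemma measurable_history (k : ℤ) : Measurable (history X k) :=
  measurable_pi_lambda _ fun _ => h.measurable_X _

lemma measurable_populationFrom (c n : ℕ) (k : ℤ) : Measurable (populationFrom A B c n k) :=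
  (measurable_populationFrom_innovationSigma c n k).mono (h.innovationSigma_le _) le_rfl

/-- The variables contributing to generations up to `k` and those contributing to generation `k + 1`
are disjoint blocks of one independent family. -/
lemma indepFun_innovation {β : Type*} [MeasurableSpace β] {f : Ω → β} {k : ℤ}
    (hf : Measurable[innovationSigma A B (Set.Iic k)] f) :
    IndepFun f (innovation A B (k + 1)) P := by
  rw [IndepFun_iff_Indep]
  have hle : ∀ q, MeasurableSpace.comap (Sum.elim (fun p : ℤ × ℕ => A p.1 p.2) B q)
      inferInstance ≤ mΩ := by
    intro q
    rw [← measurable_iff_comap_le]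
    rcases q with ⟨i, j⟩ | i
    · exact h.measurable_A i j
    · exact h.measurable_B i
  have hd : Disjoint (generation ⁻¹' Set.Iic k) (generation ⁻¹' {k + 1}) := by
    refine Disjoint.preimage _ ?_
    rw [Set.disjoint_singleton_right]
    simp
  have h1 : Indep (innovationSigma A B (Set.Iic k)) (innovationSigma A B {k + 1}) P :=
    indep_iSup_of_disjoint hle ((iIndepFun_iff_iIndep _ _ _).1 h.indep) hd
  refine indep_of_indep_of_le h1 (measurable_iff_comap_le.1 hf) (measurable_iff_comap_le.1 ?_)
  exact measurable_pi_prodMk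
    (fun j => measurable_A_innovationSigma (S := {k + 1}) rfl j)
    (measurable_B_innovationSigma (S := {k + 1}) rfl)

lemma lintegral_A (i : ℤ) (j : ℕ) :
    ∫⁻ ω, (A i j ω : ENNReal) ∂P = ∫⁻ ω, (A 0 0 ω : ENNReal) ∂P :=
  ((h.identDistrib_A i j).comp (u := fun n : ℕ => (n : ENNReal)) (by fun_prop)).lintegral_eq

lemma lintegral_B (i : ℤ) :
    ∫⁻ ω, (B i ω : ENNReal) ∂P = ∫⁻ ω, (B 0 ω : ENNReal) ∂P :=
  ((h.identDistrib_B i).comp (u := fun n : ℕ => (n : ENNReal)) (by fun_prop)).lintegral_eq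

/-- Wald's identity. -/
lemma lintegral_sum_A {N : Ω → ℕ} {k : ℤ} (hN : Measurable N)
    (hi : IndepFun N (innovation A B k) P) (hA : ∫⁻ ω, (A 0 0 ω : ENNReal) ∂P ≠ ⊤) :
    ∫⁻ ω, ((∑ j ∈ Finset.range (N ω), A k j ω : ℕ) : ENNReal) ∂P =
      (∫⁻ ω, (A 0 0 ω : ENNReal) ∂P) * ∫⁻ ω, (N ω : ENNReal) ∂P := by
  have hF : Measurable (fun z : ℕ × ((ℕ → ℕ) × ℕ) =>
      ((∑ j ∈ Finset.range z.1, z.2.1 j : ℕ) : ENNReal)) := by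
    refine measurable_from_prod_countable_right fun n => ?_
    simp only
    fun_prop
  have := lintegral_of_indepFun hi hN (h.measurable_innovation k) hF
  simp only [innovation] at this
  rw [this, ← lintegral_const_mul' _ _ hA]
  refine lintegral_congr fun ω => ?_
  push_cast
  rw [lintegral_finsetSum _ (fun j _ => by have := h.measurable_A k j; fun_prop)]
  simp [h.lintegral_A, mul_comm]

lemma lintegral_populationFrom_succ (hA : ∫⁻ ω, (A 0 0 ω : ENNReal) ∂P ≠ ⊤) (c n : ℕ) (k : ℤ) :
    ∫⁻ ω, (populationFrom A B c (n + 1) k ω : ENNReal) ∂P =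
      (∫⁻ ω, (A 0 0 ω : ENNReal) ∂P) * ∫⁻ ω, (populationFrom A B c n (k - 1) ω : ENNReal) ∂P +
        ∫⁻ ω, (B 0 ω : ENNReal) ∂P := by
  have hm := h.measurable_populationFrom c n (k - 1)
  have hi := h.indepFun_innovation (measurable_populationFrom_innovationSigma (A := A) (B := B)
    c n (k - 1))
  rw [sub_add_cancel] at hi
  rw [← h.lintegral_sum_A hm hi hA, ← h.lintegral_B k, ← lintegral_add_right]
  · simp [populationFrom]
  · have := h.measurable_B k
    fun_prop

lemma lintegral_populationFrom (hA : ∫⁻ ω, (A 0 0 ω : ENNReal) ∂P ≠ ⊤) (c n : ℕ) (k : ℤ) :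
    ∫⁻ ω, (populationFrom A B c n k ω : ENNReal) ∂P =
      c * (∫⁻ ω, (A 0 0 ω : ENNReal) ∂P) ^ n +
      (∑ i ∈ Finset.range n, (∫⁻ ω, (A 0 0 ω : ENNReal) ∂P) ^ i) *
        ∫⁻ ω, (B 0 ω : ENNReal) ∂P := by
  induction n generalizing k with
  | zero => simp [populationFrom]
  | succ n ih =>
    rw [h.lintegral_populationFrom_succ hA, ih, Finset.sum_range_succ']
    simp only [pow_succ, pow_zero, ← Finset.sum_mul]
    ring

lemma ae_forall_recursion :
    ∀ᵐ ω ∂P, ∀ i, X i ω = (∑ j ∈ Finset.range (X (i - 1) ω), A i j ω) + B i ω :=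
  ae_all_iff.2 h.recursion

omit h in
lemma populationFrom_zero_le {ω : Ω}
    (hω : ∀ i, X i ω = (∑ j ∈ Finset.range (X (i - 1) ω), A i j ω) + B i ω) (n : ℕ) (k : ℤ) :
    populationFrom A B 0 n k ω ≤ X k ω := by
  induction n generalizing k with
  | zero => exact Nat.zero_le _
  | succ n ih =>
    rw [hω k]
    exact Nat.add_le_add_right (Finset.sum_le_sum_of_subset
      (Finset.range_subset_range.2 (ih (k - 1)))) _

omit h in
lemma le_populationFrom {ω : Ω}
    (hω : ∀ i, X i ω = (∑ j ∈ Finset.range (X (i - 1) ω), A i j ω) + B i ω) {N : ℕ} (n : ℕ)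
    (k : ℤ) (hN : X (k - n) ω ≤ N) : X k ω ≤ populationFrom A B N n k ω := by
  induction n generalizing k with
  | zero => simpa [populationFrom] using hN
  | succ n ih =>
    rw [hω k]
    refine Nat.add_le_add_right (Finset.sum_le_sum_of_subset
      (Finset.range_subset_range.2 (ih (k - 1) ?_))) _
    convert hN using 2
    push_cast
    ring

lemma identDistrib_X (k : ℤ) : IdentDistrib (X k) (X 0) P P := by
  have := (h.stationary k).comp (u := fun f : ℤ → ℕ => f 0) (measurable_pi_apply 0)
  simpa [Function.comp_def] using this

/-- A coupling: unless `X (k - n)` exceeds `N`, the value `X k` is squeezed between the populations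
started from `0` and from `N` individuals. Their means differ by `N` times the `n`-th power of the
offspring mean, and integers that differ do so by at least one. -/
lemma measure_ne_populationFrom_le (hA : ∫⁻ ω, (A 0 0 ω : ENNReal) ∂P < 1)
    (hB : ∫⁻ ω, (B 0 ω : ENNReal) ∂P < ⊤) (N n : ℕ) (k : ℤ) :
    P {ω | X k ω ≠ populationFrom A B 0 n k ω} ≤
      P {ω | N < X 0 ω} + N * (∫⁻ ω, (A 0 0 ω : ENNReal) ∂P) ^ n := by
  have hA' := (hA.trans ENNReal.one_lt_top).ne
  set E := {ω | populationFrom A B 0 n k ω + 1 ≤ populationFrom A B N n k ω} with hE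
  have hm0 := h.measurable_populationFrom 0 n k
  have hmN := h.measurable_populationFrom N n k
  have hEm : MeasurableSet E := measurableSet_le (hm0.add_const 1) hmN
  have hsub : ({ω | X k ω ≠ populationFrom A B 0 n k ω} : Set Ω) ≤ᵐ[P]
      ({ω | N < X (k - n) ω} ∪ {ω | populationFrom A B 0 n k ω + 1 ≤ populationFrom A B N n k ω} :
        Set Ω) := by
    filter_upwards [h.ae_forall_recursion] with ω hω hne
    by_cases hN : N < X (k - n) ω
    · exact Or.inl hN
    · right
      have h1 := populationFrom_zero_le hω n k
      have h2 := le_populationFrom hω n k (not_lt.1 hN)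
      have h3 : X k ω ≠ populationFrom A B 0 n k ω := hne
      change populationFrom A B 0 n k ω + 1 ≤ populationFrom A B N n k ω
      omega
  have hPE : P E ≤ N * (∫⁻ ω, (A 0 0 ω : ENNReal) ∂P) ^ n := by
    -- Markov's inequality in additive form, which avoids subtraction in `ENNReal`; the finite
    -- common mean is cancelled after integration.
    have h1 : ∀ᵐ ω ∂P, (populationFrom A B 0 n k ω : ENNReal) + E.indicator 1 ω ≤
        populationFrom A B N n k ω := by
      filter_upwards [h.ae_forall_recursion] with ω hω
      by_cases hω' : ω ∈ E
      · simp only [Set.indicator_of_mem hω', Pi.one_apply]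
        exact_mod_cast hω'
      · simp only [Set.indicator_of_notMem hω', add_zero]
        have : populationFrom A B 0 n k ω ≤ populationFrom A B N n k ω := by
          clear hω' hEm hm0 hmN hsub hE hω
          clear E
          induction n generalizing k with
          | zero => exact Nat.zero_le _
          | succ n ih =>
            exact Nat.add_le_add_right (Finset.sum_le_sum_of_subset
              (Finset.range_subset_range.2 (ih (k - 1)))) _
        exact_mod_cast this
    have h2 := lintegral_mono_ae h1
    rw [lintegral_add_left (by fun_prop), lintegral_indicator_one hEm,
      h.lintegral_populationFrom hA', h.lintegral_populationFrom hA' N] at h2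
    simp only [Nat.cast_zero, zero_mul, zero_add] at h2
    rw [add_comm] at h2
    refine (ENNReal.add_le_add_iff_right ?_).1 h2
    refine ENNReal.mul_ne_top ?_ hB.ne
    exact (ENNReal.sum_lt_top.2 fun i _ => ENNReal.pow_lt_top (lt_top_iff_ne_top.2 hA')).ne
  calc P {ω | X k ω ≠ populationFrom A B 0 n k ω}
      ≤ P ({ω | N < X (k - n) ω} ∪ E) := measure_mono_ae hsub
    _ ≤ P {ω | N < X (k - n) ω} + P E := measure_union_le _ _
    _ ≤ _ := by
        refine add_le_add (le_of_eq ?_) hPE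
        exact (h.identDistrib_X (k - n)).measure_mem_eq (s := Set.Ioi N) measurableSet_Ioi

lemma tendsto_measure_lt_X : Tendsto (fun N : ℕ => P {ω | N < X 0 ω}) atTop (𝓝 0) := by
  have h1 : Antitone fun N : ℕ => {ω | N < X 0 ω} := fun a b hab ω hω => lt_of_le_of_lt hab hω
  have h2 := tendsto_measure_iInter_atTop (μ := P)
    (fun N : ℕ => (measurableSet_lt measurable_const (h.measurable_X 0)).nullMeasurableSet) h1
    ⟨0, measure_ne_top _ _⟩
  have h3 : ⋂ N : ℕ, {ω | N < X 0 ω} = ∅ := by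
    ext ω
    simp only [Set.mem_iInter, Set.mem_ofPred_eq, Set.mem_empty_iff_false, iff_false, not_forall]
    exact ⟨X 0 ω, lt_irrefl _⟩
  rwa [h3, measure_empty] at h2

/-- The process is causal: almost surely, each generation descends from finitely many generations
of immigrants. -/
lemma ae_exists_eq_populationFrom (hA : ∫⁻ ω, (A 0 0 ω : ENNReal) ∂P < 1)
    (hB : ∫⁻ ω, (B 0 ω : ENNReal) ∂P < ⊤) (k : ℤ) :
    ∀ᵐ ω ∂P, ∃ n, X k ω = populationFrom A B 0 n k ω := by
  have h1 : ∀ N : ℕ, P {ω | ¬ ∃ n, X k ω = populationFrom A B 0 n k ω} ≤ P {ω | N < X 0 ω} := by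
    -- For fixed `N` the limit in `n` removes the coupling error; `N` tends to infinity afterwards.
    intro N
    have hl : Tendsto (fun n : ℕ => P {ω | N < X 0 ω} +
        N * (∫⁻ ω, (A 0 0 ω : ENNReal) ∂P) ^ n) atTop (𝓝 (P {ω | N < X 0 ω} + N * 0)) :=
      tendsto_const_nhds.add (ENNReal.Tendsto.const_mul
        (ENNReal.tendsto_pow_atTop_nhds_zero_of_lt_one hA) (Or.inr (by simp)))
    rw [mul_zero, add_zero] at hl
    refine ge_of_tendsto' hl fun n => le_trans (measure_mono ?_)
      (h.measure_ne_populationFrom_le hA hB N n k)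
    intro ω hω
    exact (not_exists.1 hω) n
  have h2 := ge_of_tendsto' h.tendsto_measure_lt_X h1
  exact le_antisymm h2 bot_le

lemma ae_iSup_populationFrom_eq (hA : ∫⁻ ω, (A 0 0 ω : ENNReal) ∂P < 1)
    (hB : ∫⁻ ω, (B 0 ω : ENNReal) ∂P < ⊤) (k : ℤ) :
    ∀ᵐ ω ∂P, ⨆ n, (populationFrom A B 0 n k ω : ENNReal) = X k ω := by
  filter_upwards [h.ae_exists_eq_populationFrom hA hB k, h.ae_forall_recursion] with ω ⟨n, hn⟩ hω
  refine le_antisymm (iSup_le fun n => ?_) ?_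
  · exact_mod_cast populationFrom_zero_le hω n k
  · rw [hn]
    exact le_iSup (fun n => (populationFrom A B 0 n k ω : ENNReal)) n

/-- By causality `X k` is the increasing limit of populations started from `0`, whose means are
bounded by a geometric series. Monotone convergence applies. -/
lemma lintegral_X_lt_top (hA : ∫⁻ ω, (A 0 0 ω : ENNReal) ∂P < 1)
    (hB : ∫⁻ ω, (B 0 ω : ENNReal) ∂P < ⊤) (k : ℤ) : ∫⁻ ω, (X k ω : ENNReal) ∂P < ⊤ := by
  have hA' := (hA.trans ENNReal.one_lt_top).ne
  rw [← lintegral_congr_ae (h.ae_iSup_populationFrom_eq hA hB k), lintegral_iSup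
    (fun n => by have := h.measurable_populationFrom 0 n k; fun_prop)
    (monotone_nat_of_le_succ fun n ω => by exact_mod_cast populationFrom_le_succ n k ω)]
  simp_rw [h.lintegral_populationFrom hA']
  refine lt_of_le_of_lt (b := (∑' i : ℕ, (∫⁻ ω, (A 0 0 ω : ENNReal) ∂P) ^ i) *
    ∫⁻ ω, (B 0 ω : ENNReal) ∂P) (iSup_le fun n => ?_) ?_
  · simp only [Nat.cast_zero, zero_mul, zero_add]
    gcongr
    exact ENNReal.sum_le_tsum _
  · rw [ENNReal.tsum_geometric]
    refine ENNReal.mul_lt_top (ENNReal.inv_lt_top.2 ?_) hB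
    exact tsub_pos_of_lt hA

/-- The history need not itself be measurable with respect to past innovations, but causality
supplies an almost surely equal version that is. -/
lemma indepFun_history_innovation (hA : ∫⁻ ω, (A 0 0 ω : ENNReal) ∂P < 1)
    (hB : ∫⁻ ω, (B 0 ω : ENNReal) ∂P < ⊤) (k : ℤ) :
    IndepFun (history X k) (innovation A B (k + 1)) P := by
  -- The floor only serves to return to `ℕ` measurably: almost surely the supremum is the natural
  -- number `X k ω`.
  set X' : ℤ → Ω → ℕ := fun k ω =>
    ⌊(⨆ n, (populationFrom A B 0 n k ω : ENNReal)).toReal⌋₊ with hX'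
  have hm : ∀ l ≤ k, Measurable[innovationSigma A B (Set.Iic k)] (X' l) := by
    intro l hl
    have h1 : ∀ n, Measurable[innovationSigma A B (Set.Iic k)]
        fun ω => (populationFrom A B 0 n l ω : ENNReal) := fun n =>
      (measurable_of_countable (fun n : ℕ => (n : ENNReal))).comp
        ((measurable_populationFrom_innovationSigma (A := A) (B := B) 0 n l).mono
          (biSup_mono fun q (hq : generation q ≤ l) => hq.trans hl) le_rfl)
    exact Nat.measurable_floor.comp (ENNReal.measurable_toReal.comp (Measurable.iSup h1))
  have he : history X' k =ᵐ[P] history X k := by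
    have h1 : ∀ᵐ ω ∂P, ∀ k, ⨆ n, (populationFrom A B 0 n k ω : ENNReal) = X k ω :=
      ae_all_iff.2 fun k => h.ae_iSup_populationFrom_eq hA hB k
    filter_upwards [h1] with ω hω
    funext j
    simp [history, hX', hω]
  refine IndepFun.congr (h.indepFun_innovation (f := history X' k) (k := k) ?_) he (ae_eq_refl _)
  exact @measurable_pi_lambda _ _ _ (innovationSigma A B (Set.Iic k)) _ _
    fun j => hm (k - j) (by omega)

end IsStationaryGWI
end GWI

/-! ### Regular variation of the stationary tail. -/

namespace GWI

/-- A stationary Galton-Watson process with subcritical square integrable offspring distribution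
and regularly varying immigration. -/
structure IsRegularGWI {Ω : Type*} [MeasurableSpace Ω] (P : Measure Ω) (X : ℤ → Ω → ℕ)
    (A : ℤ → ℕ → Ω → ℕ) (B : ℤ → Ω → ℕ) (μ α : ℝ) : Prop where
  isStationaryGWI : IsStationaryGWI P X A B
  mean : μ = ∫ ω, (A 0 0 ω : ℝ) ∂P
  mean_mem : μ ∈ Set.Ioo (0 : ℝ) 1
  memLp : MemLp (fun ω => (A 0 0 ω : ℝ)) 2 P
  index_mem : α ∈ Set.Ioo (1 : ℝ) 2
  isRegularlyVarying : IsRegularlyVarying P (fun ω => (B 0 ω : ℝ)) α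

/-- The tail of the stationary distribution. -/
def tail {Ω : Type*} [MeasurableSpace Ω] (P : Measure Ω) (X : ℤ → Ω → ℕ) (x : ℝ) : ℝ :=
  P.real {ω | x < (X 0 ω : ℝ)}

variable {Ω : Type*} [mΩ : MeasurableSpace Ω] {P : Measure Ω} [IsProbabilityMeasure P]
  {X : ℤ → Ω → ℕ} {A : ℤ → ℕ → Ω → ℕ} {B : ℤ → Ω → ℕ} {μ α : ℝ}

lemma antitone_tail : Antitone (tail P X) := fun _ _ hxy =>
  measureReal_mono fun _ hω => lt_of_le_of_lt hxy hω

lemma tail_nonneg (x : ℝ) : 0 ≤ tail P X x := measureReal_nonneg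

lemma measureReal_le_of_ae {s t : Set Ω} (h : ∀ᵐ ω ∂P, ω ∈ s → ω ∈ t) : P.real s ≤ P.real t :=
  ENNReal.toReal_mono (measure_ne_top P _) (measure_mono_ae h)

namespace IsStationaryGWI

lemma tendsto_tail (h : IsStationaryGWI P X A B) : Tendsto (tail P X) atTop (𝓝 0) := by
  have h1 := (ENNReal.tendsto_toReal ENNReal.zero_ne_top).comp h.tendsto_measure_lt_X
  have h2 : Tendsto (fun x : ℝ => P.real {ω | ⌊x⌋₊ < X 0 ω}) atTop (𝓝 0) :=
    h1.comp tendsto_nat_floor_atTop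
  refine squeeze_zero' (Eventually.of_forall tail_nonneg) ?_ h2
  filter_upwards [eventually_ge_atTop 0] with x hx
  refine measureReal_mono fun ω hω => ?_
  exact (Nat.floor_lt hx).2 hω

lemma measureReal_lt_X (h : IsStationaryGWI P X A B) (k : ℤ) (x : ℝ) :
    P.real {ω | x < (X k ω : ℝ)} = tail P X x := by
  unfold tail
  simp only [measureReal_def]
  congr 1
  exact (h.identDistrib_X k).measure_mem_eq (s := {n : ℕ | x < (n : ℝ)})
    (MeasurableSet.of_discrete)

lemma measureReal_lt_B (h : IsStationaryGWI P X A B) (k : ℤ) (x : ℝ) :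
    P.real {ω | x < (B k ω : ℝ)} = P.real {ω | x < (B 0 ω : ℝ)} := by
  simp only [measureReal_def]
  congr 1
  exact (h.identDistrib_B k).measure_mem_eq (s := {n : ℕ | x < (n : ℝ)})
    (MeasurableSet.of_discrete)

end IsStationaryGWI

namespace IsRegularGWI

variable (h : IsRegularGWI P X A B μ α)
include h

lemma isRVTail_B : IsRVTail (fun x => P.real {ω | x < (B 0 ω : ℝ)}) α :=
  ⟨fun _ _ hxy => measureReal_mono fun _ hω => lt_of_le_of_lt hxy hω,
    fun _ => measureReal_nonneg, h.isRegularlyVarying⟩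

lemma lintegral_B_lt_top : ∫⁻ ω, (B 0 ω : ENNReal) ∂P < ⊤ :=
  lintegral_natCast_lt_top_of_summable (h.isStationaryGWI.measurable_B 0)
    (h.isRVTail_B.summable_two_pow h.index_mem.1)

lemma lintegral_A_lt_one : ∫⁻ ω, (A 0 0 ω : ENNReal) ∂P < 1 := by
  have hi : Integrable (fun ω => (A 0 0 ω : ℝ)) P := h.memLp.integrable (by norm_num)
  have h1 := ofReal_integral_eq_lintegral_ofReal hi (Eventually.of_forall fun ω => by simp)
  simp only [ENNReal.ofReal_natCast, ← h.mean] at h1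
  rw [← h1]
  exact ENNReal.ofReal_lt_one.2 h.mean_mem.2

lemma indepFun_history (k : ℤ) : IndepFun (history X k) (innovation A B (k + 1)) P :=
  h.isStationaryGWI.indepFun_history_innovation h.lintegral_A_lt_one h.lintegral_B_lt_top k

lemma lintegral_X_lt_top (k : ℤ) : ∫⁻ ω, (X k ω : ENNReal) ∂P < ⊤ :=
  h.isStationaryGWI.lintegral_X_lt_top h.lintegral_A_lt_one h.lintegral_B_lt_top k

lemma identDistrib_realA (i : ℤ) (j : ℕ) :
    IdentDistrib (fun ω => (A i j ω : ℝ)) (fun ω => (A 0 0 ω : ℝ)) P P :=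
  (h.isStationaryGWI.identDistrib_A i j).comp (u := fun n : ℕ => (n : ℝ)) (by fun_prop)

lemma iIndepFun_realA (k : ℤ) : iIndepFun (fun j ω => (A k j ω : ℝ)) P := by
  have h1 : iIndepFun (fun j => A k j) P :=
    h.isStationaryGWI.indep.precomp (g := fun j : ℕ => Sum.inl (k, j))
      (fun a b hab => by simpa using hab)
  exact h1.comp (fun _ n => (n : ℝ)) fun _ => by fun_prop

lemma measureReal_sum_A_sub_le (k : ℤ) (n : ℕ) {y : ℝ} (hy : 0 < y) :
    P {ω | y < |(∑ j ∈ Finset.range n, A k j ω : ℕ) - μ * n|} ≤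
      n * ENNReal.ofReal (variance (fun ω => (A 0 0 ω : ℝ)) P / y ^ 2) := by
  have hmem : ∀ j, MemLp (fun ω => (A k j ω : ℝ)) 2 P := fun j =>
    (h.identDistrib_realA k j).memLp_iff.2 h.memLp
  have hS : MemLp (fun ω => ∑ j ∈ Finset.range n, (A k j ω : ℝ)) 2 P :=
    memLp_finsetSum _ fun j _ => hmem j
  have hE : ∫ ω, ∑ j ∈ Finset.range n, (A k j ω : ℝ) ∂P = μ * n := by
    rw [integral_finsetSum _ fun j _ => (hmem j).integrable (by norm_num)]
    have : ∀ j, ∫ ω, (A k j ω : ℝ) ∂P = μ := fun j => by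
      rw [(h.identDistrib_realA k j).integral_eq, h.mean]
    simp [this, mul_comm]
  have hV : variance (fun ω => ∑ j ∈ Finset.range n, (A k j ω : ℝ)) P =
      n * variance (fun ω => (A 0 0 ω : ℝ)) P := by
    have h1 := IndepFun.variance_sum (X := fun j ω => (A k j ω : ℝ)) (s := Finset.range n)
      (fun j _ => hmem j) (fun i _ j _ hij => (h.iIndepFun_realA k).indepFun hij)
    have h2 : (∑ j ∈ Finset.range n, fun ω => (A k j ω : ℝ)) =
      fun ω => ∑ j ∈ Finset.range n, (A k j ω : ℝ) := by ext; simp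
    rw [h2] at h1
    rw [h1, Finset.sum_congr rfl fun j _ => (h.identDistrib_realA k j).variance_eq]
    simp
  have h3 := meas_ge_le_variance_div_sq hS hy
  rw [hE, hV, mul_div_assoc, ENNReal.ofReal_mul (by positivity), ENNReal.ofReal_natCast] at h3
  refine le_trans (measure_mono fun ω hω => ?_) h3
  simp only [Set.mem_ofPred_eq, Nat.cast_sum] at hω ⊢
  exact hω.le

/-- Chebyshev's inequality for the reproduction of a whole generation. -/
lemma exists_measureReal_offspring_sub_le : ∃ C : ℝ, 0 ≤ C ∧ ∀ (k : ℤ) (y : ℝ), 0 < y →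
    P.real {ω | y < |((∑ j ∈ Finset.range (X k ω), A (k + 1) j ω : ℕ) : ℝ) - μ * X k ω|} ≤
      C / y ^ 2 := by
  set v := variance (fun ω => (A 0 0 ω : ℝ)) P with hv
  set E := ∫⁻ ω, (X 0 ω : ENNReal) ∂P with hE
  have hEtop := h.lintegral_X_lt_top 0
  have hv0 : 0 ≤ v := variance_nonneg _ _
  -- Given `X k = n`, the offspring total has variance `n * v`; averaging over `X k` yields the
  -- constant `E * v`, finite by the first moment bound.
  refine ⟨E.toReal * v, by positivity, fun k y hy => ?_⟩
  have hX := h.isStationaryGWI.measurable_X k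
  have hind : IndepFun (X k) (innovation A B (k + 1)) P := by
    have := (h.indepFun_history k).comp (φ := fun f : ℕ → ℕ => f 0) (ψ := id)
      (measurable_pi_apply (X := fun _ : ℕ => ℕ) 0) measurable_id
    simpa [Function.comp_def, history] using this
  set T : Set (ℕ × ((ℕ → ℕ) × ℕ)) :=
    {z | y < |((∑ j ∈ Finset.range z.1, z.2.1 j : ℕ) : ℝ) - μ * z.1|} with hT
  have hTm : MeasurableSet T := by
    refine measurableSet_lt measurable_const (measurable_from_prod_countable_right fun n => ?_)
    simp only
    fun_prop
  have h1 := lintegral_of_indepFun hind hX (h.isStationaryGWI.measurable_innovation (k + 1))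
    (F := T.indicator (fun _ => (1 : ENNReal))) (measurable_const.indicator hTm)
  have h2 : P {ω | y < |((∑ j ∈ Finset.range (X k ω), A (k + 1) j ω : ℕ) : ℝ) - μ * X k ω|} =
      ∫⁻ ω, T.indicator (fun _ => (1 : ENNReal)) (X k ω, innovation A B (k + 1) ω) ∂P := by
    have hm : MeasurableSet ((fun ω => (X k ω, innovation A B (k + 1) ω)) ⁻¹' T) :=
      (hX.prodMk (h.isStationaryGWI.measurable_innovation (k + 1))) hTm
    exact (lintegral_indicator_one (μ := P) hm).symm
  have h3 : ∀ ω, ∫⁻ ω', T.indicator (fun _ => (1 : ENNReal)) (X k ω, innovation A B (k + 1) ω') ∂P ≤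
      X k ω * ENNReal.ofReal (v / y ^ 2) := by
    intro ω
    refine le_trans (le_of_eq ?_) (h.measureReal_sum_A_sub_le (k + 1) (X k ω) hy)
    have hm : MeasurableSet ((fun ω' => (X k ω, innovation A B (k + 1) ω')) ⁻¹' T) :=
      (measurable_const.prodMk (h.isStationaryGWI.measurable_innovation (k + 1))) hTm
    exact lintegral_indicator_one (μ := P) hm
  have h4 : P {ω | y < |((∑ j ∈ Finset.range (X k ω), A (k + 1) j ω : ℕ) : ℝ) - μ * X k ω|} ≤
      E * ENNReal.ofReal (v / y ^ 2) := by
    rw [h2, h1]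
    refine (lintegral_mono h3).trans (le_of_eq ?_)
    rw [lintegral_mul_const' _ _ ENNReal.ofReal_ne_top]
    congr 1
    exact ((h.isStationaryGWI.identDistrib_X k).comp (u := fun n : ℕ => (n : ENNReal))
      (by fun_prop)).lintegral_eq
  have h5 := ENNReal.toReal_mono (ENNReal.mul_ne_top hEtop.ne ENNReal.ofReal_ne_top) h4
  rw [ENNReal.toReal_mul, ENNReal.toReal_ofReal (by positivity), ← mul_div_assoc] at h5
  exact h5

lemma measureReal_inter_B (k : ℤ) (S : Set ℕ) (T : Set ℕ) :
    P.real ({ω | X k ω ∈ S} ∩ {ω | B (k + 1) ω ∈ T}) =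
      P.real {ω | X k ω ∈ S} * P.real {ω | B (k + 1) ω ∈ T} := by
  have := (h.indepFun_history k).comp (φ := fun f : ℕ → ℕ => f 0) (ψ := Prod.snd)
      (measurable_pi_apply (X := fun _ : ℕ => ℕ) 0) measurable_snd
  have h1 := this.measure_inter_preimage_eq_mul S T MeasurableSet.of_discrete
    MeasurableSet.of_discrete
  simp only [Function.comp_def, history, innovation, Nat.cast_zero, sub_zero] at h1
  simp only [measureReal_def, ← ENNReal.toReal_mul]
  congr 1

/-- If neither `μ * X k` nor `B (k + 1)` exceeds `(1 - δ) * x`, then passing level `x` requires both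
to exceed `δ / 2 * x` or the offspring total to fluctuate by that amount. The first alternative has
a product probability by independence. -/
lemma tail_le_add (k : ℤ) (C : ℝ) (hC : ∀ (k : ℤ) (y : ℝ), 0 < y →
      P.real {ω | y < |((∑ j ∈ Finset.range (X k ω), A (k + 1) j ω : ℕ) : ℝ) - μ * X k ω|} ≤
      C / y ^ 2) {δ x : ℝ} (hδ : 0 < δ) (hx : 0 < x) :
    tail P X x ≤ tail P X ((1 - δ) / μ * x) + P.real {ω | (1 - δ) * x < (B 0 ω : ℝ)} +
      (tail P X (δ / 2 / μ * x) * P.real {ω | δ / 2 * x < (B 0 ω : ℝ)} +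
        C / (δ / 2 * x) ^ 2) := by
  have hμ := h.mean_mem.1
  have hs := h.isStationaryGWI
  have e1 : tail P X x = P.real {ω | x < (X (k + 1) ω : ℝ)} :=
    (hs.measureReal_lt_X (k + 1) x).symm
  have hsub : ∀ᵐ ω ∂P, ω ∈ {ω | x < (X (k + 1) ω : ℝ)} → ω ∈ (
      ({ω | (1 - δ) / μ * x < (X k ω : ℝ)} ∪ {ω | (1 - δ) * x < (B (k + 1) ω : ℝ)}) ∪
      (({ω | δ / 2 / μ * x < (X k ω : ℝ)} ∩ {ω | δ / 2 * x < (B (k + 1) ω : ℝ)}) ∪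
      {ω | δ / 2 * x < |((∑ j ∈ Finset.range (X k ω), A (k + 1) j ω : ℕ) : ℝ) -
        μ * X k ω|}) : Set Ω) := by
    filter_upwards [hs.recursion (k + 1)] with ω hω hlt
    rw [add_sub_cancel_right] at hω
    simp only [Set.mem_union, Set.mem_inter_iff, Set.mem_ofPred_eq] at hlt ⊢
    by_contra hcon
    push Not at hcon
    obtain ⟨⟨c1, c2⟩, c3, c4⟩ := hcon
    rw [div_mul_eq_mul_div, le_div_iff₀ hμ] at c1
    rw [hω] at hlt
    push_cast at hlt c4
    have c5 := (abs_le.1 c4).2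
    by_cases c6 : δ / 2 / μ * x < (X k ω : ℝ)
    · have := c3 c6
      nlinarith
    · rw [not_lt, div_mul_eq_mul_div, le_div_iff₀ hμ] at c6
      nlinarith
  have hle := measureReal_le_of_ae hsub
  have e2 := h.measureReal_inter_B k {n | δ / 2 / μ * x < (n : ℝ)} {n | δ / 2 * x < (n : ℝ)}
  simp only [Set.mem_ofPred_eq] at e2
  rw [hs.measureReal_lt_X, hs.measureReal_lt_B] at e2
  rw [e1]
  refine hle.trans ((measureReal_union_le _ _).trans (add_le_add
    ((measureReal_union_le _ _).trans (add_le_add ?_ ?_))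
    ((measureReal_union_le _ _).trans (add_le_add ?_ ?_))))
  · exact (hs.measureReal_lt_X _ _).le
  · exact (hs.measureReal_lt_B _ _).le
  · exact e2.le
  · exact hC k _ (by positivity)

/-- Either summand exceeding `(1 + δ) * x` suffices, up to a fluctuation of size `δ * x`.
Inclusion-exclusion and independence produce the product term. -/
lemma add_le_tail (k : ℤ) (C : ℝ) (hC : ∀ (k : ℤ) (y : ℝ), 0 < y →
      P.real {ω | y < |((∑ j ∈ Finset.range (X k ω), A (k + 1) j ω : ℕ) : ℝ) - μ * X k ω|} ≤
      C / y ^ 2) {δ x : ℝ} (hδ : 0 < δ) (hx : 0 < x) :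
    tail P X ((1 + δ) / μ * x) + P.real {ω | (1 + δ) * x < (B 0 ω : ℝ)} -
      (tail P X ((1 + δ) / μ * x) * P.real {ω | (1 + δ) * x < (B 0 ω : ℝ)} +
        C / (δ * x) ^ 2) ≤ tail P X x := by
  have hμ := h.mean_mem.1
  have hs := h.isStationaryGWI
  have e1 : tail P X x = P.real {ω | x < (X (k + 1) ω : ℝ)} :=
    (hs.measureReal_lt_X (k + 1) x).symm
  have hsub : ∀ᵐ ω ∂P, ω ∈ ({ω | (1 + δ) / μ * x < (X k ω : ℝ)} ∪
      {ω | (1 + δ) * x < (B (k + 1) ω : ℝ)} : Set Ω) → ω ∈ ({ω | x < (X (k + 1) ω : ℝ)} ∪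
      {ω | δ * x < |((∑ j ∈ Finset.range (X k ω), A (k + 1) j ω : ℕ) : ℝ) -
        μ * X k ω|} : Set Ω) := by
    filter_upwards [hs.recursion (k + 1)] with ω hω hlt
    rw [add_sub_cancel_right] at hω
    simp only [Set.mem_union, Set.mem_ofPred_eq] at hlt ⊢
    by_contra hcon
    push Not at hcon
    obtain ⟨c1, c4⟩ := hcon
    rw [hω] at c1
    push_cast at c1 c4
    have c5 := (abs_le.1 c4).1
    have c6 : (0 : ℝ) ≤ ∑ j ∈ Finset.range (X k ω), (A (k + 1) j ω : ℝ) := by positivity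
    have c7 : (0 : ℝ) ≤ B (k + 1) ω := by positivity
    rcases hlt with hlt | hlt
    · rw [div_mul_eq_mul_div, div_lt_iff₀ hμ] at hlt
      nlinarith
    · nlinarith
  have hle := measureReal_le_of_ae hsub
  have e2 := h.measureReal_inter_B k {n | (1 + δ) / μ * x < (n : ℝ)}
    {n | (1 + δ) * x < (n : ℝ)}
  simp only [Set.mem_ofPred_eq] at e2
  have e3 := measureReal_union_add_inter (μ := P) (s := {ω | (1 + δ) / μ * x < (X k ω : ℝ)})
    (t := {ω | (1 + δ) * x < (B (k + 1) ω : ℝ)})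
    (measurableSet_lt measurable_const (by have := hs.measurable_B (k + 1); fun_prop))
  rw [e2] at e3
  simp only [hs.measureReal_lt_X, hs.measureReal_lt_B] at e3
  have e4 := hC k (δ * x) (by positivity)
  have e5 := hle.trans (measureReal_union_le _ _)
  rw [hs.measureReal_lt_X] at e5
  linarith

/-- The stationary distribution inherits the regularly varying tail of the immigration. -/
lemma isRVTail_tail : IsRVTail (tail P X) α := by
  have hb := h.isRVTail_B
  obtain ⟨C, hC0, hC⟩ := h.exists_measureReal_offspring_sub_le
  have hμ := h.mean_mem.1
  have ht := h.isStationaryGWI.tendsto_tail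
  have hα := h.index_mem.1
  have hcomp : ∀ c > 0, Tendsto (fun x => tail P X (c * x)) atTop (𝓝 0) := fun c hc =>
    ht.comp (tendsto_id.const_mul_atTop hc)
  -- Relative to the immigration tail, the product term is a bounded ratio times a vanishing tail,
  -- and the Chebyshev term vanishes because `α < 2`.
  have herr : ∀ c > 0, ∀ d > 0, ∀ d' > 0, Tendsto (fun x =>
      (tail P X (c * x) * P.real {ω | d * x < (B 0 ω : ℝ)} + C / (d' * x) ^ 2) /
        P.real {ω | x < (B 0 ω : ℝ)}) atTop (𝓝 0) := by
    intro c hc d hd d' hd'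
    have h1 := ((hcomp c hc).mul (hb.tendsto_div d hd)).add
      (hb.tendsto_inv_sq_div h.index_mem.2 (C / d' ^ 2))
    simp only [zero_mul, add_zero] at h1
    refine h1.congr fun x => ?_
    rw [add_div, mul_div_assoc, mul_pow, div_div C]
  refine hb.of_tendsto_div (c := 1 / (1 - μ ^ α)) ?_ antitone_tail tail_nonneg
    (hb.tendsto_div_of_recursion (by linarith) h.mean_mem tail_nonneg ht ?_ ?_)
  · have := Real.rpow_lt_one hμ.le h.mean_mem.2 (by linarith : 0 < α)
    have : 0 < 1 - μ ^ α := by linarith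
    positivity
  · intro δ hδ
    refine ⟨_, herr (δ / 2 / μ) (by have := hδ.1; positivity) (δ / 2) (by linarith [hδ.1])
      (δ / 2) (by linarith [hδ.1]), ?_⟩
    filter_upwards [eventually_gt_atTop 0] with x hx
    exact h.tail_le_add 0 C hC hδ.1 hx
  · intro δ hδ
    refine ⟨_, herr ((1 + δ) / μ) (by have := hδ.1; positivity) (1 + δ) (by linarith [hδ.1])
      δ hδ.1, ?_⟩
    filter_upwards [eventually_gt_atTop 0] with x hx
    exact h.add_le_tail 0 C hC hδ.1 hx

end IsRegularGWI

end GWI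

/-! ### Geometric decay after a large value. -/

namespace GWI

variable {Ω : Type*} [mΩ : MeasurableSpace Ω] {P : Measure Ω} [IsProbabilityMeasure P]
  {X : ℤ → Ω → ℕ} {A : ℤ → ℕ → Ω → ℕ} {B : ℤ → Ω → ℕ} {μ α : ℝ}

lemma IsStationaryGWI.measureReal_shift (h : IsStationaryGWI P X A B) (i j s : ℤ)
    (S : Set (ℕ × ℕ)) :
    P.real {ω | (X (i + s) ω, X (j + s) ω) ∈ S} = P.real {ω | (X i ω, X j ω) ∈ S} := by
  simp only [measureReal_def]
  congr 1
  have hm : Measurable fun f : ℤ → ℕ => (f i, f j) :=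
    (measurable_pi_apply (X := fun _ : ℤ => ℕ) i).prodMk
      (measurable_pi_apply (X := fun _ : ℤ => ℕ) j)
  exact ((h.stationary s).comp hm).measure_mem_eq (s := S) MeasurableSet.of_discrete

/-- The bound `R` may depend on `η`, so a truncation parameter can be fixed before the limit in `x`
is taken. -/
lemma tendsto_zero_of_forall_bound {ι E : Type*} [SeminormedAddCommGroup E] {l : Filter ι}
    {g : ι → E}
    (h : ∀ η > 0, ∃ (R : ι → ℝ) (r : ℝ), (∀ᶠ x in l, ‖g x‖ ≤ R x) ∧ Tendsto R l (𝓝 r) ∧ r < η) :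
    Tendsto g l (𝓝 0) := by
  rw [tendsto_zero_iff_norm_tendsto_zero, Metric.tendsto_nhds]
  intro η hη
  obtain ⟨R, r, h1, h2, h3⟩ := h η hη
  filter_upwards [h1, h2.eventually (gt_mem_nhds h3)] with x hx1 hx2
  rw [Real.dist_eq, sub_zero, abs_of_nonneg (norm_nonneg _)]
  exact lt_of_le_of_lt hx1 hx2

lemma norm_integral_sub_le {f g : Ω → ℂ} (hf : Integrable f P) (hg : Integrable g P) {S T : Set Ω}
    (hS : MeasurableSet S) (hT : MeasurableSet T) {η C : ℝ}
    (h : ∀ ω, ‖f ω - g ω‖ ≤ S.indicator (fun _ => η) ω + T.indicator (fun _ => C) ω) :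
    ‖∫ ω, f ω ∂P - ∫ ω, g ω ∂P‖ ≤ η * P.real S + C * P.real T := by
  rw [← integral_sub hf hg]
  refine (norm_integral_le_integral_norm _).trans ?_
  have h1 : Integrable (S.indicator fun _ => η) P := (integrable_const η).indicator hS
  have h2 : Integrable (T.indicator fun _ => C) P := (integrable_const C).indicator hT
  refine (integral_mono (hf.sub hg).norm (h1.add h2) h).trans (le_of_eq ?_)
  simp only [Pi.add_apply]
  rw [integral_add h1 h2, integral_indicator_const _ hS, integral_indicator_const _ hT]
  simp [mul_comm]

namespace IsRegularGWI

variable (h : IsRegularGWI P X A B μ α)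
include h

lemma measurable_realX (k : ℤ) : Measurable fun ω => (X k ω : ℝ) := by
  have := h.isStationaryGWI.measurable_X k
  fun_prop

lemma tendsto_tail_B : Tendsto (fun x => P.real {ω | x < (B 0 ω : ℝ)}) atTop (𝓝 0) := by
  refine squeeze_zero (fun _ => measureReal_nonneg) (fun x => ?_) h.isStationaryGWI.tendsto_tail
  refine measureReal_le_of_ae ?_
  filter_upwards [h.isStationaryGWI.recursion 0] with ω hω hlt
  change x < (B 0 ω : ℝ) at hlt
  refine lt_of_lt_of_le hlt ?_
  rw [hω]
  exact_mod_cast Nat.le_add_left _ _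

lemma measureReal_inter_B_of_le (j : ℕ) (S : Set ℕ) (T : Set ℕ) :
    P.real ({ω | X 0 ω ∈ S} ∩ {ω | B (j + 1) ω ∈ T}) =
      P.real {ω | X 0 ω ∈ S} * P.real {ω | B (j + 1) ω ∈ T} := by
  have := (h.indepFun_history j).comp (φ := fun f : ℕ → ℕ => f j) (ψ := Prod.snd)
      (measurable_pi_apply (X := fun _ : ℕ => ℕ) j) measurable_snd
  have h1 := this.measure_inter_preimage_eq_mul S T MeasurableSet.of_discrete
    MeasurableSet.of_discrete
  simp only [Function.comp_def, history, innovation, sub_self] at h1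
  simp only [measureReal_def, ← ENNReal.toReal_mul]
  congr 1

/-- A deviation of order `x` comes from the offspring, with probability `O(x⁻²)`, or from `B (j +
1)`. The latter is independent of `X 0`, so a second large value costs a further vanishing factor.
-/
lemma tendsto_step_deviation (j : ℕ) {ε δ : ℝ} (hε : 0 < ε) (hδ : 0 < δ) :
    Tendsto (fun x => P.real {ω | ε * x < (X 0 ω : ℝ) ∧
      δ * x < |(X (j + 1) ω : ℝ) - μ * X j ω|} / tail P X x) atTop (𝓝 0) := by
  obtain ⟨C, hC0, hC⟩ := h.exists_measureReal_offspring_sub_le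
  have hs := h.isStationaryGWI
  have hp := h.isRVTail_tail
  have hlim : Tendsto (fun x => C / (δ / 2) ^ 2 / x ^ 2 / tail P X x +
      tail P X (ε * x) / tail P X x * P.real {ω | δ / 2 * x < (B 0 ω : ℝ)}) atTop (𝓝 0) := by
    have h1 := (hp.tendsto_inv_sq_div h.index_mem.2 (C / (δ / 2) ^ 2)).add
      ((hp.tendsto_div ε hε).mul (h.tendsto_tail_B.comp
        (tendsto_id.const_mul_atTop (by positivity : 0 < δ / 2))))
    simpa only [mul_zero, add_zero, Function.comp_def, id] using h1
  refine squeeze_zero' (Eventually.of_forall fun x => div_nonneg measureReal_nonneg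
    (tail_nonneg x)) ?_ hlim
  filter_upwards [eventually_gt_atTop 0] with x hx
  have h1 : P.real {ω | ε * x < (X 0 ω : ℝ) ∧ δ * x < |(X (j + 1) ω : ℝ) - μ * X j ω|} ≤
      P.real ({ω | δ / 2 * x < |((∑ i ∈ Finset.range (X j ω), A (j + 1) i ω : ℕ) : ℝ) -
        μ * X j ω|} ∪ ({ω | ε * x < (X 0 ω : ℝ)} ∩ {ω | δ / 2 * x < (B (j + 1) ω : ℝ)})) := by
    refine measureReal_le_of_ae ?_
    filter_upwards [hs.recursion (j + 1)] with ω hω hlt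
    rw [add_sub_cancel_right] at hω
    simp only [Set.mem_union, Set.mem_inter_iff, Set.mem_ofPred_eq] at hlt ⊢
    by_contra hcon
    push Not at hcon
    have h2 := hcon.2 hlt.1
    have h3 := hlt.2
    rw [hω] at h3
    push_cast at h3
    have h5 := abs_add_le ((∑ i ∈ Finset.range (X j ω), (A (j + 1) i ω : ℝ)) - μ * X j ω)
      (B (j + 1) ω)
    have h6 : |(B (j + 1) ω : ℝ)| = B (j + 1) ω := abs_of_nonneg (by positivity)
    have h4 := hcon.1
    push_cast at h4
    rw [show (∑ i ∈ Finset.range (X j ω), (A (j + 1) i ω : ℝ)) + (B (j + 1) ω) - μ * X j ω =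
      (∑ i ∈ Finset.range (X j ω), (A (j + 1) i ω : ℝ)) - μ * X j ω + B (j + 1) ω by ring] at h3
    linarith
  have h2 := h.measureReal_inter_B_of_le j {n | ε * x < (n : ℝ)} {n | δ / 2 * x < (n : ℝ)}
  simp only [Set.mem_ofPred_eq] at h2
  rw [hs.measureReal_lt_X, hs.measureReal_lt_B] at h2
  have h3 := h1.trans (measureReal_union_le _ _)
  rw [h2] at h3
  have h4 := hC j (δ / 2 * x) (by positivity)
  have hpx := hp.pos x
  calc _ ≤ (C / (δ / 2 * x) ^ 2 + tail P X (ε * x) * P.real {ω | δ / 2 * x < (B 0 ω : ℝ)}) /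
        tail P X x := by gcongr; linarith
    _ = _ := by rw [add_div, mul_pow, div_div C]; ring

/-- Given a large generation, the following ones decay geometrically. -/
lemma tendsto_deviation (j : ℕ) {ε δ : ℝ} (hε : 0 < ε) (hδ : 0 < δ) :
    Tendsto (fun x => P.real {ω | ε * x < (X 0 ω : ℝ) ∧
      δ * x < |(X j ω : ℝ) - μ ^ j * X 0 ω|} / tail P X x) atTop (𝓝 0) := by
  have hμ0 := h.mean_mem.1
  have hμ1 := h.mean_mem.2
  induction j generalizing δ with
  | zero =>
    refine tendsto_const_nhds.congr' ?_
    filter_upwards [eventually_gt_atTop 0] with x hx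
    have : {ω | ε * x < (X 0 ω : ℝ) ∧ δ * x < |(X (0 : ℕ) ω : ℝ) - μ ^ 0 * X 0 ω|} = ∅ := by
      ext ω
      simp only [Set.mem_ofPred_eq, Set.mem_empty_iff_false, iff_false, not_and, not_lt]
      intro _
      simp
      positivity
    rw [this]
    simp
  | succ j ih =>
    have h1 := (ih (half_pos hδ)).add (h.tendsto_step_deviation j hε (half_pos hδ))
    rw [add_zero] at h1
    refine squeeze_zero' (Eventually.of_forall fun x => div_nonneg measureReal_nonneg
      (tail_nonneg x)) ?_ h1
    filter_upwards [eventually_gt_atTop 0] with x hx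
    rw [← add_div]
    refine div_le_div_of_nonneg_right ?_ (tail_nonneg x)
    refine (measureReal_mono ?_).trans (measureReal_union_le _ _)
    intro ω hω
    simp only [Set.mem_union, Set.mem_ofPred_eq] at hω ⊢
    by_contra hcon
    push Not at hcon
    have h2 := hcon.1 hω.1
    have h3 := hcon.2 hω.1
    have h4 := hω.2
    push_cast at h4
    -- The earlier error is inherited with factor `μ < 1`, so halving `δ` at each step suffices.
    rw [show (X (j + 1) ω : ℝ) - μ ^ (j + 1) * X 0 ω = ((X (j + 1) ω : ℝ) - μ * X j ω) +
      μ * ((X j ω : ℝ) - μ ^ j * X 0 ω) by ring] at h4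
    have h5 := abs_add_le ((X (j + 1) ω : ℝ) - μ * X j ω) (μ * ((X j ω : ℝ) - μ ^ j * X 0 ω))
    rw [abs_mul, abs_of_pos hμ0] at h5
    have h6 : μ * |(X j ω : ℝ) - μ ^ j * X 0 ω| ≤ 1 * |(X j ω : ℝ) - μ ^ j * X 0 ω| :=
      mul_le_mul_of_nonneg_right hμ1.le (abs_nonneg _)
    linarith

lemma tendsto_deviation_shift (j : ℕ) (s : ℤ) {ε δ : ℝ} (hε : 0 < ε) (hδ : 0 < δ) :
    Tendsto (fun x => P.real {ω | ε * x < (X s ω : ℝ) ∧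
      δ * x < |(X (s + j) ω : ℝ) - μ ^ j * X s ω|} / tail P X x) atTop (𝓝 0) := by
  refine (h.tendsto_deviation j hε hδ).congr fun x => ?_
  have := h.isStationaryGWI.measureReal_shift 0 j s
    {z | ε * x < (z.1 : ℝ) ∧ δ * x < |(z.2 : ℝ) - μ ^ j * z.1|}
  simp only [Set.mem_ofPred_eq, zero_add, add_comm (j : ℤ) s] at this
  rw [this]

end IsRegularGWI

/-! ### The Pareto limit at time zero. -/

section Pareto

variable {Ω' : Type*} [MeasurableSpace Ω'] {P' : Measure Ω'} [IsProbabilityMeasure P']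
  {Y₀ : Ω' → ℝ}

/-- Continuity of `y ^ (-α)` turns closed tails into open ones for `a ≥ 1`; below `1` the tail is
full because it already is at `1`. -/
lemma measureReal_lt_of_pareto
    (hY₀ : ∀ y : ℝ, 1 ≤ y → P'.real {ω | y ≤ Y₀ ω} = y ^ (-α)) (a : ℝ) :
    P'.real {ω | a < Y₀ ω} = (max a 1) ^ (-α) := by
  have key : ∀ a : ℝ, 1 ≤ a → P'.real {ω | a < Y₀ ω} = a ^ (-α) := by
    intro a ha
    refine le_antisymm ?_ ?_
    · rw [← hY₀ a ha]
      exact measureReal_mono fun ω (hω : a < Y₀ ω) => le_of_lt hω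
    · have h1 : Tendsto (fun y : ℝ => y ^ (-α)) (𝓝[>] a) (𝓝 (a ^ (-α))) :=
        (Real.continuousAt_rpow_const a (-α) (Or.inl (by linarith))).tendsto.mono_left
          nhdsWithin_le_nhds
      refine le_of_tendsto h1 ?_
      filter_upwards [self_mem_nhdsWithin] with y hy
      rw [← hY₀ y (ha.trans (le_of_lt hy))]
      exact measureReal_mono fun ω (hω : y ≤ Y₀ ω) => lt_of_lt_of_le hy hω
  rcases le_or_gt 1 a with ha | ha
  · rw [max_eq_left ha, key a ha]
  · rw [max_eq_right ha.le, Real.one_rpow]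
    refine le_antisymm measureReal_le_one ?_
    have := key 1 le_rfl
    rw [Real.one_rpow] at this
    rw [← this]
    exact measureReal_mono fun ω (hω : 1 < Y₀ ω) => ha.trans hω

lemma cond_real_eq {S T : Set Ω} (hS : MeasurableSet S) :
    (cond P S).real T = P.real (S ∩ T) / P.real S := by
  rw [measureReal_def, cond_apply hS, ENNReal.toReal_mul, ENNReal.toReal_inv, div_eq_inv_mul]
  rfl

/-- The mean of `f` conditionally on `X 0 > x`. -/
def tailMean (P : Measure Ω) (X : ℤ → Ω → ℕ) (x : ℝ) (f : Ω → ℂ) : ℂ :=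
  (tail P X x : ℂ)⁻¹ * ∫ ω in {ω | x < (X 0 ω : ℝ)}, f ω ∂P

lemma integral_cond_eq_tailMean (x : ℝ) (f : Ω → ℂ) :
    ∫ ω, f ω ∂(cond P {ω | x < (X 0 ω : ℝ)}) = tailMean P X x f := by
  rw [ProbabilityTheory.cond, integral_smul_measure, tailMean]
  simp only [ENNReal.toReal_inv, tail, measureReal_def]
  rw [Complex.real_smul]
  simp

lemma IsRegularGWI.tendsto_tailMean_exp (h : IsRegularGWI P X A B μ α)
    (hY₀_meas : Measurable Y₀)
    (hY₀ : ∀ y : ℝ, 1 ≤ y → P'.real {ω | y ≤ Y₀ ω} = y ^ (-α)) (θ : ℝ) :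
    Tendsto (fun x : ℝ => tailMean P X x fun ω =>
      Complex.exp ((θ * (X 0 ω / x) : ℝ) * Complex.I)) atTop
      (𝓝 (∫ ω, Complex.exp ((θ * Y₀ ω : ℝ) * Complex.I) ∂P')) := by
  have hp := h.isRVTail_tail
  have hXm := h.measurable_realX 0
  have hSm : ∀ x : ℝ, MeasurableSet {ω | x < (X 0 ω : ℝ)} := fun x =>
    measurableSet_lt measurable_const hXm
  have hne : ∀ x : ℝ, P {ω | x < (X 0 ω : ℝ)} ≠ 0 := fun x h0 => by
    have := hp.pos x
    simp [tail, measureReal_def, h0] at this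
  have hprob : ∀ x : ℝ, IsProbabilityMeasure (cond P {ω | x < (X 0 ω : ℝ)}) := fun x =>
    cond_isProbabilityMeasure (hne x)
  have hm : ∀ x : ℝ, Measurable fun ω => (X 0 ω : ℝ) / x := fun x => hXm.div_const x
  let ν : ℝ → ProbabilityMeasure ℝ := fun x =>
    ⟨(cond P {ω | x < (X 0 ω : ℝ)}).map fun ω => (X 0 ω : ℝ) / x,
      have := hprob x; Measure.isProbabilityMeasure_map (hm x).aemeasurable⟩
  let ν₀ : ProbabilityMeasure ℝ := ⟨P'.map Y₀, Measure.isProbabilityMeasure_map hY₀_meas.aemeasurable⟩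
  have hIoi : ∀ a : ℝ, Tendsto (fun x => (ν x : Measure ℝ).real (Set.Ioi a)) atTop
      (𝓝 ((ν₀ : Measure ℝ).real (Set.Ioi a))) := by
    intro a
    have e0 : (ν₀ : Measure ℝ).real (Set.Ioi a) = (max a 1) ^ (-α) := by
      rw [← measureReal_lt_of_pareto hY₀ a]
      exact map_measureReal_apply hY₀_meas measurableSet_Ioi
    rw [e0]
    refine (hp.tendsto_div (max a 1) (by positivity)).congr' ?_
    filter_upwards [eventually_gt_atTop 0] with x hx
    have e1 : (ν x : Measure ℝ).real (Set.Ioi a) =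
        (cond P {ω | x < (X 0 ω : ℝ)}).real ((fun ω => (X 0 ω : ℝ) / x) ⁻¹' Set.Ioi a) :=
      map_measureReal_apply (hm x) measurableSet_Ioi
    rw [e1, cond_real_eq (hSm x)]
    unfold tail
    congr 2
    ext ω
    simp only [Set.mem_inter_iff, Set.mem_preimage, Set.mem_Ioi, Set.mem_ofPred_eq]
    -- Conditioning on `X 0 > x` merges with `X 0 > a * x` into a single tail event at `max a 1 *
    -- x`, so regular variation gives the limit at every `a`.
    rw [lt_div_iff₀ hx, max_mul_of_nonneg _ _ hx.le, max_lt_iff, one_mul, and_comm]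
  have hconv : Tendsto ν atTop (𝓝 ν₀) := by
    refine (isPiSystem_Ioc (id : ℝ → ℝ) id).tendsto_probabilityMeasure_of_tendsto_of_mem ?_ ?_ ?_
    · rintro s ⟨a, b, -, rfl⟩
      exact measurableSet_Ioc
    · intro u hu y hy
      obtain ⟨ε, hε, hsub⟩ := Metric.isOpen_iff.1 hu y hy
      refine ⟨Set.Ioc (y - ε / 2) (y + ε / 2), ⟨y - ε / 2, y + ε / 2, by simp; linarith, rfl⟩,
        Ioc_mem_nhds (by linarith) (by linarith), fun z hz => hsub ?_⟩
      rw [Metric.mem_ball, Real.dist_eq, abs_lt]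
      constructor <;> linarith [hz.1, hz.2]
    · rintro s ⟨a, b, hab, rfl⟩
      have e : ∀ (ρ : ProbabilityMeasure ℝ), (ρ (Set.Ioc a b) : ℝ) =
          (ρ : Measure ℝ).real (Set.Ioi a) - (ρ : Measure ℝ).real (Set.Ioi b) := by
        intro ρ
        have h1 : Set.Ioc a b = Set.Ioi a \ Set.Ioi b := by
          ext z; simp
        simp only [id] at hab
        have h2 := measureReal_sdiff (μ := (ρ : Measure ℝ))
          (Set.Ioi_subset_Ioi (le_of_lt hab)) (measurableSet_Ioi (a := b))
        rw [← h1] at h2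
        exact h2
      rw [← NNReal.tendsto_coe]
      simp only [id]
      rw [e ν₀]
      refine ((hIoi a).sub (hIoi b)).congr fun x => (e (ν x)).symm
  rw [ProbabilityMeasure.tendsto_iff_forall_integral_rclike_tendsto ℂ] at hconv
  have h1 := hconv (BoundedContinuousFunction.innerProbChar θ)
  simp only [BoundedContinuousFunction.innerProbChar_apply] at h1
  have e0 : ∫ z, Complex.exp ((inner ℝ z θ : ℝ) * Complex.I) ∂(ν₀ : Measure ℝ) =
      ∫ ω, Complex.exp ((θ * Y₀ ω : ℝ) * Complex.I) ∂P' := by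
    refine (integral_map hY₀_meas.aemeasurable ?_).trans ?_
    · exact (by fun_prop : Continuous _).aestronglyMeasurable
    · simp
  rw [e0] at h1
  refine h1.congr fun x => ?_
  refine (integral_map (hm x).aemeasurable ?_).trans ?_
  · exact (by fun_prop : Continuous _).aestronglyMeasurable
  · rw [← integral_cond_eq_tailMean]
    simp

end Pareto

end GWI

/-! ### Large ancestors before time zero. -/

namespace GWI

variable {Ω : Type*} [mΩ : MeasurableSpace Ω] {P : Measure Ω} [IsProbabilityMeasure P]
  {X : ℤ → Ω → ℕ} {A : ℤ → ℕ → Ω → ℕ} {B : ℤ → Ω → ℕ} {μ α : ℝ}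

lemma norm_exp_mul_I_sub_le (a b : ℝ) :
    ‖Complex.exp (a * Complex.I) - Complex.exp (b * Complex.I)‖ ≤ |a - b| := by
  have h1 : Complex.exp (a * Complex.I) - Complex.exp (b * Complex.I) =
      Complex.exp (b * Complex.I) * (Complex.exp (Complex.I * ((a - b : ℝ) : ℂ)) - 1) := by
    rw [mul_sub, ← Complex.exp_add, mul_one]
    congr 2
    push_cast
    ring
  rw [h1, norm_mul, Complex.norm_exp_ofReal_mul_I, one_mul]
  exact Real.norm_exp_I_mul_ofReal_sub_one_le

/-- The event that the ancestors `j` generations before time `0` are numerous enough to make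
generation `0` exceed a multiple of `x`. -/
def ancestorEvent (X : ℤ → Ω → ℕ) (μ : ℝ) (j : ℕ) (x : ℝ) : Set Ω :=
  {ω | x / 2 < μ ^ j * (X (-j) ω : ℝ)}

lemma measurableSet_ancestorEvent (hX : ∀ k, Measurable fun ω => (X k ω : ℝ)) (j : ℕ) (x : ℝ) :
    MeasurableSet (ancestorEvent X μ j x) :=
  measurableSet_lt measurable_const ((hX _).const_mul _)

lemma integrable_of_norm_le_one {f : Ω → ℂ} (hf : Measurable f) (h : ∀ ω, ‖f ω‖ ≤ 1) :
    Integrable f P :=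
  Integrable.of_bound hf.aestronglyMeasurable 1 (Eventually.of_forall h)

lemma norm_indicator_exp_le (s : Set Ω) (g : Ω → ℝ) (ω : Ω) :
    ‖s.indicator (fun ω => Complex.exp (g ω * Complex.I)) ω‖ ≤ 1 := by
  refine (norm_indicator_le_norm_self _ _).trans ?_
  rw [Complex.norm_exp_ofReal_mul_I]

namespace IsRegularGWI

variable (h : IsRegularGWI P X A B μ α)
include h

lemma measurableSet_lt_X (x : ℝ) : MeasurableSet {ω | x < (X 0 ω : ℝ)} :=
  measurableSet_lt measurable_const (h.measurable_realX 0)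

/-- Stationarity replaces `X (-j)` by `X 0`, and the substitution `y = x / μ ^ j` turns the
expression into a ratio of tails, with limit `μ ^ (α * j)`, times the mean at level `y`. -/
lemma tendsto_integral_ancestor (j : ℕ) {θ : ℝ} {L : ℂ}
    (hL : Tendsto (fun x : ℝ => tailMean P X x fun ω =>
      Complex.exp ((θ * (X 0 ω / x) : ℝ) * Complex.I)) atTop (𝓝 L)) :
    Tendsto (fun x : ℝ => (tail P X x : ℂ)⁻¹ * ∫ ω, {ω | x < μ ^ j * (X (-j) ω : ℝ)}.indicator
      (fun ω => Complex.exp ((θ * (μ ^ j * X (-j) ω / x) : ℝ) * Complex.I)) ω ∂P) atTop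
      (𝓝 ((μ ^ (α * j) : ℝ) * L)) := by
  have hμ := h.mean_mem.1
  have hμj : 0 < μ ^ j := by positivity
  have hp := h.isRVTail_tail
  have h1 : Tendsto (fun x : ℝ => (μ ^ j)⁻¹ * x) atTop atTop :=
    tendsto_id.const_mul_atTop (by positivity)
  have h2 := hp.tendsto_div (μ ^ j)⁻¹ (by positivity)
  have e1 : ((μ ^ j)⁻¹) ^ (-α) = μ ^ (α * j) := by
    rw [Real.inv_rpow hμj.le, Real.rpow_neg hμj.le, inv_inv, mul_comm, Real.rpow_mul hμ.le,
      Real.rpow_natCast]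
  rw [e1] at h2
  have h3 := ((Complex.continuous_ofReal.tendsto _).comp h2).mul (hL.comp h1)
  refine h3.congr fun x => ?_
  have e2 : ∫ ω, {ω | x < μ ^ j * (X (-j) ω : ℝ)}.indicator
      (fun ω => Complex.exp ((θ * (μ ^ j * X (-j) ω / x) : ℝ) * Complex.I)) ω ∂P =
      ∫ ω, {ω | (μ ^ j)⁻¹ * x < (X 0 ω : ℝ)}.indicator
      (fun ω => Complex.exp ((θ * (X 0 ω / ((μ ^ j)⁻¹ * x)) : ℝ) * Complex.I)) ω ∂P := by
    have h4 := ((h.isStationaryGWI.identDistrib_X (-j)).comp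
      (u := fun n : ℕ => {n : ℕ | (μ ^ j)⁻¹ * x < (n : ℝ)}.indicator
        (fun n => Complex.exp ((θ * (n / ((μ ^ j)⁻¹ * x)) : ℝ) * Complex.I)) n)
      (measurable_of_countable _)).integral_eq
    refine Eq.trans (integral_congr_ae (Eventually.of_forall fun ω => ?_)) h4
    simp only [Function.comp_apply, Set.indicator, Set.mem_ofPred_eq, inv_mul_lt_iff₀ hμj]
    congr 5
    field_simp
  rw [e2, integral_indicator (h.measurableSet_lt_X _)]
  simp only [Function.comp_apply, tailMean]
  have h5 : (tail P X ((μ ^ j)⁻¹ * x) : ℂ) ≠ 0 := by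
    exact_mod_cast (hp.pos _).ne'
  rw [Complex.ofReal_div, div_mul_eq_mul_div, ← mul_assoc, mul_inv_cancel₀ h5, one_mul,
    div_eq_inv_mul]

/-- On the ancestor event `X 0` is close to `μ ^ j * X (-j)`, so both the exponential and the
condition `X 0 > x` can be rewritten in terms of the ancestors. The factor `μ ^ (α * j)` will be
matched with the probability of `K ≥ j`. -/
lemma tendsto_tailMean_ancestor (j : ℕ) {θ : ℝ} {L : ℂ}
    (hL : Tendsto (fun x : ℝ => tailMean P X x fun ω =>
      Complex.exp ((θ * (X 0 ω / x) : ℝ) * Complex.I)) atTop (𝓝 L)) :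
    Tendsto (fun x : ℝ => tailMean P X x ((ancestorEvent X μ j x).indicator fun ω =>
      Complex.exp ((θ * (X 0 ω / x) : ℝ) * Complex.I))) atTop (𝓝 ((μ ^ (α * j) : ℝ) * L)) := by
  have hμ := h.mean_mem.1
  have hμj : 0 < μ ^ j := by positivity
  have hp := h.isRVTail_tail
  have hs := h.isStationaryGWI
  rw [← tendsto_sub_nhds_zero_iff] at *
  have h0 := h.tendsto_integral_ancestor j (tendsto_sub_nhds_zero_iff.1 hL)
  rw [← tendsto_sub_nhds_zero_iff] at h0
  suffices hmain : Tendsto (fun x : ℝ => tailMean P X x ((ancestorEvent X μ j x).indicator fun ω =>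
      Complex.exp ((θ * (X 0 ω / x) : ℝ) * Complex.I)) - (tail P X x : ℂ)⁻¹ *
      ∫ ω, {ω | x < μ ^ j * (X (-j) ω : ℝ)}.indicator
        (fun ω => Complex.exp ((θ * (μ ^ j * X (-j) ω / x) : ℝ) * Complex.I)) ω ∂P)
      atTop (𝓝 0) by
    have := hmain.add h0
    rw [add_zero] at this
    exact this.congr fun x => by ring
  have hcross : Tendsto (fun δ : ℝ => |θ| * δ + 2 * (0 + (((1 - δ) / μ ^ j) ^ (-α) -
      ((1 + δ) / μ ^ j) ^ (-α)))) (𝓝[>] 0) (𝓝 0) := by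
    have hc : ContinuousAt (fun δ : ℝ => |θ| * δ + 2 * (0 + (((1 - δ) / μ ^ j) ^ (-α) -
      ((1 + δ) / μ ^ j) ^ (-α)))) 0 := by
      have h1 : ContinuousAt (fun δ : ℝ => ((1 - δ) / μ ^ j) ^ (-α)) 0 :=
        ContinuousAt.rpow_const (by fun_prop) (Or.inl (by simp [hμ.ne']))
      have h2 : ContinuousAt (fun δ : ℝ => ((1 + δ) / μ ^ j) ^ (-α)) 0 :=
        ContinuousAt.rpow_const (by fun_prop) (Or.inl (by simp [hμ.ne']))
      fun_prop
    have := hc.tendsto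
    simp only [mul_zero, sub_zero, add_zero, sub_self] at this
    exact this.mono_left nhdsWithin_le_nhds
  refine tendsto_zero_of_forall_bound fun η hη => ?_
  obtain ⟨δ, hδη, hδ⟩ := ((hcross.eventually (gt_mem_nhds hη)).and
    (Ioo_mem_nhdsGT (by norm_num : (0 : ℝ) < 1 / 2))).exists
  obtain ⟨hδ0, hδ2⟩ := hδ
  have hdev := h.tendsto_deviation_shift j (-j) (ε := 1 / 2 / μ ^ j) (δ := δ) (by positivity) hδ0
  rw [neg_add_cancel] at hdev
  refine ⟨_, _, ?_, (hdev.add ((hp.tendsto_div ((1 - δ) / μ ^ j)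
    (div_pos (by linarith) hμj)).sub (hp.tendsto_div ((1 + δ) / μ ^ j)
    (div_pos (by linarith) hμj)))).const_mul 2 |>.const_add (|θ| * δ), hδη⟩
  filter_upwards [eventually_gt_atTop 0] with x hx
  set S : Set Ω := {ω | x < (X 0 ω : ℝ)}
  set T₁ : Set Ω := {ω | 1 / 2 / μ ^ j * x < (X (-j) ω : ℝ) ∧
    δ * x < |(X 0 ω : ℝ) - μ ^ j * X (-j) ω|} with hT₁
  -- The boundary layer where `X 0 > x` and `μ ^ j * X (-j) > x` may disagree although the two
  -- values are close. Its relative probability has a limit that vanishes with `δ`, by continuity of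
  -- the power function.
  set T₂ : Set Ω := {ω | (1 - δ) / μ ^ j * x < (X (-j) ω : ℝ)} \
    {ω | (1 + δ) / μ ^ j * x < (X (-j) ω : ℝ)} with hT₂
  have hX0 := h.measurable_realX 0
  have hXj := h.measurable_realX (-j)
  have hSm : MeasurableSet S := h.measurableSet_lt_X x
  have hT₁m : MeasurableSet T₁ := by
    have h1 : Measurable fun ω => |(X 0 ω : ℝ) - μ ^ j * X (-j) ω| := by fun_prop
    exact (measurableSet_lt measurable_const hXj).inter (measurableSet_lt measurable_const h1)
  have hT₂m : MeasurableSet T₂ := (measurableSet_lt measurable_const hXj).diff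
    (measurableSet_lt measurable_const hXj)
  have hT₂P : P.real T₂ = tail P X ((1 - δ) / μ ^ j * x) - tail P X ((1 + δ) / μ ^ j * x) := by
    have hle : (1 - δ) / μ ^ j * x ≤ (1 + δ) / μ ^ j * x := by
      gcongr
      linarith
    have hsub : {ω | (1 + δ) / μ ^ j * x < (X (-j) ω : ℝ)} ⊆
        {ω | (1 - δ) / μ ^ j * x < (X (-j) ω : ℝ)} := fun ω hω => lt_of_le_of_lt hle hω
    rw [hT₂, measureReal_sdiff hsub (measurableSet_lt measurable_const hXj),
      hs.measureReal_lt_X, hs.measureReal_lt_X]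
  have hm1 : Measurable fun ω => Complex.exp ((θ * (X 0 ω / x) : ℝ) * Complex.I) := by fun_prop
  have hm2 : Measurable fun ω => Complex.exp ((θ * (μ ^ j * X (-j) ω / x) : ℝ) * Complex.I) := by
    fun_prop
  have hJm := measurableSet_ancestorEvent (μ := μ) h.measurable_realX j x
  have hSm2 : MeasurableSet {ω | x < μ ^ j * (X (-j) ω : ℝ)} :=
    measurableSet_lt measurable_const (hXj.const_mul _)
  set f₁ := S.indicator ((ancestorEvent X μ j x).indicator fun ω =>
      Complex.exp ((θ * (X 0 ω / x) : ℝ) * Complex.I)) with hf₁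
  set f₂ := {ω | x < μ ^ j * (X (-j) ω : ℝ)}.indicator
        (fun ω => Complex.exp ((θ * (μ ^ j * X (-j) ω / x) : ℝ) * Complex.I)) with hf₂
  have hn1 : ∀ ω, ‖f₁ ω‖ ≤ 1 := fun ω =>
    (norm_indicator_le_norm_self _ _).trans (norm_indicator_exp_le _ _ ω)
  have hn2 : ∀ ω, ‖f₂ ω‖ ≤ 1 := fun ω => norm_indicator_exp_le _ _ ω
  have hbound := norm_integral_sub_le (P := P) (f := f₁) (g := f₂) (S := S) (T := T₁ ∪ T₂)
    (η := |θ| * δ) (C := 2)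
    (integrable_of_norm_le_one ((hm1.indicator hJm).indicator hSm) hn1)
    (integrable_of_norm_le_one (hm2.indicator hSm2) hn2) hSm (hT₁m.union hT₂m) ?_
  · have hpx := hp.pos x
    have e1 : tailMean P X x ((ancestorEvent X μ j x).indicator fun ω =>
        Complex.exp ((θ * (X 0 ω / x) : ℝ) * Complex.I)) = (tail P X x : ℂ)⁻¹ * ∫ ω, f₁ ω ∂P := by
      rw [hf₁, integral_indicator hSm]
      rfl
    rw [e1, ← mul_sub, norm_mul, norm_inv, Complex.norm_real, Real.norm_of_nonneg hpx.le,
      inv_mul_le_iff₀ hpx]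
    refine hbound.trans ?_
    have h6 := measureReal_union_le (μ := P) T₁ T₂
    rw [hT₂P] at h6
    have h7 : P.real S = tail P X x := rfl
    rw [h7]
    have h8 : tail P X x * (|θ| * δ + 2 * (P.real T₁ / tail P X x +
        (tail P X ((1 - δ) / μ ^ j * x) / tail P X x -
          tail P X ((1 + δ) / μ ^ j * x) / tail P X x))) = |θ| * δ * tail P X x +
        2 * (P.real T₁ + (tail P X ((1 - δ) / μ ^ j * x) - tail P X ((1 + δ) / μ ^ j * x))) := by
      field_simp
    rw [h8]
    linarith
  · intro ω
    by_cases hω : ω ∈ T₁ ∪ T₂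
    · rw [Set.indicator_of_mem hω]
      have h6 : 0 ≤ S.indicator (fun _ => |θ| * δ) ω :=
        Set.indicator_nonneg (fun _ _ => by positivity) _
      linarith [norm_sub_le (f₁ ω) (f₂ ω), hn1 ω, hn2 ω]
    · rw [Set.indicator_of_notMem hω, add_zero]
      simp only [Set.mem_union, not_or, hT₁, hT₂, Set.mem_ofPred_eq, Set.mem_sdiff, not_and,
        not_lt] at hω
      obtain ⟨hω1, hω2⟩ := hω
      rw [div_mul_eq_mul_div, div_lt_iff₀' hμj] at hω1
      rw [div_mul_eq_mul_div, div_lt_iff₀' hμj, div_mul_eq_mul_div, not_le,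
        div_lt_iff₀' hμj] at hω2
      have hS_iff : ω ∈ S ↔ x < (X 0 ω : ℝ) := Iff.rfl
      have hJ_iff : ω ∈ ancestorEvent X μ j x ↔ x / 2 < μ ^ j * (X (-j) ω : ℝ) := Iff.rfl
      have h2_iff : ω ∈ {ω | x < μ ^ j * (X (-j) ω : ℝ)} ↔ x < μ ^ j * (X (-j) ω : ℝ) := Iff.rfl
      by_cases hJ : x / 2 < μ ^ j * (X (-j) ω : ℝ)
      · have h9 := abs_le.1 (hω1 (by linarith))
        by_cases h10 : (1 - δ) * x < μ ^ j * (X (-j) ω : ℝ)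
        · have h11 := hω2 h10
          have h12 : x < (X 0 ω : ℝ) := by linarith
          have h13 : x < μ ^ j * (X (-j) ω : ℝ) := by nlinarith
          rw [Set.indicator_of_mem (hS_iff.2 h12), hf₁, hf₂, Set.indicator_of_mem (hS_iff.2 h12),
            Set.indicator_of_mem (hJ_iff.2 hJ), Set.indicator_of_mem (h2_iff.2 h13)]
          refine (norm_exp_mul_I_sub_le _ _).trans ?_
          rw [← mul_sub, ← sub_div, abs_mul, abs_div, abs_of_pos hx]
          gcongr
          rw [div_le_iff₀ hx]
          exact hω1 (by linarith)
        · have h12 : ¬ x < (X 0 ω : ℝ) := by linarith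
          have h13 : ¬ x < μ ^ j * (X (-j) ω : ℝ) := by nlinarith
          rw [Set.indicator_of_notMem (mt hS_iff.1 h12), hf₁, hf₂,
            Set.indicator_of_notMem (mt hS_iff.1 h12), Set.indicator_of_notMem (mt h2_iff.1 h13)]
          simp
      · have h13 : ¬ x < μ ^ j * (X (-j) ω : ℝ) := by linarith
        have h14 : f₁ ω = 0 := by
          rw [hf₁]
          by_cases hSω : ω ∈ S
          · rw [Set.indicator_of_mem hSω, Set.indicator_of_notMem (mt hJ_iff.1 hJ)]
          · rw [Set.indicator_of_notMem hSω]
        rw [h14, hf₂, Set.indicator_of_notMem (mt h2_iff.1 h13), sub_zero, norm_zero]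
        exact Set.indicator_nonneg (fun _ _ => by positivity) _

end IsRegularGWI

end GWI

/-! ### The geometric spine and its characteristic function. -/

namespace GWI

variable {Ω : Type*} [mΩ : MeasurableSpace Ω] {P : Measure Ω} [IsProbabilityMeasure P]
  {X : ℤ → Ω → ℕ} {A : ℤ → ℕ → Ω → ℕ} {B : ℤ → Ω → ℕ} {μ α : ℝ}

/-- The event that the path around time `0` is close to a geometric spine. -/
def typicalSet (X : ℤ → Ω → ℕ) (μ : ℝ) (m : ℕ) (δ x : ℝ) : Set Ω :=
  {ω | ∀ j : ℕ, j ≤ m → |(X j ω : ℝ) - μ ^ j * X 0 ω| ≤ δ * x ∧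
    ((X (-j) ω : ℝ) ≤ δ * x ∨ |(X 0 ω : ℝ) - μ ^ j * X (-j) ω| ≤ δ * x) ∧
    ((X (-(j + 1)) ω : ℝ) ≤ δ * x ∨ |(X (-j) ω : ℝ) - μ * X (-(j + 1)) ω| ≤ δ * x)}

lemma exists_threshold {J : ℕ → Prop} (m : ℕ) (h0 : J 0) (h : ∀ j < m, J (j + 1) → J j) :
    ∃ κ ≤ m, ∀ k ≤ m, J k ↔ k ≤ κ := by
  induction m with
  | zero => exact ⟨0, le_rfl, fun k hk => by simp [Nat.le_zero.1 hk, h0]⟩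
  | succ m ih =>
    obtain ⟨κ, hκ, hJ⟩ := ih fun j hj => h j (by omega)
    by_cases hm : J (m + 1)
    · refine ⟨m + 1, le_rfl, fun k hk => ⟨fun _ => hk, fun _ => ?_⟩⟩
      have h1 : m ≤ κ := (hJ m le_rfl).1 (h m (by omega) hm)
      rcases Nat.lt_or_ge k (m + 1) with hk' | hk'
      · exact (hJ k (by omega)).2 (by omega)
      · rwa [le_antisymm hk hk']
    · refine ⟨κ, by omega, fun k hk => ?_⟩
      rcases Nat.lt_or_ge k (m + 1) with hk' | hk'
      · exact hJ k (by omega)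
      · have : k = m + 1 := le_antisymm hk hk'
        subst this
        exact ⟨fun hc => absurd hc hm, fun hc => by omega⟩

/-- Here `κ` is the age of the big jump, truncated at `m`. On the typical set an ancestor generation
is either at most `δ * x` or close to the curve through `X 0 > x`, so the threshold `x / 2`
separates the cases. Solving for `X (-j)` divides an error `δ * x` by `μ ^ j ≥ μ ^ m`. -/
lemma exists_spine {m : ℕ} {δ x : ℝ} {ω : Ω} (hμ : μ ∈ Set.Ioo (0 : ℝ) 1) (hx : 0 < x)
    (hδ0 : 0 < δ) (hδ : δ ≤ 1 / 5) (hX : x < (X 0 ω : ℝ)) (hω : ω ∈ typicalSet X μ m δ x) :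
    ∃ κ ≤ m, (∀ k ≤ m, ω ∈ ancestorEvent X μ k x ↔ k ≤ κ) ∧
      ∀ i ∈ Finset.Icc (-(m : ℤ)) m, |(X i ω : ℝ) / x -
        (if -(κ : ℤ) ≤ i then μ ^ i else 0) * (X 0 ω / x)| ≤ (μ ^ m)⁻¹ * δ := by
  obtain ⟨hμ0, hμ1⟩ := hμ
  have hδx : 0 < δ * x := by positivity
  have hpow : ∀ j : ℕ, 0 < μ ^ j := fun j => by positivity
  have hpow1 : ∀ j : ℕ, μ ^ j ≤ 1 := fun j => pow_le_one₀ hμ0.le hμ1.le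
  have hJ_iff : ∀ j, ω ∈ ancestorEvent X μ j x ↔ x / 2 < μ ^ j * (X (-j) ω : ℝ) :=
    fun _ => Iff.rfl
  have hXn : ∀ i, (0 : ℝ) ≤ X i ω := fun i => by positivity
  have hlarge : ∀ j : ℕ, ω ∈ ancestorEvent X μ j x → δ * x < (X (-j) ω : ℝ) := by
    intro j hj
    rw [hJ_iff] at hj
    have := mul_le_mul_of_nonneg_right (hpow1 j) (hXn (-j))
    nlinarith
  -- The two closeness conditions give `μ ^ j * X (-j) ≥ (1 - 2 * δ) * x`, which exceeds `x / 2`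
  -- since `δ ≤ 1 / 5`.
  have hnested : ∀ j < m, ω ∈ ancestorEvent X μ (j + 1) x → ω ∈ ancestorEvent X μ j x := by
    intro j hj hj1
    have h1 := hlarge _ hj1
    have h2 := (hω (j + 1) (by omega)).2.1.resolve_left (not_le.2 h1)
    push_cast at h1
    have h3 := (hω j hj.le).2.2.resolve_left (not_le.2 h1)
    push_cast at h2
    have h4 := (abs_le.1 h2).2
    have h5 := (abs_le.1 h3).1
    rw [hJ_iff]
    have h6 := mul_le_mul_of_nonneg_left h5 (hpow j).le
    have h7 := mul_le_mul_of_nonneg_right (hpow1 j) hδx.le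
    have h8 : μ ^ (j + 1) * (X (-(j + 1)) ω : ℝ) = μ ^ j * (μ * X (-(j + 1)) ω) := by ring
    rw [h8] at h4
    nlinarith
  have h0 : ω ∈ ancestorEvent X μ 0 x := by
    rw [hJ_iff]
    simp
    linarith
  obtain ⟨κ, hκ, hthr⟩ := exists_threshold (J := fun k => ω ∈ ancestorEvent X μ k x) m h0 hnested
  refine ⟨κ, hκ, hthr, fun i hi => ?_⟩
  rw [Finset.mem_Icc] at hi
  have hinv : 1 ≤ (μ ^ m)⁻¹ := (one_le_inv₀ (hpow m)).2 (hpow1 m)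
  have hδ1 : δ ≤ (μ ^ m)⁻¹ * δ := le_mul_of_one_le_left hδ0.le hinv
  rw [← mul_div_assoc, ← sub_div, abs_div, abs_of_pos hx, div_le_iff₀ hx]
  obtain ⟨j, rfl | rfl⟩ := Int.eq_nat_or_neg i
  · rw [if_pos (by omega), zpow_natCast]
    refine (hω j (by omega)).1.trans ?_
    gcongr
  · have hjm : j ≤ m := by omega
    by_cases hj : j ≤ κ
    · have hJ := (hthr j hjm).2 hj
      have h2 := (hω j hjm).2.1.resolve_left (not_le.2 (hlarge j hJ))
      rw [if_pos (by omega), zpow_neg, zpow_natCast]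
      have h3 : (X (-j) ω : ℝ) - (μ ^ j)⁻¹ * X 0 ω =
          -((μ ^ j)⁻¹ * ((X 0 ω : ℝ) - μ ^ j * X (-j) ω)) := by
        have := (hpow j).ne'
        field_simp
        ring
      rw [h3, abs_neg, abs_mul, abs_of_pos (inv_pos.2 (hpow j)), mul_assoc]
      exact mul_le_mul (inv_anti₀ (hpow m) (pow_le_pow_of_le_one hμ0.le hμ1.le hjm)) h2
        (abs_nonneg _) (inv_pos.2 (hpow m)).le
    · have hJ := mt (hthr j hjm).1 hj
      rw [if_neg (by omega), zero_mul, sub_zero, abs_of_nonneg (hXn _)]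
      have h3 : (X (-j) ω : ℝ) ≤ δ * x := by
        rcases (hω j hjm).2.1 with h4 | h4
        · exact h4
        · rw [hJ_iff, not_lt] at hJ
          have := (abs_le.1 h4).2
          nlinarith
      refine h3.trans ?_
      gcongr

lemma IsRegularGWI.measurableSet_typicalSet (h : IsRegularGWI P X A B μ α) (m : ℕ) (δ x : ℝ) :
    MeasurableSet (typicalSet X μ m δ x) := by
  have hX := h.measurable_realX
  refine MeasurableSet.congr (s := ⋂ j : ℕ, ⋂ _ : j ≤ m,
    ({ω | |(X j ω : ℝ) - μ ^ j * X 0 ω| ≤ δ * x} ∩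
    (({ω | (X (-j) ω : ℝ) ≤ δ * x} ∪ {ω | |(X 0 ω : ℝ) - μ ^ j * X (-j) ω| ≤ δ * x}) ∩
    ({ω | (X (-(j + 1)) ω : ℝ) ≤ δ * x} ∪
      {ω | |(X (-j) ω : ℝ) - μ * X (-(j + 1)) ω| ≤ δ * x})))) ?_ ?_
  · refine MeasurableSet.iInter fun j => MeasurableSet.iInter fun _ => ?_
    have h0 := hX 0
    have h1 := hX j
    have h2 := hX (-j)
    have h3 := hX (-(j + 1))
    have m1 : Measurable fun ω => |(X j ω : ℝ) - μ ^ j * X 0 ω| := by fun_prop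
    have m2 : Measurable fun ω => |(X 0 ω : ℝ) - μ ^ j * X (-j) ω| := by fun_prop
    have m3 : Measurable fun ω => |(X (-j) ω : ℝ) - μ * X (-(j + 1)) ω| := by fun_prop
    exact (measurableSet_le m1 measurable_const).inter
      (((measurableSet_le h2 measurable_const).union (measurableSet_le m2 measurable_const)).inter
      ((measurableSet_le h3 measurable_const).union (measurableSet_le m3 measurable_const)))
  · ext ω
    simp only [typicalSet, Set.mem_iInter, Set.mem_inter_iff, Set.mem_union, Set.mem_ofPred_eq]

/-- A failure is a deviation from geometric decay after a value of order `x` at one of the times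
`0`, `-j`, `-(j + 1)`; a union bound over finitely many `j` is enough. -/
lemma IsRegularGWI.tendsto_not_typicalSet (h : IsRegularGWI P X A B μ α) (m : ℕ) {δ : ℝ}
    (hδ : 0 < δ) :
    Tendsto (fun x => P.real ({ω | x < (X 0 ω : ℝ)} \ typicalSet X μ m δ x) / tail P X x)
      atTop (𝓝 0) := by
  have hlim : Tendsto (fun x => ∑ j ∈ Finset.range (m + 1),
      (P.real {ω | 1 * x < (X 0 ω : ℝ) ∧ δ * x < |(X j ω : ℝ) - μ ^ j * X 0 ω|} / tail P X x +
      (P.real {ω | δ * x < (X (-j) ω : ℝ) ∧ δ * x < |(X (-j + j) ω : ℝ) - μ ^ j * X (-j) ω|} /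
        tail P X x +
      P.real {ω | δ * x < (X (-(j + 1)) ω : ℝ) ∧
        δ * x < |(X (-(j + 1) + (1 : ℕ)) ω : ℝ) - μ ^ 1 * X (-(j + 1)) ω|} / tail P X x)))
      atTop (𝓝 0) := by
    rw [show (0 : ℝ) = ∑ j ∈ Finset.range (m + 1), (0 + (0 + 0)) by simp]
    exact tendsto_finsetSum _ fun j _ => (h.tendsto_deviation j one_pos hδ).add
      ((h.tendsto_deviation_shift j (-j) hδ hδ).add
        (h.tendsto_deviation_shift 1 (-(j + 1)) hδ hδ))
  refine squeeze_zero (fun x => div_nonneg measureReal_nonneg (tail_nonneg x)) (fun x => ?_) hlim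
  simp only [← add_div, ← Finset.sum_div]
  refine div_le_div_of_nonneg_right ?_ (tail_nonneg x)
  have hsub : {ω | x < (X 0 ω : ℝ)} \ typicalSet X μ m δ x ⊆ ⋃ j ∈ Finset.range (m + 1),
      ({ω | 1 * x < (X 0 ω : ℝ) ∧ δ * x < |(X j ω : ℝ) - μ ^ j * X 0 ω|} ∪
      ({ω | δ * x < (X (-j) ω : ℝ) ∧ δ * x < |(X (-j + j) ω : ℝ) - μ ^ j * X (-j) ω|} ∪
      {ω | δ * x < (X (-(j + 1)) ω : ℝ) ∧
        δ * x < |(X (-(j + 1) + (1 : ℕ)) ω : ℝ) - μ ^ 1 * X (-(j + 1)) ω|})) := by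
    rintro ω ⟨hω1, hω2⟩
    simp only [Set.mem_ofPred_eq] at hω1
    simp only [typicalSet, Set.mem_ofPred_eq] at hω2
    push Not at hω2
    obtain ⟨j, hj, hcon⟩ := hω2
    simp only [Set.mem_iUnion, Set.mem_union, Set.mem_ofPred_eq, Finset.mem_range]
    refine ⟨j, by omega, ?_⟩
    have e1 : -(j : ℤ) + j = 0 := by ring
    have e2 : -((j : ℤ) + 1) + (1 : ℕ) = -j := by push_cast; ring
    rw [e1, e2, pow_one, one_mul]
    by_contra hc
    push Not at hc
    obtain ⟨c1, c2, c3⟩ := hc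
    have d := hcon (c1 hω1) (by
      rcases le_or_gt (X (-j) ω : ℝ) (δ * x) with hle | hgt
      · exact Or.inl hle
      · exact Or.inr (c2 hgt))
    exact absurd (c3 d.1) (not_le.2 d.2)
  refine (measureReal_mono hsub (measure_ne_top _ _)).trans ((measureReal_biUnion_finset_le _ _).trans ?_)
  refine Finset.sum_le_sum fun j _ => (measureReal_union_le _ _).trans ?_
  gcongr
  exact measureReal_union_le _ _

/-- The linear form `s`, evaluated at the spine that starts `k` generations before time `0`. -/
def spineCoeff (μ : ℝ) (m : ℕ) (s : Finset.Icc (-(m : ℤ)) (m : ℤ) → ℝ) (k : ℕ) : ℝ :=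
  ∑ i, s i * (if -(k : ℤ) ≤ (i : ℤ) then μ ^ (i : ℤ) else 0)

/-- An approximation of `exp (i ∑ s_i X_i / x)` that depends on the past up to time `0` only. -/
def spineExp (X : ℤ → Ω → ℕ) (μ : ℝ) (m : ℕ) (s : Finset.Icc (-(m : ℤ)) (m : ℤ) → ℝ) (x : ℝ)
    (ω : Ω) : ℂ :=
  ∑ k ∈ Finset.range (m + 1),
    ((ancestorEvent X μ k x).indicator
      (fun ω => Complex.exp ((spineCoeff μ m s k * (X 0 ω / x) : ℝ) * Complex.I)) ω -
    if k < m then (ancestorEvent X μ (k + 1) x).indicator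
      (fun ω => Complex.exp ((spineCoeff μ m s k * (X 0 ω / x) : ℝ) * Complex.I)) ω else 0)

/-- For nested ancestor events the difference of consecutive indicators selects the one index `k =
κ`. Nothing is subtracted at `k = m`, so that term collects all ages of at least `m`. -/
lemma spineExp_eq {m κ : ℕ} (s : Finset.Icc (-(m : ℤ)) (m : ℤ) → ℝ) {x : ℝ} {ω : Ω} (hκ : κ ≤ m)
    (hthr : ∀ k ≤ m, ω ∈ ancestorEvent X μ k x ↔ k ≤ κ) :
    spineExp X μ m s x ω =
      Complex.exp ((spineCoeff μ m s κ * (X 0 ω / x) : ℝ) * Complex.I) := by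
  unfold spineExp
  rw [Finset.sum_eq_single_of_mem κ (Finset.mem_range.2 (by omega))]
  · rw [Set.indicator_of_mem ((hthr κ hκ).2 le_rfl)]
    split_ifs with hκm
    · rw [Set.indicator_of_notMem (mt (hthr (κ + 1) hκm).1 (by omega)), sub_zero]
    · rw [sub_zero]
  · intro k hk hne
    rw [Finset.mem_range] at hk
    rcases lt_or_gt_of_ne hne with hlt | hgt
    · rw [Set.indicator_of_mem ((hthr k (by omega)).2 (by omega)), if_pos (by omega),
        Set.indicator_of_mem ((hthr (k + 1) (by omega)).2 (by omega)), sub_self]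
    · rw [Set.indicator_of_notMem (mt (hthr k (by omega)).1 (by omega))]
      split_ifs with hkm
      · rw [Set.indicator_of_notMem (mt (hthr (k + 1) hkm).1 (by omega)), sub_zero]
      · rw [sub_zero]

lemma norm_spineExp_le (m : ℕ) (s : Finset.Icc (-(m : ℤ)) (m : ℤ) → ℝ) (x : ℝ) (ω : Ω) :
    ‖spineExp X μ m s x ω‖ ≤ 2 * (m + 1) := by
  unfold spineExp
  refine (norm_sum_le _ _).trans ?_
  have : ∀ k ∈ Finset.range (m + 1), ‖((ancestorEvent X μ k x).indicator
      (fun ω => Complex.exp ((spineCoeff μ m s k * (X 0 ω / x) : ℝ) * Complex.I)) ω -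
    if k < m then (ancestorEvent X μ (k + 1) x).indicator
      (fun ω => Complex.exp ((spineCoeff μ m s k * (X 0 ω / x) : ℝ) * Complex.I)) ω else 0)‖
      ≤ 2 := by
    intro k _
    refine (norm_sub_le _ _).trans ?_
    have h1 := norm_indicator_exp_le (ancestorEvent X μ k x)
      (fun ω => spineCoeff μ m s k * (X 0 ω / x)) ω
    have h2 := norm_indicator_exp_le (ancestorEvent X μ (k + 1) x)
      (fun ω => spineCoeff μ m s k * (X 0 ω / x)) ω
    split_ifs
    · linarith
    · rw [norm_zero]; linarith
  refine (Finset.sum_le_sum this).trans (le_of_eq ?_)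
  simp
  ring

lemma measurable_spineExp (hX : ∀ k, Measurable fun ω => (X k ω : ℝ)) (m : ℕ)
    (s : Finset.Icc (-(m : ℤ)) (m : ℤ) → ℝ) (x : ℝ) : Measurable (spineExp X μ m s x) := by
  unfold spineExp
  have hX0 := hX 0
  refine Finset.measurable_sum _ fun k _ => ?_
  have hm : Measurable fun ω =>
      Complex.exp ((spineCoeff μ m s k * (X 0 ω / x) : ℝ) * Complex.I) := by fun_prop
  refine (hm.indicator (measurableSet_ancestorEvent hX k x)).sub ?_
  split_ifs
  · exact hm.indicator (measurableSet_ancestorEvent hX (k + 1) x)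
  · exact measurable_const

/-- Linearity reduces this to single ancestor events; the weights that arise are the point
probabilities of `K` truncated at `m`. -/
lemma IsRegularGWI.tendsto_tailMean_spineExp (h : IsRegularGWI P X A B μ α) (m : ℕ)
    (s : Finset.Icc (-(m : ℤ)) (m : ℤ) → ℝ) {L : ℝ → ℂ}
    (hL : ∀ θ : ℝ, Tendsto (fun x : ℝ => tailMean P X x fun ω =>
      Complex.exp ((θ * (X 0 ω / x) : ℝ) * Complex.I)) atTop (𝓝 (L θ))) :
    Tendsto (fun x : ℝ => tailMean P X x (spineExp X μ m s x)) atTop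
      (𝓝 (∑ k ∈ Finset.range (m + 1), ((μ ^ (α * k) : ℝ) * L (spineCoeff μ m s k) -
        if k < m then (μ ^ (α * (k + 1 : ℕ)) : ℝ) * L (spineCoeff μ m s k) else 0))) := by
  have hlim := tendsto_finsetSum (Finset.range (m + 1)) (fun k _ =>
    (h.tendsto_tailMean_ancestor k (hL (spineCoeff μ m s k))).sub
    (show Tendsto (fun x => if k < m then tailMean P X x ((ancestorEvent X μ (k + 1) x).indicator
      fun ω => Complex.exp ((spineCoeff μ m s k * (X 0 ω / x) : ℝ) * Complex.I)) else 0) atTop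
      (𝓝 (if k < m then (μ ^ (α * (k + 1 : ℕ)) : ℝ) * L (spineCoeff μ m s k) else 0)) by
      split_ifs
      · exact h.tendsto_tailMean_ancestor (k + 1) (hL (spineCoeff μ m s k))
      · exact tendsto_const_nhds))
  refine hlim.congr fun x => ?_
  have hX := h.measurable_realX 0
  have hi : ∀ k j, Integrable ((ancestorEvent X μ j x).indicator
      fun ω => Complex.exp ((spineCoeff μ m s k * (X 0 ω / x) : ℝ) * Complex.I))
      (P.restrict {ω | x < (X 0 ω : ℝ)}) := by
    intro k j
    refine (integrable_of_norm_le_one ?_ (norm_indicator_exp_le _ _)).restrict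
    exact (by fun_prop : Measurable fun ω =>
      Complex.exp ((spineCoeff μ m s k * (X 0 ω / x) : ℝ) * Complex.I)).indicator
        (measurableSet_ancestorEvent h.measurable_realX j x)
  have hi2 : ∀ k, Integrable (fun ω => if k < m then (ancestorEvent X μ (k + 1) x).indicator
      (fun ω => Complex.exp ((spineCoeff μ m s k * (X 0 ω / x) : ℝ) * Complex.I)) ω else 0)
      (P.restrict {ω | x < (X 0 ω : ℝ)}) := by
    intro k
    split_ifs
    · exact hi k (k + 1)
    · exact integrable_zero _ _ _
  have hi3 : ∀ k, Integrable (fun ω => (ancestorEvent X μ k x).indicator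
      (fun ω => Complex.exp ((spineCoeff μ m s k * (X 0 ω / x) : ℝ) * Complex.I)) ω -
      if k < m then (ancestorEvent X μ (k + 1) x).indicator
      (fun ω => Complex.exp ((spineCoeff μ m s k * (X 0 ω / x) : ℝ) * Complex.I)) ω else 0)
      (P.restrict {ω | x < (X 0 ω : ℝ)}) := fun k => (hi k k).sub (hi2 k)
  simp only [tailMean, spineExp]
  rw [integral_finsetSum _ fun k _ => hi3 k, Finset.mul_sum]
  refine Finset.sum_congr rfl fun k _ => ?_
  rw [integral_sub (hi k k) (hi2 k), mul_sub]
  split_ifs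
  · rfl
  · simp

lemma IsRegularGWI.norm_tailMean_sub_le (h : IsRegularGWI P X A B μ α) {x : ℝ} {f g : Ω → ℂ}
    {C η : ℝ} (hf : Measurable f) (hg : Measurable g) (hfC : ∀ ω, ‖f ω‖ ≤ C)
    (hgC : ∀ ω, ‖g ω‖ ≤ C) {T : Set Ω} (hT : MeasurableSet T) (hη : 0 ≤ η)
    (hfg : ∀ ω, x < (X 0 ω : ℝ) → ω ∈ T → ‖f ω - g ω‖ ≤ η) :
    ‖tailMean P X x f - tailMean P X x g‖ ≤
      η + 2 * C * (P.real ({ω | x < (X 0 ω : ℝ)} \ T) / tail P X x) := by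
  have hS := h.measurableSet_lt_X x
  have hpx := h.isRVTail_tail.pos x
  set S : Set Ω := {ω | x < (X 0 ω : ℝ)}
  have hif : Integrable f P := Integrable.of_bound hf.aestronglyMeasurable C
    (Eventually.of_forall hfC)
  have hig : Integrable g P := Integrable.of_bound hg.aestronglyMeasurable C
    (Eventually.of_forall hgC)
  have hb := norm_integral_sub_le (hif.indicator hS) (hig.indicator hS) hS (hS.diff hT)
    (η := η) (C := 2 * C) ?_
  · rw [integral_indicator hS, integral_indicator hS] at hb
    unfold tailMean
    rw [← mul_sub, norm_mul, norm_inv, Complex.norm_real, Real.norm_of_nonneg hpx.le,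
      inv_mul_le_iff₀ hpx]
    refine hb.trans (le_of_eq ?_)
    have : P.real S = tail P X x := rfl
    rw [this]
    field_simp
  · intro ω
    by_cases hωS : ω ∈ S
    · rw [Set.indicator_of_mem hωS, Set.indicator_of_mem hωS, Set.indicator_of_mem hωS]
      by_cases hωT : ω ∈ T
      · rw [Set.indicator_of_notMem (fun hc => hc.2 hωT), add_zero]
        exact hfg ω hωS hωT
      · rw [Set.indicator_of_mem (show ω ∈ S \ T from ⟨hωS, hωT⟩)]
        have := norm_sub_le (f ω) (g ω)
        linarith [hfC ω, hgC ω]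
    · rw [Set.indicator_of_notMem hωS, Set.indicator_of_notMem hωS, Set.indicator_of_notMem hωS,
        Set.indicator_of_notMem fun hc => hωS hc.1]
      simp

/-- On the typical set the two phases differ by a multiple of `δ`, and its complement is negligible.
The bounded factor `G` is carried along to hold the exponentials of the increments. -/
lemma IsRegularGWI.tendsto_tailMean_sub_spineExp (h : IsRegularGWI P X A B μ α) (m : ℕ)
    (s : Finset.Icc (-(m : ℤ)) (m : ℤ) → ℝ) {G : ℝ → Ω → ℂ} (hG : ∀ x, Measurable (G x))
    (hG1 : ∀ x ω, ‖G x ω‖ ≤ 1) :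
    Tendsto (fun x : ℝ =>
      tailMean P X x (fun ω => Complex.exp ((∑ i, s i * (X i ω / x) : ℝ) * Complex.I) * G x ω) -
        tailMean P X x (fun ω => spineExp X μ m s x ω * G x ω)) atTop (𝓝 0) := by
  have hμ0 := h.mean_mem.1
  set c₁ := ∑ i, |s i| with hc
  have hc0 : 0 ≤ c₁ := Finset.sum_nonneg fun i _ => abs_nonneg _
  refine tendsto_zero_of_forall_bound fun η hη => ?_
  have hlin : Tendsto (fun δ : ℝ => c₁ * ((μ ^ m)⁻¹ * δ) + 2 * (2 * (m + 1)) * 0) (𝓝[>] 0)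
      (𝓝 0) := by
    have : Continuous fun δ : ℝ => c₁ * ((μ ^ m)⁻¹ * δ) + 2 * (2 * (m + 1)) * 0 := by fun_prop
    have := this.tendsto 0
    simp only [mul_zero, add_zero] at this ⊢
    exact this.mono_left nhdsWithin_le_nhds
  obtain ⟨δ, hδη, hδ0, hδ1⟩ := ((hlin.eventually (gt_mem_nhds hη)).and
    (Ioo_mem_nhdsGT (by norm_num : (0 : ℝ) < 1 / 5))).exists
  refine ⟨_, _, ?_, ((h.tendsto_not_typicalSet m hδ0).const_mul (2 * (2 * ((m : ℝ) + 1)))).const_add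
    (c₁ * ((μ ^ m)⁻¹ * δ)), hδη⟩
  filter_upwards [eventually_gt_atTop 0] with x hx
  have hX := h.measurable_realX
  have hm1 : Measurable fun ω =>
      Complex.exp ((∑ i : Finset.Icc (-(m : ℤ)) (m : ℤ), s i * (X i ω / x) : ℝ) * Complex.I) := by
    fun_prop
  have hm0 : (0 : ℝ) ≤ m := by positivity
  refine h.norm_tailMean_sub_le (hm1.mul (hG x)) ((measurable_spineExp h.measurable_realX m s x).mul (hG x))
    (fun ω => ?_) (fun ω => ?_) (h.measurableSet_typicalSet m δ x) (by positivity) ?_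
  · rw [Pi.mul_apply, norm_mul, Complex.norm_exp_ofReal_mul_I, one_mul]
    linarith [hG1 x ω]
  · rw [Pi.mul_apply, norm_mul]
    have := mul_le_mul (norm_spineExp_le (X := X) (μ := μ) m s x ω) (hG1 x ω) (norm_nonneg _)
      (by positivity)
    linarith
  · intro ω hωX hωT
    obtain ⟨κ, hκ, hthr, hcl⟩ := exists_spine h.mean_mem hx hδ0 hδ1.le hωX hωT
    simp only [Pi.mul_apply]
    rw [← sub_mul, norm_mul, spineExp_eq s hκ hthr]
    refine (mul_le_of_le_one_right (norm_nonneg _) (hG1 x ω)).trans ?_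
    refine (norm_exp_mul_I_sub_le _ _).trans ?_
    rw [spineCoeff, Finset.sum_mul, ← Finset.sum_sub_distrib, hc, Finset.sum_mul]
    refine (Finset.abs_sum_le_sum_abs _ _).trans (Finset.sum_le_sum fun i _ => ?_)
    rw [mul_assoc, ← mul_sub, abs_mul]
    exact mul_le_mul_of_nonneg_left (hcl i i.2) (abs_nonneg _)

end GWI

/-! ### Gaussian fluctuations of the increments. -/

namespace GWI

variable {Ω : Type*} [mΩ : MeasurableSpace Ω] {P : Measure Ω} [IsProbabilityMeasure P]
  {X : ℤ → Ω → ℕ} {A : ℤ → ℕ → Ω → ℕ} {B : ℤ → Ω → ℕ} {μ α : ℝ}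

/-- The normalized increment `M_{k+1} / √(X_k ∨ 1)`. -/
def normalizedM (μ ν : ℝ) (X : ℤ → Ω → ℕ) (k : ℤ) (ω : Ω) : ℝ :=
  M μ ν X (k + 1) ω / √(max (X k ω : ℝ) 1)

/-- The value of `normalizedM` in terms of the size `n` of the parent generation and the offspring
and immigration numbers `w`. -/
def normalizedNoise (μ ν : ℝ) (n : ℕ) (w : (ℕ → ℕ) × ℕ) : ℝ :=
  ((∑ j ∈ Finset.range n, (w.1 j : ℝ)) + w.2 - μ * n - ν) / √(max (n : ℝ) 1)

lemma measurable_normalizedNoise (μ ν : ℝ) (n : ℕ) : Measurable (normalizedNoise μ ν n) := by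
  unfold normalizedNoise
  fun_prop

lemma measurable_eval_apply {β : Type*} [MeasurableSpace β] {g : ℕ → β → ℝ}
    (hg : ∀ n, Measurable (g n)) : Measurable fun z : (ℕ → ℕ) × β => g (z.1 0) z.2 := by
  have h1 : Measurable fun z : ℕ × β => g z.1 z.2 := measurable_from_prod_countable_right hg
  have h2 : Measurable fun z : (ℕ → ℕ) × β => (z.1 0, z.2) := by fun_prop
  exact h1.comp h2

/-- The characteristic function of the normalized increment, given `n` parents. -/
def noiseCharFun (P : Measure Ω) (A : ℤ → ℕ → Ω → ℕ) (B : ℤ → Ω → ℕ) (μ ν : ℝ) (k : ℤ) (t : ℝ)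
    (n : ℕ) : ℂ :=
  ∫ ω, Complex.exp ((t * normalizedNoise μ ν n (innovation A B k ω) : ℝ) * Complex.I) ∂P

lemma norm_noiseCharFun_le (μ ν : ℝ) (k : ℤ) (t : ℝ) (n : ℕ) :
    ‖noiseCharFun P A B μ ν k t n‖ ≤ 1 := by
  refine (norm_integral_le_of_norm_le_const (C := 1) (Eventually.of_forall fun ω => ?_)).trans ?_
  · rw [Complex.norm_exp_ofReal_mul_I]
  · simp

namespace IsRegularGWI

variable (h : IsRegularGWI P X A B μ α)
include h

lemma ae_normalizedM_eq (ν : ℝ) (k : ℤ) : ∀ᵐ ω ∂P,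
    normalizedM μ ν X k ω = normalizedNoise μ ν (X k ω) (innovation A B (k + 1) ω) := by
  filter_upwards [h.isStationaryGWI.recursion (k + 1)] with ω hω
  rw [add_sub_cancel_right] at hω
  simp only [normalizedM, normalizedNoise, M, innovation, add_sub_cancel_right, hω]
  push_cast
  rfl

/-- The central limit theorem handles the offspring. The immigration, with any centring `ν`,
disappears after division by `√n`. -/
lemma tendsto_noiseCharFun (ν : ℝ) (k : ℤ) (t : ℝ) :
    Tendsto (noiseCharFun P A B μ ν k t) atTop
      (𝓝 (Complex.exp (-(variance (fun ω => (A 0 0 ω : ℝ)) P * t ^ 2 / 2 : ℝ)))) := by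
  set v := variance (fun ω => (A 0 0 ω : ℝ)) P with hv
  have hAm : ∀ j, Measurable fun ω => (A k j ω : ℝ) := fun j => by
    have := h.isStationaryGWI.measurable_A k j
    fun_prop
  have hBm : Measurable fun ω => (B k ω : ℝ) := by
    have := h.isStationaryGWI.measurable_B k
    fun_prop
  have hvar : variance (fun ω => (A k 0 ω : ℝ)) P = v := (h.identDistrib_realA k 0).variance_eq
  have hmean : ∫ ω, (A k 0 ω : ℝ) ∂P = μ := by
    rw [(h.identDistrib_realA k 0).integral_eq, h.mean]
  have hclt := tendstoInDistribution_inv_sqrt_mul_sum_sub (P := P)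
    (P' := gaussianReal 0 v.toNNReal) (Y := id) (X := fun j ω => (A k j ω : ℝ))
    (by rw [hvar]; exact HasLaw.id) ((h.identDistrib_realA k 0).memLp_iff.2 h.memLp)
    (h.iIndepFun_realA k)
    (fun j => (h.identDistrib_realA k j).trans (h.identDistrib_realA k 0).symm)
  have h1 := ProbabilityMeasure.tendsto_iff_tendsto_charFun.1 hclt.tendsto t
  simp only [hmean] at h1
  have e0 : charFun (Measure.map id (gaussianReal 0 v.toNNReal)) t =
      Complex.exp (-(v * t ^ 2 / 2 : ℝ)) := by
    rw [Measure.map_id, charFun_gaussianReal]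
    congr 1
    have e5 : ((v.toNNReal : ℝ) : ℂ) = v := by
      rw [Real.coe_toNNReal _ (variance_nonneg _ _)]
    simp only [Complex.ofReal_zero, mul_zero, zero_mul, zero_sub, e5]
    push_cast
    ring
  have h2 : Tendsto (fun n : ℕ => ∫ ω, Complex.exp ((t * ((√n)⁻¹ *
      (∑ j ∈ Finset.range n, (A k j ω : ℝ) - n * μ)) : ℝ) * Complex.I) ∂P) atTop
      (𝓝 (Complex.exp (-(v * t ^ 2 / 2 : ℝ)))) := by
    rw [← e0]
    refine h1.congr fun n => ?_
    refine (charFun_apply_real t).trans ?_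
    refine (integral_map (Measurable.aemeasurable (by fun_prop)) ?_).trans ?_
    · exact (by fun_prop : Continuous _).aestronglyMeasurable
    · simp
  -- Two unit complex numbers differ by at most the phase difference and by at most `2`; the
  -- truncation gives dominated convergence without a moment of `B`.
  have h3 : Tendsto (fun n : ℕ => ∫ ω, |t * ((√n)⁻¹ * ((B k ω : ℝ) - ν))| ⊓ 2 ∂P) atTop
      (𝓝 (∫ ω, (0 : ℝ) ∂P)) := by
    refine tendsto_integral_of_dominated_convergence (fun _ => 2) (fun n => ?_)
      (integrable_const _) (fun n => Eventually.of_forall fun ω => ?_)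
      (Eventually.of_forall fun ω => ?_)
    · exact (by fun_prop : Measurable fun ω =>
        |t * ((√(n : ℝ))⁻¹ * ((B k ω : ℝ) - ν))| ⊓ 2).aestronglyMeasurable
    · rw [Real.norm_of_nonneg (le_inf (abs_nonneg _) (by norm_num))]
      exact inf_le_right
    · have h4 : Tendsto (fun n : ℕ => (√(n : ℝ))⁻¹) atTop (𝓝 0) :=
        tendsto_inv_atTop_zero.comp (Real.tendsto_sqrt_atTop.comp tendsto_natCast_atTop_atTop)
      have h5 := ((h4.mul_const ((B k ω : ℝ) - ν)).const_mul t).abs.inf_nhds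
        (tendsto_const_nhds (x := (2 : ℝ)))
      simpa using h5
  simp only [integral_zero] at h3
  refine tendsto_of_tendsto_of_dist h2 ?_
  refine squeeze_zero' (Eventually.of_forall fun _ => dist_nonneg) ?_ h3
  filter_upwards [eventually_ge_atTop 1] with n hn
  have hn1 : max (n : ℝ) 1 = n := max_eq_left (by exact_mod_cast hn)
  have hm1 : Measurable fun ω => Complex.exp ((t * ((√(n : ℝ))⁻¹ *
      (∑ j ∈ Finset.range n, (A k j ω : ℝ) - n * μ)) : ℝ) * Complex.I) := by fun_prop
  have hm2 : Measurable fun ω =>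
      Complex.exp ((t * normalizedNoise μ ν n (innovation A B k ω) : ℝ) * Complex.I) := by
    have := (measurable_normalizedNoise μ ν n).comp (h.isStationaryGWI.measurable_innovation k)
    simp only [Function.comp_def] at this
    fun_prop
  have hi1 := integrable_of_norm_le_one (P := P) hm1
    (fun ω => (Complex.norm_exp_ofReal_mul_I _).le)
  have hi2 := integrable_of_norm_le_one (P := P) hm2
    (fun ω => (Complex.norm_exp_ofReal_mul_I _).le)
  rw [noiseCharFun, dist_eq_norm, ← integral_sub hi1 hi2]
  refine (norm_integral_le_integral_norm _).trans (integral_mono (hi1.sub hi2).norm ?_ ?_)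
  · refine Integrable.of_bound (C := 2) (by fun_prop : Measurable fun ω =>
        |t * ((√(n : ℝ))⁻¹ * ((B k ω : ℝ) - ν))| ⊓ 2).aestronglyMeasurable
      (Eventually.of_forall fun ω => ?_)
    rw [Real.norm_of_nonneg (le_inf (abs_nonneg _) (by norm_num))]
    exact inf_le_right
  · intro ω
    refine le_inf ?_ ?_
    · refine (norm_exp_mul_I_sub_le _ _).trans (le_of_eq ?_)
      rw [← abs_neg]
      congr 1
      simp only [normalizedNoise, innovation, hn1]
      ring
    · refine (norm_sub_le _ _).trans ?_
      rw [Complex.norm_exp_ofReal_mul_I, Complex.norm_exp_ofReal_mul_I]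
      norm_num

lemma integral_history_mul_exp (ν : ℝ) (k : ℤ) (t : ℝ) {F : (ℕ → ℕ) → ℂ} {C : ℝ}
    (hF : Measurable F) (hC : ∀ f, ‖F f‖ ≤ C) :
    ∫ ω, F (history X k ω) * Complex.exp ((t * normalizedM μ ν X k ω : ℝ) * Complex.I) ∂P =
      ∫ ω, F (history X k ω) * noiseCharFun P A B μ ν (k + 1) t (X k ω) ∂P := by
  have hN := measurable_eval_apply (g := normalizedNoise μ ν) (measurable_normalizedNoise μ ν)
  have hG : Measurable fun z : (ℕ → ℕ) × ((ℕ → ℕ) × ℕ) =>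
      F z.1 * Complex.exp ((t * normalizedNoise μ ν (z.1 0) z.2 : ℝ) * Complex.I) := by
    have hF1 : Measurable fun z : (ℕ → ℕ) × ((ℕ → ℕ) × ℕ) => F z.1 := hF.comp measurable_fst
    fun_prop
  have h1 := integral_of_indepFun (h.indepFun_history k) (h.isStationaryGWI.measurable_history k)
    (h.isStationaryGWI.measurable_innovation (k + 1)) hG (C := C) (fun z => by
      rw [norm_mul, Complex.norm_exp_ofReal_mul_I, mul_one]
      exact hC _)
  have e0 : ∀ ω, history X k ω 0 = X k ω := fun ω => by simp [history]
  simp only [e0] at h1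
  refine Eq.trans (integral_congr_ae ?_) (h1.trans ?_)
  · filter_upwards [h.ae_normalizedM_eq ν k] with ω hω
    rw [hω]
  · refine integral_congr_ae (Eventually.of_forall fun ω => ?_)
    simp only [noiseCharFun]
    rw [integral_const_mul]

/-- For `k ≥ 0` the event `X 0 > x` concerns coordinate `k` of the history up to time `k`, so its
indicator can be absorbed into `F`. -/
lemma tailMean_history_mul_exp (ν : ℝ) (k : ℕ) (t x : ℝ) {F : (ℕ → ℕ) → ℂ} {C : ℝ}
    (hF : Measurable F) (hC : ∀ f, ‖F f‖ ≤ C) :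
    tailMean P X x (fun ω => F (history X k ω) *
        Complex.exp ((t * normalizedM μ ν X k ω : ℝ) * Complex.I)) =
      tailMean P X x (fun ω => F (history X k ω) *
        noiseCharFun P A B μ ν (k + 1) t (X k ω)) := by
  have hS := h.measurableSet_lt_X x
  have hSf : MeasurableSet {f : ℕ → ℕ | x < (f k : ℝ)} := by
    have : Measurable fun f : ℕ → ℕ => (f k : ℝ) := by fun_prop
    exact measurableSet_lt measurable_const this
  have h1 := h.integral_history_mul_exp ν k t (hF.indicator hSf) (C := C)
    (fun f => (norm_indicator_le_norm_self _ _).trans (hC f))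
  unfold tailMean
  rw [← integral_indicator hS, ← integral_indicator hS]
  congr 1
  have e : ∀ ω, {f : ℕ → ℕ | x < (f k : ℝ)}.indicator F (history X k ω) =
      {ω | x < (X 0 ω : ℝ)}.indicator (fun ω => F (history X k ω)) ω := by
    intro ω
    simp only [Set.indicator, Set.mem_ofPred_eq, history, sub_self]
  simp only [e] at h1
  simp only [Set.indicator_mul_left]
  exact h1

/-- Since `X k` is close to `μ ^ k * X 0 > μ ^ k * x`, it exceeds any fixed `N`. This puts the
increment after time `k` in the range of the central limit theorem. -/
lemma tendsto_small_descendants (k : ℕ) (N : ℕ) :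
    Tendsto (fun x => P.real ({ω | x < (X 0 ω : ℝ)} \ {ω | N ≤ X k ω}) / tail P X x)
      atTop (𝓝 0) := by
  have hμ := h.mean_mem.1
  have hμk : 0 < μ ^ k := by positivity
  refine squeeze_zero' (Eventually.of_forall fun x => div_nonneg measureReal_nonneg
    (tail_nonneg x)) ?_ (h.tendsto_deviation k one_pos (half_pos hμk))
  filter_upwards [eventually_gt_atTop (2 * N / μ ^ k), eventually_gt_atTop 0] with x hx hx0
  refine div_le_div_of_nonneg_right (measureReal_mono ?_) (tail_nonneg x)
  rintro ω ⟨hω1, hω2⟩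
  simp only [Set.mem_ofPred_eq, not_le] at hω1 hω2 ⊢
  rw [div_lt_iff₀ hμk] at hx
  refine ⟨by linarith, ?_⟩
  have h1 : (X k ω : ℝ) < N := by exact_mod_cast hω2
  have h2 := mul_lt_mul_of_pos_left hω1 hμk
  rw [abs_sub_comm]
  exact lt_of_lt_of_le (by linarith) (le_abs_self _)

/-- Integrating out the innovation leaves the noise characteristic function at `X k`, which is
uniformly close to its Gaussian limit once `X k ≥ N`. -/
lemma tendsto_tailMean_mul_exp (ν : ℝ) (k : ℕ) (t : ℝ) {F : ℝ → (ℕ → ℕ) → ℂ} {C : ℝ}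
    (hF : ∀ x, Measurable (F x)) (hC : ∀ x f, ‖F x f‖ ≤ C) :
    Tendsto (fun x => tailMean P X x (fun ω => F x (history X k ω) *
        Complex.exp ((t * normalizedM μ ν X k ω : ℝ) * Complex.I)) -
      tailMean P X x (fun ω => F x (history X k ω)) *
        Complex.exp (-(variance (fun ω => (A 0 0 ω : ℝ)) P * t ^ 2 / 2 : ℝ))) atTop (𝓝 0) := by
  set q := Complex.exp (-(variance (fun ω => (A 0 0 ω : ℝ)) P * t ^ 2 / 2 : ℝ)) with hq
  have hC0 : 0 ≤ C := (norm_nonneg _).trans (hC 0 0)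
  have hq1 : ‖q‖ ≤ 1 := by
    rw [hq, ← Complex.ofReal_neg, Complex.norm_exp_ofReal, Real.exp_le_one_iff, neg_nonpos]
    have := variance_nonneg (fun ω => (A 0 0 ω : ℝ)) P
    positivity
  have hφ := h.tendsto_noiseCharFun ν (k + 1) t
  refine tendsto_zero_of_forall_bound fun η hη => ?_
  have hη' : 0 < η / (C + 1) := by positivity
  obtain ⟨N, hN⟩ := eventually_atTop.1 (Metric.tendsto_nhds.1 hφ (η / (C + 1)) hη')
  refine ⟨_, _, Eventually.of_forall fun x => ?_,
    ((h.tendsto_small_descendants k N).const_mul (2 * C)).const_add (C * (η / (C + 1))), ?_⟩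
  · have hm := (hF x).comp (h.isStationaryGWI.measurable_history k)
    have hXk := h.isStationaryGWI.measurable_X k
    rw [h.tailMean_history_mul_exp ν k t x (hF x) (hC x)]
    have e : tailMean P X x (fun ω => F x (history X k ω)) * q =
        tailMean P X x (fun ω => F x (history X k ω) * q) := by
      unfold tailMean
      rw [integral_mul_const, mul_assoc]
    rw [e]
    refine h.norm_tailMean_sub_le (hm.mul ((measurable_of_countable
      (noiseCharFun P A B μ ν (k + 1) t)).comp hXk)) (hm.mul measurable_const) (fun ω => ?_)
      (fun ω => ?_) (measurableSet_le measurable_const hXk) (by positivity) ?_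
    · rw [Pi.mul_apply, norm_mul]
      have := mul_le_mul (hC x (history X k ω))
        (norm_noiseCharFun_le (P := P) (A := A) (B := B) μ ν (k + 1) t (X k ω)) (norm_nonneg _) hC0
      exact this.trans_eq (mul_one C)
    · rw [Pi.mul_apply, norm_mul]
      have := mul_le_mul (hC x (history X k ω)) hq1 (norm_nonneg _) hC0
      exact this.trans_eq (mul_one C)
    · intro ω _ hωT
      simp only [Pi.mul_apply, Function.comp_apply]
      rw [← mul_sub, norm_mul]
      have h6 := (hN (X k ω) hωT).le
      rw [dist_eq_norm] at h6
      exact mul_le_mul (hC x _) h6 (norm_nonneg _) hC0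
  · rw [mul_zero, add_zero, ← mul_div_assoc, div_lt_iff₀ (by positivity)]
    nlinarith

/-- Given `X 0 > x`, the normalized increments are asymptotically Gaussian and independent of the
past. -/
lemma tendsto_tailMean_mul_prod (ν : ℝ) (n : ℕ) (t : ℕ → ℝ) {F : ℝ → (ℕ → ℕ) → ℂ} {C : ℝ}
    (hF : ∀ x, Measurable (F x)) (hC : ∀ x f, ‖F x f‖ ≤ C) :
    Tendsto (fun x => tailMean P X x (fun ω => F x (history X 0 ω) *
        ∏ k ∈ Finset.range n, Complex.exp ((t k * normalizedM μ ν X k ω : ℝ) * Complex.I)) -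
      tailMean P X x (fun ω => F x (history X 0 ω)) * ∏ k ∈ Finset.range n,
        Complex.exp (-(variance (fun ω => (A 0 0 ω : ℝ)) P * t k ^ 2 / 2 : ℝ))) atTop (𝓝 0) := by
  induction n with
  | zero => simp
  | succ n ih =>
    -- The first `n` increments belong to the past at time `n`. In that history `X k` is coordinate
    -- `n - k`, and the history up to time `0` starts at coordinate `n`.
    set F' : ℝ → (ℕ → ℕ) → ℂ := fun x f => F x (fun j => f (n + j)) *
      ∏ k ∈ Finset.range n, Complex.exp ((t k * (((f (n - (k + 1)) : ℝ) - μ * f (n - k) - ν) /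
        √(max (f (n - k) : ℝ) 1)) : ℝ) * Complex.I) with hF'
    have hF'm : ∀ x, Measurable (F' x) := by
      intro x
      have h1 : Measurable fun f : ℕ → ℕ => F x fun j => f (n + j) :=
        (hF x).comp (measurable_pi_lambda _ fun j => measurable_pi_apply _)
      refine h1.mul (Finset.measurable_prod _ fun k _ => ?_)
      fun_prop
    have hF'C : ∀ x f, ‖F' x f‖ ≤ C := by
      intro x f
      simp only [hF', norm_mul, norm_prod, Complex.norm_exp_ofReal_mul_I, Finset.prod_const_one,
        mul_one]
      exact hC _ _
    have hF'h : ∀ x ω, F' x (history X n ω) = F x (history X 0 ω) *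
        ∏ k ∈ Finset.range n, Complex.exp ((t k * normalizedM μ ν X k ω : ℝ) * Complex.I) := by
      intro x ω
      simp only [hF']
      congr 1
      · congr 1
        funext j
        simp only [history]
        congr 1
        push_cast
        ring
      · refine Finset.prod_congr rfl fun k hk => ?_
        rw [Finset.mem_range] at hk
        have e1 : (n : ℤ) - ((n - (k + 1) : ℕ) : ℤ) = k + 1 := by omega
        have e2 : (n : ℤ) - ((n - k : ℕ) : ℤ) = k := by omega
        simp only [history, normalizedM, M, e1, e2, add_sub_cancel_right]
    have h1 := h.tendsto_tailMean_mul_exp ν n (t n) hF'm hF'C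
    simp only [hF'h] at h1
    have h2 := h1.add (ih.mul_const
      (Complex.exp (-(variance (fun ω => (A 0 0 ω : ℝ)) P * t n ^ 2 / 2 : ℝ))))
    rw [zero_mul, add_zero] at h2
    refine h2.congr fun x => ?_
    simp only [Finset.prod_range_succ, ← mul_assoc]
    ring

end IsRegularGWI

/-- Only times `≤ 0` enter, so the coordinates `(-i).toNat` recover every value used; this provides
the function of the history needed to peel off increments. -/
lemma spineExp_history (m : ℕ) (s : Finset.Icc (-(m : ℤ)) (m : ℤ) → ℝ) (x : ℝ) (ω : Ω) :
    spineExp X μ m s x ω =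
      spineExp (fun (i : ℤ) (f : ℕ → ℕ) => f (-i).toNat) μ m s x (history X 0 ω) := by
  simp [spineExp, ancestorEvent, Set.indicator, history]

end GWI

/-! ### Characteristic functions of the limit vector. -/

namespace GWI

variable {Ω Ω' : Type*} [MeasurableSpace Ω] [MeasurableSpace Ω'] {P : Measure Ω}
  {P' : Measure Ω'} [IsProbabilityMeasure P'] {μ α : ℝ}

/-- The vector with the two blocks of coordinates of `v`. -/
def blockVec {ι κ : Type*} (v : (ι → ℝ) × (κ → ℝ)) : EuclideanSpace ℝ (ι ⊕ κ) :=
  WithLp.toLp 2 (Sum.elim v.1 v.2)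

lemma measurable_blockVec {ι κ : Type*} [Fintype ι] [Fintype κ] :
    Measurable (blockVec : (ι → ℝ) × (κ → ℝ) → EuclideanSpace ℝ (ι ⊕ κ)) := by
  refine (WithLp.measurable_toLp 2 (ι ⊕ κ → ℝ)).comp (measurable_pi_lambda _ fun j => ?_)
  cases j <;> simp only [Sum.elim_inl, Sum.elim_inr] <;> fun_prop

lemma charFun_map_blockVec {ι κ : Type*} [Fintype ι] [Fintype κ] (Q : Measure Ω)
    {U : Ω → (ι → ℝ) × (κ → ℝ)} (hU : Measurable U) (u : EuclideanSpace ℝ (ι ⊕ κ)) :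
    charFun (Q.map fun ω => blockVec (U ω)) u = ∫ ω, Complex.exp
      ((∑ i, u (Sum.inl i) * (U ω).1 i : ℝ) * Complex.I) * Complex.exp
        ((∑ k, u (Sum.inr k) * (U ω).2 k : ℝ) * Complex.I) ∂Q := by
  have hm : Measurable fun ω => blockVec (U ω) := measurable_blockVec.comp hU
  rw [charFun_apply, integral_map hm.aemeasurable
    (by fun_prop : Continuous fun x : EuclideanSpace ℝ (ι ⊕ κ) =>
      Complex.exp ((inner ℝ x u : ℝ) * Complex.I)).aestronglyMeasurable]
  refine integral_congr_ae (Eventually.of_forall fun ω => ?_)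
  simp only [PiLp.inner_apply, Fintype.sum_sum_type, blockVec, Sum.elim_inl, Sum.elim_inr]
  rw [← Complex.exp_add, ← add_mul, ← Complex.ofReal_add]
  simp

/-- **Lévy's continuity theorem** for random vectors with two blocks of coordinates. -/
lemma tendsto_law_of_tendsto_exp {ι κ : Type*} [Fintype ι] [Fintype κ]
    {Q : ℕ → Measure Ω} [∀ n, IsProbabilityMeasure (Q n)]
    {V : ℕ → Ω → (ι → ℝ) × (κ → ℝ)} (hV : ∀ n, Measurable (V n))
    {W : Ω' → (ι → ℝ) × (κ → ℝ)} (hW : Measurable W)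
    (hc : ∀ (s : ι → ℝ) (t : κ → ℝ), Tendsto (fun n => ∫ ω, Complex.exp
        ((∑ i, s i * (V n ω).1 i : ℝ) * Complex.I) * Complex.exp
          ((∑ k, t k * (V n ω).2 k : ℝ) * Complex.I) ∂(Q n)) atTop
      (𝓝 (∫ ω, Complex.exp ((∑ i, s i * (W ω).1 i : ℝ) * Complex.I) * Complex.exp
          ((∑ k, t k * (W ω).2 k : ℝ) * Complex.I) ∂P'))) :
    Tendsto (fun n => law (Q n) (V n)) atTop (𝓝 (law P' W)) := by
  let g : EuclideanSpace ℝ (ι ⊕ κ) → (ι → ℝ) × (κ → ℝ) := fun v =>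
    (fun i => v (Sum.inl i), fun k => v (Sum.inr k))
  have hVm : ∀ n, Measurable fun ω => blockVec (V n ω) := fun n => measurable_blockVec.comp (hV n)
  have hWm : Measurable fun ω => blockVec (W ω) := measurable_blockVec.comp hW
  have hg : Continuous g := by fun_prop
  let ν : ℕ → ProbabilityMeasure (EuclideanSpace ℝ (ι ⊕ κ)) := fun n =>
    ⟨(Q n).map fun ω => blockVec (V n ω),
      Measure.isProbabilityMeasure_map (hVm n).aemeasurable⟩
  let ν₀ : ProbabilityMeasure (EuclideanSpace ℝ (ι ⊕ κ)) :=
    ⟨P'.map fun ω => blockVec (W ω), Measure.isProbabilityMeasure_map hWm.aemeasurable⟩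
  have hν : Tendsto ν atTop (𝓝 ν₀) := by
    refine ProbabilityMeasure.tendsto_of_tendsto_charFun fun u => ?_
    simp only [ν, ν₀, ProbabilityMeasure.coe_mk, charFun_map_blockVec _ (hV _),
      charFun_map_blockVec _ hW]
    exact hc (fun i => u (Sum.inl i)) fun k => u (Sum.inr k)
  have h1 := (ProbabilityMeasure.tendsto_nhds_iff_toFiniteMeasure_tendsto_nhds _).1
    (ProbabilityMeasure.tendsto_map_of_tendsto_of_continuous ν ν₀ hν hg)
  have e1 : ∀ n, law (Q n) (V n) =
      ((ν n).map hg.measurable.aemeasurable).toFiniteMeasure := by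
    intro n
    refine Subtype.ext ?_
    change (Q n).map (V n) = ((Q n).map fun ω => blockVec (V n ω)).map g
    rw [Measure.map_map hg.measurable (hVm n)]
    rfl
  have e2 : law P' W = (ν₀.map hg.measurable.aemeasurable).toFiniteMeasure := by
    refine Subtype.ext ?_
    change P'.map W = (P'.map fun ω => blockVec (W ω)).map g
    rw [Measure.map_map hg.measurable hWm]
    rfl
  rw [e2]
  simp only [e1]
  exact h1

/-- Within the window from `-m` to `m`, only `min K m` matters, in parallel with the truncated age
of the big jump. -/
lemma sum_mul_tailProcess (m : ℕ) (s : Finset.Icc (-(m : ℤ)) (m : ℤ) → ℝ) (Y₀ : Ω' → ℝ)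
    (K : Ω' → ℕ) (ω : Ω') :
    ∑ i, s i * tailProcess μ Y₀ K i ω = spineCoeff μ m s (min (K ω) m) * Y₀ ω := by
  rw [spineCoeff, Finset.sum_mul]
  refine Finset.sum_congr rfl fun i _ => ?_
  have hi := Finset.mem_Icc.1 i.2
  rw [mul_assoc]
  congr 1
  unfold tailProcess
  split_ifs with h1 h2 h3 h4 h5
  · rfl
  · push_cast at h2; omega
  · rfl
  · rw [abs_of_neg (by omega)] at h3
    push_cast at h4; omega
  · rw [abs_of_neg (by omega)] at h3
    push_cast at h5; omega
  · simp

lemma measureReal_le_of_geometric {K : Ω' → ℕ} (hK_meas : Measurable K)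
    (hμ : 0 < μ) (hK : ∀ k : ℕ, P'.real {ω | K ω = k} = μ ^ (α * k) * (1 - μ ^ α)) (k : ℕ) :
    P'.real {ω | k ≤ K ω} = μ ^ (α * k) := by
  induction k with
  | zero => simp
  | succ k ih =>
    have e : {ω | k ≤ K ω} = {ω | k + 1 ≤ K ω} ∪ {ω | K ω = k} := by
      ext ω
      simp only [Set.mem_ofPred_eq, Set.mem_union]
      omega
    have hd : Disjoint {ω | k + 1 ≤ K ω} {ω | K ω = k} := by
      rw [Set.disjoint_left]
      intro ω h1 h2
      simp only [Set.mem_ofPred_eq] at h1 h2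
      omega
    rw [e, measureReal_union hd (hK_meas (measurableSet_singleton k)), hK] at ih
    have e2 : μ ^ (α * (k + 1 : ℕ)) = μ ^ (α * k) * μ ^ α := by
      rw [← Real.rpow_add hμ]
      congr 1
      push_cast
      ring
    rw [e2]
    linarith

lemma measureReal_min_eq_of_geometric {K : Ω' → ℕ} (hK_meas : Measurable K)
    (hμ : 0 < μ) (hK : ∀ k : ℕ, P'.real {ω | K ω = k} = μ ^ (α * k) * (1 - μ ^ α)) {m k : ℕ}
    (hk : k ≤ m) :
    P'.real {ω | min (K ω) m = k} =
      μ ^ (α * k) - if k < m then μ ^ (α * (k + 1 : ℕ)) else 0 := by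
  split_ifs with hkm
  · have e : {ω | min (K ω) m = k} = {ω | K ω = k} := by
      ext ω
      simp only [Set.mem_ofPred_eq]
      omega
    have e2 : μ ^ (α * (k + 1 : ℕ)) = μ ^ (α * k) * μ ^ α := by
      rw [← Real.rpow_add hμ]
      congr 1
      push_cast
      ring
    rw [e, hK, e2]
    ring
  · have e : {ω | min (K ω) m = k} = {ω | k ≤ K ω} := by
      ext ω
      simp only [Set.mem_ofPred_eq]
      omega
    rw [e, measureReal_le_of_geometric hK_meas hμ hK, sub_zero]

/-- Decomposing by the value of `min K m` and using independence of `Y₀` and `K` gives the same sum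
as the limit of `spineExp`. -/
lemma integral_exp_tailProcess {Y₀ : Ω' → ℝ} {K : Ω' → ℕ} (hY₀_meas : Measurable Y₀)
    (hK_meas : Measurable K) (hμ : 0 < μ)
    (hK : ∀ k : ℕ, P'.real {ω | K ω = k} = μ ^ (α * k) * (1 - μ ^ α))
    (hind : IndepFun Y₀ K P') (m : ℕ) (s : Finset.Icc (-(m : ℤ)) (m : ℤ) → ℝ) {L : ℝ → ℂ}
    (hL : ∀ θ : ℝ, ∫ ω, Complex.exp ((θ * Y₀ ω : ℝ) * Complex.I) ∂P' = L θ) :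
    ∫ ω, Complex.exp ((∑ i, s i * tailProcess μ Y₀ K i ω : ℝ) * Complex.I) ∂P' =
      ∑ k ∈ Finset.range (m + 1), ((μ ^ (α * k) : ℝ) * L (spineCoeff μ m s k) -
        if k < m then (μ ^ (α * (k + 1 : ℕ)) : ℝ) * L (spineCoeff μ m s k) else 0) := by
  let q : ℕ → ℕ → ℂ := fun k n => if min n m = k then 1 else 0
  have hq : ∀ k, Measurable (q k) := fun k => measurable_of_countable _
  have h1 : ∀ ω, Complex.exp ((∑ i, s i * tailProcess μ Y₀ K i ω : ℝ) * Complex.I) =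
      ∑ k ∈ Finset.range (m + 1),
        Complex.exp ((spineCoeff μ m s k * Y₀ ω : ℝ) * Complex.I) * q k (K ω) := by
    intro ω
    rw [sum_mul_tailProcess, Finset.sum_eq_single_of_mem (min (K ω) m)
      (Finset.mem_range.2 (by omega))]
    · simp [q]
    · intro k _ hk
      simp [q, hk.symm]
  simp only [h1]
  have hq1 : ∀ k n, ‖q k n‖ ≤ 1 := by
    intro k n
    simp only [q]
    split_ifs <;> simp
  rw [integral_finsetSum]
  · refine Finset.sum_congr rfl fun k hk => ?_
    have hi : IndepFun (fun ω => Complex.exp ((spineCoeff μ m s k * Y₀ ω : ℝ) * Complex.I))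
        (fun ω => q k (K ω)) P' :=
      hind.comp (φ := fun y : ℝ => Complex.exp ((spineCoeff μ m s k * y : ℝ) * Complex.I))
        (ψ := q k) (by fun_prop) (hq k)
    rw [hi.integral_fun_mul_eq_mul_integral (by fun_prop)
      ((hq k).comp hK_meas).aestronglyMeasurable, hL]
    have hset : MeasurableSet {ω | min (K ω) m = k} :=
      (hK_meas.min measurable_const) (measurableSet_singleton k)
    have h2 : ∫ ω, q k (K ω) ∂P' = (P'.real {ω | min (K ω) m = k} : ℂ) := by
      have e : (fun ω => q k (K ω)) = {ω | min (K ω) m = k}.indicator fun _ => (1 : ℂ) := by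
        funext ω
        simp only [q, Set.indicator, Set.mem_ofPred_eq]
      rw [e, integral_indicator hset, setIntegral_const]
      simp
    rw [h2, measureReal_min_eq_of_geometric hK_meas hμ hK (by
      have := Finset.mem_range.1 hk; omega)]
    split_ifs <;> push_cast <;> ring
  · intro k _
    refine integrable_of_norm_le_one (by
      have := (hq k).comp hK_meas
      have e : Measurable fun ω => q k (K ω) := this
      fun_prop) fun ω => ?_
    rw [norm_mul, Complex.norm_exp_ofReal_mul_I, one_mul]
    exact hq1 _ _

lemma measurable_tailProcess {Y₀ : Ω' → ℝ} {K : Ω' → ℕ} (hY₀_meas : Measurable Y₀)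
    (hK_meas : Measurable K) (i : ℤ) : Measurable (tailProcess μ Y₀ K i) := by
  unfold tailProcess
  refine Measurable.ite (by simp) (by fun_prop) (Measurable.ite ?_ (by fun_prop) (by fun_prop))
  exact hK_meas (t := {n : ℕ | |i| ≤ (n : ℤ)}) (MeasurableSet.of_discrete)

/-- The characteristic function of the limit factorizes. -/
lemma integral_exp_tailProcess_mul_exp {Y₀ : Ω' → ℝ} {K : Ω' → ℕ} {Z : ℕ → Ω' → ℝ} {v : ℝ}
    (hv : 0 ≤ v) (hY₀_meas : Measurable Y₀) (hK_meas : Measurable K)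
    (hZ_meas : ∀ i, Measurable (Z i)) (hZ : ∀ i, P'.map (Z i) = gaussianReal 0 v.toNNReal)
    (hZ_indep : iIndepFun Z P')
    (hYKZ_indep : IndepFun (fun ω => (Y₀ ω, K ω)) (fun (ω : Ω') (i : ℕ) => Z i ω) P')
    (m n : ℕ) (s : Finset.Icc (-(m : ℤ)) (m : ℤ) → ℝ) (t : Fin n → ℝ) :
    ∫ ω, Complex.exp ((∑ i, s i * tailProcess μ Y₀ K i ω : ℝ) * Complex.I) *
        Complex.exp ((∑ k, t k * Z k ω : ℝ) * Complex.I) ∂P' =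
      (∫ ω, Complex.exp ((∑ i, s i * tailProcess μ Y₀ K i ω : ℝ) * Complex.I) ∂P') *
        ∏ k, Complex.exp (-(v * t k ^ 2 / 2 : ℝ)) := by
  have hi : IndepFun
      (fun ω => Complex.exp ((∑ i, s i * tailProcess μ Y₀ K i ω : ℝ) * Complex.I))
      (fun ω => Complex.exp ((∑ k, t k * Z k ω : ℝ) * Complex.I)) P' := by
    refine hYKZ_indep.comp (φ := fun p : ℝ × ℕ => Complex.exp
      ((∑ i, s i * tailProcess μ Prod.fst Prod.snd i p : ℝ) * Complex.I))
      (ψ := fun z : ℕ → ℝ => Complex.exp ((∑ k, t k * z k : ℝ) * Complex.I)) ?_ (by fun_prop)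
    have := fun i => measurable_tailProcess (μ := μ) (Y₀ := (Prod.fst : ℝ × ℕ → ℝ))
      (K := Prod.snd) measurable_fst measurable_snd i
    fun_prop
  have hY := fun i => measurable_tailProcess (μ := μ) hY₀_meas hK_meas i
  rw [hi.integral_fun_mul_eq_mul_integral (by fun_prop) (by fun_prop)]
  congr 1
  have hZi : iIndepFun (fun (k : Fin n) ω => Complex.exp ((t k * Z k ω : ℝ) * Complex.I)) P' :=
    (hZ_indep.precomp (g := fun k : Fin n => (k : ℕ)) Fin.val_injective).comp
      (fun k y => Complex.exp ((t k * y : ℝ) * Complex.I)) fun k => by fun_prop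
  have e : ∀ ω, Complex.exp ((∑ k, t k * Z k ω : ℝ) * Complex.I) =
      ∏ k, Complex.exp ((t k * Z k ω : ℝ) * Complex.I) := by
    intro ω
    rw [← Complex.exp_sum, Complex.ofReal_sum, Finset.sum_mul]
  simp only [e]
  rw [hZi.integral_fun_prod_eq_prod_integral fun k => by fun_prop]
  refine Finset.prod_congr rfl fun k _ => ?_
  have h2 := charFun_gaussianReal (μ := 0) (v := v.toNNReal) (t k)
  rw [← hZ k, charFun_apply_real, integral_map (hZ_meas k).aemeasurable (by fun_prop)] at h2
  push_cast
  rw [h2, Real.coe_toNNReal v hv]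
  congr 1
  push_cast
  ring

namespace IsRegularGWI

variable [IsProbabilityMeasure P] {X : ℤ → Ω → ℕ} {A : ℤ → ℕ → Ω → ℕ} {B : ℤ → Ω → ℕ}
  (h : IsRegularGWI P X A B μ α)
include h

lemma measurable_normalizedM (ν : ℝ) (k : ℤ) : Measurable (normalizedM μ ν X k) := by
  have h1 := h.measurable_realX
  unfold normalizedM M
  fun_prop

lemma measurable_scaledVec (ν : ℝ) (m : ℕ) (x : ℝ) : Measurable (scaledVec μ ν X m x) := by
  have h1 := h.measurable_realX
  unfold scaledVec M
  fun_prop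

lemma tendsto_tailMean_exp_mul_prod (ν : ℝ) (m n : ℕ)
    (s : Finset.Icc (-(m : ℤ)) (m : ℤ) → ℝ) (t : ℕ → ℝ) {L : ℝ → ℂ}
    (hL : ∀ θ : ℝ, Tendsto (fun x : ℝ => tailMean P X x fun ω =>
      Complex.exp ((θ * (X 0 ω / x) : ℝ) * Complex.I)) atTop (𝓝 (L θ))) :
    Tendsto (fun x : ℝ => tailMean P X x fun ω =>
        Complex.exp ((∑ i, s i * (X i ω / x) : ℝ) * Complex.I) *
          ∏ k ∈ Finset.range n, Complex.exp ((t k * normalizedM μ ν X k ω : ℝ) * Complex.I)) atTop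
      (𝓝 ((∑ k ∈ Finset.range (m + 1), ((μ ^ (α * k) : ℝ) * L (spineCoeff μ m s k) -
        if k < m then (μ ^ (α * (k + 1 : ℕ)) : ℝ) * L (spineCoeff μ m s k) else 0)) *
        ∏ k ∈ Finset.range n,
          Complex.exp (-(variance (fun ω => (A 0 0 ω : ℝ)) P * t k ^ 2 / 2 : ℝ)))) := by
  have hM := h.measurable_normalizedM ν
  have h1 := h.tendsto_tailMean_sub_spineExp m s
    (G := fun _ ω => ∏ k ∈ Finset.range n,
      Complex.exp ((t k * normalizedM μ ν X k ω : ℝ) * Complex.I)) (fun x => by fun_prop)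
    (fun x ω => by simp only [norm_prod, Complex.norm_exp_ofReal_mul_I, Finset.prod_const_one, le_refl])
  have h2 := h.tendsto_tailMean_mul_prod ν n t
    (F := fun x => spineExp (fun (i : ℤ) (f : ℕ → ℕ) => f (-i).toNat) μ m s x)
    (fun x => measurable_spineExp (fun k => by fun_prop) m s x)
    (fun x f => norm_spineExp_le m s x f)
  simp only [← spineExp_history] at h2
  have h3 := (h1.add h2).add ((h.tendsto_tailMean_spineExp m s hL).mul_const
    (∏ k ∈ Finset.range n,
      Complex.exp (-(variance (fun ω => (A 0 0 ω : ℝ)) P * t k ^ 2 / 2 : ℝ))))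
  rw [zero_add, zero_add] at h3
  refine h3.congr fun x => ?_
  ring

end IsRegularGWI

end GWI

end

/-! ### Identification of the limit. -/

theorem proposition2p1
    {Ω Ω' : Type*} [MeasurableSpace Ω] [MeasurableSpace Ω']
    (P : Measure Ω) [IsProbabilityMeasure P] (P' : Measure Ω') [IsProbabilityMeasure P']
    -- the stationary process with its offspring and immigration variables
    (X : ℤ → Ω → ℕ) (A : ℤ → ℕ → Ω → ℕ) (B : ℤ → Ω → ℕ)
    (hX : GWI.IsStationaryGWI P X A B)
    (μA μB σA2 α : ℝ)
    (hμA_def : μA = ∫ ω, (A 0 0 ω : ℝ) ∂P)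
    (hμB_def : μB = ∫ ω, (B 0 ω : ℝ) ∂P)
    (hσA2_def : σA2 = variance (fun ω => (A 0 0 ω : ℝ)) P)
    -- the standing conditions; the second one includes that the variance is finite
    (hμA : μA ∈ Set.Ioo (0 : ℝ) 1)
    (hA_sq : MemLp (fun ω => (A 0 0 ω : ℝ)) 2 P) (hσA2 : 0 < σA2)
    (hα : α ∈ Set.Ioo (1 : ℝ) 2)
    (hB : GWI.IsRegularlyVarying P (fun ω => (B 0 ω : ℝ)) α)
    -- the variables that make up the limit
    (Y₀ : Ω' → ℝ) (K : Ω' → ℕ) (Z : ℕ → Ω' → ℝ)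
    (hY₀_meas : Measurable Y₀) (hK_meas : Measurable K) (hZ_meas : ∀ i, Measurable (Z i))
    (hY₀ : ∀ y : ℝ, 1 ≤ y → P'.real {ω | y ≤ Y₀ ω} = y ^ (-α))
    (hK : ∀ k : ℕ, P'.real {ω | K ω = k} = μA ^ (α * k) * (1 - μA ^ α))
    (hZ : ∀ i, P'.map (Z i) = gaussianReal 0 σA2.toNNReal)
    (hY₀K_indep : IndepFun Y₀ K P')
    (hZ_indep : iIndepFun Z P')
    (hYKZ_indep : IndepFun (fun ω => (Y₀ ω, K ω)) (fun (ω : Ω') (i : ℕ) => Z i ω) P')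
    (m : ℕ) :
    Tendsto
      (fun x : ℝ => GWI.condLaw P (GWI.scaledVec μA μB X m x) {ω | x < (X 0 ω : ℝ)})
      atTop
      (𝓝 (GWI.law P' (GWI.limitVec μA Y₀ K Z m))) := by
  have h : GWI.IsRegularGWI P X A B μA α := ⟨hX, hμA_def, hμA, hA_sq, hα, hB⟩
  set L : ℝ → ℂ := fun θ => ∫ ω, Complex.exp ((θ * Y₀ ω : ℝ) * Complex.I) ∂P'
  have hY := fun i : ℤ => GWI.measurable_tailProcess (μ := μA) hY₀_meas hK_meas i
  have hW : Measurable (GWI.limitVec μA Y₀ K Z m) := by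
    unfold GWI.limitVec
    fun_prop
  -- The continuity theorem is applied to sequences, which suffice because `atTop` on `ℝ` is
  -- countably generated.
  refine tendsto_of_seq_tendsto fun u hu => ?_
  have hprob : ∀ n, IsProbabilityMeasure (cond P {ω | u n < (X 0 ω : ℝ)}) := fun n =>
    cond_isProbabilityMeasure fun h0 =>
      (h.isRVTail_tail.pos (u n)).ne' (by rw [GWI.tail, measureReal_def, h0, ENNReal.toReal_zero])
  refine GWI.tendsto_law_of_tendsto_exp (fun n => h.measurable_scaledVec μB m (u n)) hW
    fun s t => ?_
  have hlim := h.tendsto_tailMean_exp_mul_prod μB m (m + 1) s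
    -- The peeling lemma takes frequencies indexed by `ℕ`; the value `0` outside the range is never
    -- reached.
    (fun k => if hk : k < m + 1 then t ⟨k, hk⟩ else 0) (L := L)
    (h.tendsto_tailMean_exp hY₀_meas hY₀)
  have e1 := GWI.integral_exp_tailProcess_mul_exp hσA2.le hY₀_meas hK_meas hZ_meas hZ hZ_indep
    hYKZ_indep m (m + 1) s t (μ := μA)
  rw [GWI.integral_exp_tailProcess hY₀_meas hK_meas hμA.1 hK hY₀K_indep m s (L := L)
    fun θ => rfl] at e1
  simp only [GWI.limitVec]
  rw [e1]
  simp only [Finset.prod_range, Fin.is_lt, dite_true, ← hσA2_def] at hlim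
  refine (hlim.comp hu).congr fun n => ?_
  rw [GWI.integral_cond_eq_tailMean, Function.comp_apply]
  congr 1
  funext ω
  rw [← Complex.exp_sum, Complex.ofReal_sum (s := Finset.univ) (f := fun k => t k * _),
    Finset.sum_mul]
  rfl
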